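/- Let $F$ be a connected oriented surface, possibly with boundary and not necessarily compact, with finitely many distinguished input and output points on its boundary. Diagrams in $F$ are non-empty oriented diagrams, made up of arcs joining the inputs to the outputs and of closed curves, with finitely many transverse double points, each with over/under information. Put $z=s-s^{-1}$, and let $\Lambda$ be ${\bf Z}[v^{\pm1},s^{\pm1}]$ localised at the elements $s^r-s^{-r}$, $r\ge 1$. The Homfly skein of $F$ is the $\Lambda$-module of linear combinations of diagrams in $F$, up to isotopy and Reidemeister moves II and III, modulo the relations $D_+-D_-=z\,D_0$ (where $D_+$, $D_-$, $D_0$ differ only at one crossing, which is positive, negative and smoothed according to the orientation, respectively), $D=v^{-1}D'$ if $D'$ arises from $D$ by removing a positive curl, and $D=vD'$ if $D'$ arises from $D$ by removing a negative curl. A resolution tree for a diagram $D$ is a finite directed tree of diagrams in $F$, considered up to isotopy and Reidemeister moves II and III, with initial vertex $D$ and with either one or two edges leaving each internal vertex. Two edges lead to the diagrams in which one crossing of the current diagram is switched, respectively smoothed. A single edge performs a Reidemeister move of type I (in either direction) on the current diagram, or removes from it a null-homotopic closed curve without crossings, that is, a closed curve without crossings that bounds a disc in $F$ (the disc may contain other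 parts of the diagram). Write $k(D)$ for the number of closed curves of $D$ that are null-homotopic in $F$. **Lemma.** Let $D$ be a diagram in $F$ with a resolution tree whose end vertices carry the diagrams $D_i$, $i\in I$. Then there are $c_i\in{\bf Z}[v^{\pm1},z]$, $i \in I$, such that $$z^{k(D)}D=\sum_{i\in I}c_i\,z^{k(D_i)}D_i$$ in the Homfly skein of $F$. -/

import Mathlib

namespace HomflySkein

open Topology unitInterval

universe u

/-! ## Surfaces -/

section Surfaces

variable {F : Type u} [TopologicalSpace F]

/-- A point of a surface is interior if it has a neighbourhood homeomorphic to the plane. -/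
def IsInteriorPoint (x : F) : Prop :=
  ∃ φ : ℂ → F, IsOpenEmbedding φ ∧ x ∈ Set.range φ

/-- A connected oriented surface, possibly with boundary and not necessarily compact, with
distinguished input and output points on its boundary. The orientation is a choice, among the
embedded open discs `φ : ℂ → F`, of the positively oriented ones: the choice does not change under
isotopy of embeddings, and exactly one of `φ` and its mirror image `φ ∘ conj` is chosen. -/
structure MarkedSurface (F : Type u) [TopologicalSpace F] where
  t2 : T2Space F
  secondCountable : SecondCountableTopology F
  connected : ConnectedSpace F
  chart : ∀ x : F, IsInteriorPoint x ∨
    ∃ φ : {w : ℂ // 0 ≤ w.im} → F, IsOpenEmbedding φ ∧ φ ⟨0, le_rfl⟩ = x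
  numIn : ℕ
  numOut : ℕ
  inputs : Fin numIn → F
  outputs : Fin numOut → F
  marked_injective : Function.Injective (Sum.elim inputs outputs)
  marked_boundary : ∀ i, ¬ IsInteriorPoint (Sum.elim inputs outputs i)
  pos : Set (ℂ → F)
  pos_isOpenEmbedding : ∀ φ ∈ pos, IsOpenEmbedding φ
  pos_mirror : ∀ φ : ℂ → F, IsOpenEmbedding φ →
    (φ ∈ pos ↔ (fun w => φ (starRingEnd ℂ w)) ∉ pos)
  pos_isotopy : ∀ Φ : I → ℂ → F, Continuous (fun p : I × ℂ => Φ p.1 p.2) →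
    (∀ t, IsOpenEmbedding (Φ t)) → Φ 0 ∈ pos → Φ 1 ∈ pos

/-- Near the parameter `t` the path `γ` runs, inside the disc `φ`, along the line through `0` in
the direction of `d`. -/
def RunsAlong (φ : ℂ → F) (d : ℂ) (γ : I → F) (t : I) : Prop :=
  φ 0 = γ t ∧
  (∀ᶠ s in 𝓝[>] t, γ s ∈ φ '' {w | ∃ r : ℝ, 0 < r ∧ w = r * d}) ∧
  (∀ᶠ s in 𝓝[<] t, γ s ∈ φ '' {w | ∃ r : ℝ, r < 0 ∧ w = r * d})

end Surfaces

/-! ## Diagrams -/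

/-- A (non-empty) oriented diagram in the surface, presented by cutting its curves into `n`
directed pieces. The bijection `next` says what follows an input point or the end of a piece: the
start of a piece, or an output point. Thus the pieces are joined up into arcs, from the inputs to
the outputs, and closed curves. The only multiple points are finitely many transverse double
points, the crossings; `above x y` says that at a crossing the strand at the parameter `x` passes
over the strand at `y`. Away from finitely many corners, the pieces are locally straight in
suitable charts (every simple arc in a surface is). A diagram meets the boundary of the surface only in the marked points. -/
structure PieceDiagram {F : Type u} [TopologicalSpace F] (S : MarkedSurface F) (n : ℕ) where
  pieces_pos : 0 < n
  path : Fin n → C(I, F)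
  next : Fin S.numIn ⊕ Fin n ≃ Fin S.numOut ⊕ Fin n
  above : Fin n × I → Fin n × I → Prop
  join : ∀ x, Sum.elim S.inputs (fun e => path e 1) x =
    Sum.elim S.outputs (fun e => path e 0) (next x)
  boundary : ∀ e t, ¬ IsInteriorPoint (path e t) →
    (t = 0 ∧ ∃ a, next (Sum.inl a) = Sum.inr e) ∨ (t = 1 ∧ ∃ b, next (Sum.inr e) = Sum.inl b)
  above_point : ∀ x y, above x y → path x.1 x.2 = path y.1 y.2
  above_ne : ∀ x y, above x y → x ≠ y
  above_asymm : ∀ x y, above x y → ¬ above y x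
  above_inside : ∀ x y, above x y → x.2 ∈ Set.Ioo 0 1 ∧ y.2 ∈ Set.Ioo 0 1
  above_finite : {p : (Fin n × I) × (Fin n × I) | above p.1 p.2}.Finite
  no_triple : ∀ x y z, (above x y ∨ above y x) → (above x z ∨ above z x) → y = z
  meet : ∀ x y : Fin n × I, path x.1 x.2 = path y.1 y.2 → x = y ∨ above x y ∨ above y x ∨
    (x.2 = 1 ∧ y.2 = 0 ∧ next (Sum.inr x.1) = Sum.inr y.1) ∨
    (y.2 = 1 ∧ x.2 = 0 ∧ next (Sum.inr y.1) = Sum.inr x.1)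
  flat : ∀ e, {t | ¬ ∃ φ : ℂ → F, IsOpenEmbedding φ ∧ RunsAlong φ 1 (path e) t}.Finite
  transverse : ∀ x y, above x y → ∃ φ : ℂ → F, IsOpenEmbedding φ ∧
    RunsAlong φ 1 (path x.1) x.2 ∧ RunsAlong φ Complex.I (path y.1) y.2

/-- Diagrams, presented by any number of pieces. -/
abbrev Diagram {F : Type u} [TopologicalSpace F] (S : MarkedSurface F) : Type u :=
  Σ n : ℕ, PieceDiagram S n

namespace PieceDiagram

variable {F : Type u} [TopologicalSpace F] {S : MarkedSurface F} {n m : ℕ}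

/-- The crossing of the over-strand at `x` with the under-strand at `y` is positive: the direction
of the over-strand, then that of the under-strand, form a positively oriented frame. -/
def IsPositive (D : PieceDiagram S n) (x y : Fin n × I) : Prop :=
  D.above x y ∧ ∃ φ ∈ S.pos,
    RunsAlong φ 1 (D.path x.1) x.2 ∧ RunsAlong φ Complex.I (D.path y.1) y.2

/-- The crossing of the over-strand at `x` with the under-strand at `y` is negative. -/
def IsNegative (D : PieceDiagram S n) (x y : Fin n × I) : Prop :=
  D.above x y ∧ ∃ φ ∈ S.pos,
    RunsAlong φ Complex.I (D.path x.1) x.2 ∧ RunsAlong φ 1 (D.path y.1) y.2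

/-! ### Closed curves and null-homotopy -/

/-- A piece as a path between its end points. -/
def piece (D : PieceDiagram S n) (e : Fin n) : Path (D.path e 0) (D.path e 1) where
  toContinuousMap := D.path e
  source' := rfl
  target' := rfl

/-- The path is the concatenation of the listed pieces, in this order. -/
inductive Traces (D : PieceDiagram S n) : List (Fin n) → {x y : F} → Path x y → Prop
  | nil (x : F) : Traces D [] (Path.refl x)
  | cons (e : Fin n) {l : List (Fin n)} {x y : F} (p : Path x y) (h : D.path e 1 = x) :
      Traces D l p → Traces D (e :: l) ((D.piece e).trans (p.cast h rfl))

/-- The distinct pieces `e :: l`, in this cyclic order, make up a closed curve of the diagram. -/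
def IsClosedCurve (D : PieceDiagram S n) (e : Fin n) (l : List (Fin n)) : Prop :=
  (e :: l).Nodup ∧
  List.IsChain (fun a b => D.next (Sum.inr a) = Sum.inr b) (e :: (l ++ [e]))

/-- The closed curve made up of the pieces `e :: l` is null-homotopic in the surface. -/
def IsNullHomotopic (D : PieceDiagram S n) (e : Fin n) (l : List (Fin n)) : Prop :=
  ∃ (x : F) (p : Path x x), D.Traces (e :: l) p ∧ p.Homotopic (Path.refl x)

/-- The number of null-homotopic closed curves of the diagram. A closed curve is identified by the
set of its pieces. -/
noncomputable def numNull (D : PieceDiagram S n) : ℕ :=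
  Set.ncard {s : Finset (Fin n) | ∃ e l, s = (e :: l).toFinset ∧
    D.IsClosedCurve e l ∧ D.IsNullHomotopic e l}

/-! ### Different presentations of a diagram; isotopy and Reidemeister moves II and III -/

/-- `D'` presents the same diagram as `D`: the pieces of `D` have been reparametrised,
renumbered, and cut further. The piece `e` of `D'` is the part `τ e` of the piece `π e` of `D`. -/
def Subdivides (D' : PieceDiagram S n) (D : PieceDiagram S m) : Prop :=
  ∃ (π : Fin n → Fin m) (τ : Fin n → I → I),
    (∀ e, Continuous (τ e) ∧ StrictMono (τ e)) ∧
    (∀ x : Fin m × I, ∃ e t, (π e, τ e t) = x) ∧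
    (∀ e t, D'.path e t = D.path (π e) (τ e t)) ∧
    (∀ x y : Fin n × I, D'.above x y ↔ D.above (π x.1, τ x.1 x.2) (π y.1, τ y.1 y.2)) ∧
    (∀ e f, D'.next (Sum.inr e) = Sum.inr f ↔ (π e = π f ∧ τ e 1 = τ f 0) ∨
      (τ e 1 = 1 ∧ τ f 0 = 0 ∧ D.next (Sum.inr (π e)) = Sum.inr (π f))) ∧
    (∀ a e, D'.next (Sum.inl a) = Sum.inr e ↔
      τ e 0 = 0 ∧ D.next (Sum.inl a) = Sum.inr (π e)) ∧
    (∀ e b, D'.next (Sum.inr e) = Sum.inl b ↔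
      τ e 1 = 1 ∧ D.next (Sum.inr (π e)) = Sum.inl b)

/-- `D'` arises from `D` by moving the pieces in `A`, which lie above all other pieces, by an
isotopy `H` of the surface that is the identity on the boundary of the surface and near the
points where pieces in `A` are joined to other pieces; the other pieces stay where they are.
With all pieces in `A` this is isotopy of diagrams. With `A` a strand passing over one other strand
in a disc, respectively over the crossing of two other strands, it is a Reidemeister move of
type II, respectively III. -/
def LayerIsotopic (D D' : PieceDiagram S n) : Prop :=
  D'.next = D.next ∧ ∃ (A : Set (Fin n)) (H : I → F ≃ₜ F),
    Continuous (fun p : I × F => H p.1 p.2) ∧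
    (∀ x, H 0 x = x) ∧
    (∀ t x, ¬ IsInteriorPoint x → H t x = x) ∧
    (∀ e f, D.next (Sum.inr e) = Sum.inr f → ¬ (e ∈ A ↔ f ∈ A) →
      ∃ U ∈ 𝓝 (D.path e 1), ∀ t, ∀ x ∈ U, H t x = x) ∧
    (∀ e ∈ A, ∀ t, D'.path e t = H 1 (D.path e t)) ∧
    (∀ e ∉ A, D'.path e = D.path e) ∧
    (∀ x y : Fin n × I, (x.1 ∈ A ↔ y.1 ∈ A) → (D'.above x y ↔ D.above x y)) ∧
    (∀ x y : Fin n × I, x.1 ∉ A → y.1 ∈ A → ¬ D.above x y ∧ ¬ D'.above x y)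

/-! ### Switching and smoothing a crossing -/

/-- `D'` arises from `D` by switching the crossing at which `x` passes over `y`. -/
def IsSwitch (D D' : PieceDiagram S n) (x y : Fin n × I) : Prop :=
  D.above x y ∧ D'.path = D.path ∧ D'.next = D.next ∧
  ∀ u w, D'.above u w ↔ (D.above u w ∧ ¬ (u = x ∧ w = y)) ∨ (u = y ∧ w = x)

/-- The piece `a` crosses the disc `φ '' closedBall 0 1` from boundary to boundary. -/
def IsProperIn (D : PieceDiagram S n) (φ : ℂ → F) (a : Fin n) : Prop :=
  (∀ t ∈ Set.Ioo (0 : I) 1, D.path a t ∈ φ '' Metric.ball 0 1) ∧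
  D.path a 0 ∈ φ '' Metric.sphere 0 1 ∧ D.path a 1 ∈ φ '' Metric.sphere 0 1

/-- `D₀` arises from `D` by smoothing the crossing at which `x` passes over `y`. In a disc which
contains only two pieces `a`, `b` of `D`, with this single crossing, these are replaced by disjoint
simple arcs, one from the start of `a` to the end of `b`, one from the start of `b` to the end
of `a`. -/
def IsSmoothing (D D₀ : PieceDiagram S n) (x y : Fin n × I) : Prop :=
  D.above x y ∧ x.1 ≠ y.1 ∧
  D.path x.1 1 ≠ D.path y.1 0 ∧ D.path y.1 1 ≠ D.path x.1 0 ∧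
  (∃ φ : ℂ → F, IsOpenEmbedding φ ∧
    D.IsProperIn φ x.1 ∧ D.IsProperIn φ y.1 ∧ D₀.IsProperIn φ x.1 ∧ D₀.IsProperIn φ y.1 ∧
    ∀ e, e ≠ x.1 → e ≠ y.1 → ∀ t, D.path e t ∉ φ '' Metric.ball 0 1) ∧
  (∀ u w, D.above u w → (u.1 = x.1 ∨ u.1 = y.1 ∨ w.1 = x.1 ∨ w.1 = y.1) → u = x ∧ w = y) ∧
  (∀ u w, D₀.above u w ↔ D.above u w ∧ ¬ (u = x ∧ w = y)) ∧
  (∀ e, e ≠ x.1 → e ≠ y.1 → D₀.path e = D.path e) ∧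
  D₀.path x.1 0 = D.path x.1 0 ∧ D₀.path x.1 1 = D.path y.1 1 ∧
  D₀.path y.1 0 = D.path y.1 0 ∧ D₀.path y.1 1 = D.path x.1 1 ∧
  ∀ z, D₀.next z = D.next (Equiv.swap (Sum.inr x.1) (Sum.inr y.1) z)

/-! ### Reidemeister move I and removal of a closed curve -/

/-- `D'` arises from `D` by removing a curl, that is, by a Reidemeister move of type I. In a disc
which contains a single piece of `D`, with just one crossing, where `x` passes over `y`, this piece
is replaced by a simple arc with the same end points. -/
def IsCurlRemoval (D D' : PieceDiagram S n) (x y : Fin n × I) : Prop :=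
  D.above x y ∧ x.1 = y.1 ∧ D.path x.1 0 ≠ D.path x.1 1 ∧
  (∃ φ : ℂ → F, IsOpenEmbedding φ ∧ D.IsProperIn φ x.1 ∧ D'.IsProperIn φ x.1 ∧
    ∀ e, e ≠ x.1 → ∀ t, D.path e t ∉ φ '' Metric.ball 0 1) ∧
  (∀ u w, D.above u w → (u.1 = x.1 ∨ w.1 = x.1) → u = x ∧ w = y) ∧
  (∀ u w, D'.above u w ↔ D.above u w ∧ ¬ (u = x ∧ w = y)) ∧
  (∀ e, e ≠ x.1 → D'.path e = D.path e) ∧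
  D'.path x.1 0 = D.path x.1 0 ∧ D'.path x.1 1 = D.path x.1 1 ∧
  D'.next = D.next

/-- `D'` arises from `D` by removing a closed curve without crossings that bounds a disc in the
surface. Other parts of the diagram may lie inside the disc. A closed curve without crossings in a
surface bounds a disc if and only if it is null-homotopic. -/
def IsCircleRemoval (D : PieceDiagram S (n + 1)) (D' : PieceDiagram S n) : Prop :=
  ∃ c : Fin (n + 1),
    D.next (Sum.inr c) = Sum.inr c ∧
    (∀ u w, D.above u w → u.1 ≠ c ∧ w.1 ≠ c) ∧
    (∃ φ : ℂ → F, IsOpenEmbedding φ ∧ Set.range (D.path c) = φ '' Metric.sphere 0 1) ∧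
    (∀ e, D'.path e = D.path (c.succAbove e)) ∧
    (∀ x y : Fin n × I,
      D'.above x y ↔ D.above (c.succAbove x.1, x.2) (c.succAbove y.1, y.2)) ∧
    (∀ z, Sum.map id c.succAbove (D'.next z) = D.next (Sum.map id c.succAbove z))

end PieceDiagram

/-! ## The coefficient ring -/

open LaurentPolynomial in
/-- The denominators `s ^ r - s ^ (-r)`, `r ≥ 1`, in `ℤ[v^±1][s^±1]`. -/
noncomputable def denominators : Submonoid (LaurentPolynomial (LaurentPolynomial ℤ)) :=
  Submonoid.closure {x | ∃ r : ℕ, 1 ≤ r ∧ x = T (r : ℤ) - T (-(r : ℤ))}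

/-- The coefficient ring `ℤ[v^±1, s^±1]` with denominators `s ^ r - s ^ (-r)`, `r ≥ 1`. -/
def Coeff : Type := Localization denominators

noncomputable instance : CommRing Coeff := inferInstanceAs (CommRing (Localization denominators))

noncomputable instance : Algebra (LaurentPolynomial (LaurentPolynomial ℤ)) Coeff :=
  inferInstanceAs (Algebra _ (Localization denominators))

instance : IsLocalization denominators Coeff :=
  inferInstanceAs (IsLocalization denominators (Localization denominators))

noncomputable section

/-- The element `v` of the coefficient ring. -/
def v : Coeff :=
  algebraMap _ _ (LaurentPolynomial.C (LaurentPolynomial.T 1) :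
    LaurentPolynomial (LaurentPolynomial ℤ))

/-- The inverse of `v`. -/
def vInv : Coeff :=
  algebraMap _ _ (LaurentPolynomial.C (LaurentPolynomial.T (-1)) :
    LaurentPolynomial (LaurentPolynomial ℤ))

/-- The element `z = s - s⁻¹` of the coefficient ring. -/
def z : Coeff :=
  algebraMap _ _ (LaurentPolynomial.T 1 - LaurentPolynomial.T (-1) :
    LaurentPolynomial (LaurentPolynomial ℤ))

/-- The subring `ℤ[v^±1, z]` of the coefficient ring. -/
def integral : Subring Coeff := Subring.closure {v, vInv, z}

/-! ## The skein -/

variable {F : Type u} [TopologicalSpace F]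

/-- One step of regular isotopy: a change of presentation, or an isotopy of an upper part
of the diagram. -/
inductive IsotopyStep (S : MarkedSurface F) : Diagram S → Diagram S → Prop
  | subdivide {m n : ℕ} {D : PieceDiagram S m} {D' : PieceDiagram S n} (h : D'.Subdivides D) :
      IsotopyStep S ⟨m, D⟩ ⟨n, D'⟩
  | layer {n : ℕ} {D D' : PieceDiagram S n} (h : D.LayerIsotopic D') :
      IsotopyStep S ⟨n, D⟩ ⟨n, D'⟩

/-- Two diagrams agree up to isotopy and Reidemeister moves II and III. -/
def RegularlyIsotopic {S : MarkedSurface F} : Diagram S → Diagram S → Prop :=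
  Relation.EqvGen (IsotopyStep S)

/-- The formal combination of diagrams consisting of one diagram with coefficient `1`. -/
def formal {S : MarkedSurface F} {n : ℕ} (D : PieceDiagram S n) : Diagram S →₀ Coeff :=
  Finsupp.single ⟨n, D⟩ 1

/-- The defining relations of the skein: regular isotopy, the relation `D₊ - D₋ = z D₀`, and the
removal of a positive or negative curl at the expense of `v⁻¹` or `v`. -/
inductive SkeinRelation (S : MarkedSurface F) : (Diagram S →₀ Coeff) → Prop
  | isotopy {D D' : Diagram S} (h : IsotopyStep S D D') :
      SkeinRelation S (Finsupp.single D 1 - Finsupp.single D' 1)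
  | crossing {n : ℕ} {D D' D₀ : PieceDiagram S n} {x y : Fin n × I} (h : D.IsPositive x y)
      (h' : D.IsSwitch D' x y) (h₀ : D.IsSmoothing D₀ x y) :
      SkeinRelation S (formal D - formal D' - z • formal D₀)
  | positiveCurl {n : ℕ} {D D' : PieceDiagram S n} {x y : Fin n × I} (h : D.IsPositive x y)
      (h' : D.IsCurlRemoval D' x y) : SkeinRelation S (formal D - vInv • formal D')
  | negativeCurl {n : ℕ} {D D' : PieceDiagram S n} {x y : Fin n × I} (h : D.IsNegative x y)
      (h' : D.IsCurlRemoval D' x y) : SkeinRelation S (formal D - v • formal D')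

/-- The Homfly skein of the surface: linear combinations of diagrams modulo the relations. -/
abbrev Skein (S : MarkedSurface F) : Type u :=
  (Diagram S →₀ Coeff) ⧸ Submodule.span Coeff {r | SkeinRelation S r}

/-- The element of the skein represented by a diagram. -/
def toSkein {S : MarkedSurface F} (D : Diagram S) : Skein S :=
  Submodule.Quotient.mk (Finsupp.single D 1)

/-- `k D`, the number of null-homotopic closed curves in the diagram `D`. -/
def k {S : MarkedSurface F} (D : Diagram S) : ℕ := D.2.numNull

/-! ## Resolution trees -/

/-- Resolution trees with initial vertex `D`. At each vertex a diagram may be replaced by one which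
agrees with it up to isotopy and Reidemeister moves II and III; this includes a change of
presentation. -/
inductive ResolutionTree {S : MarkedSurface F} : Diagram S → Type u
  | leaf (D : Diagram S) : ResolutionTree D
  | crossing {n : ℕ} {D D' D₀ : PieceDiagram S n} {x y : Fin n × I}
      (h' : D.IsSwitch D' x y) (h₀ : D.IsSmoothing D₀ x y)
      (T' : ResolutionTree ⟨n, D'⟩) (T₀ : ResolutionTree ⟨n, D₀⟩) : ResolutionTree ⟨n, D⟩
  | curlRemoval {n : ℕ} {D D' : PieceDiagram S n} {x y : Fin n × I}
      (h : D.IsCurlRemoval D' x y) (T' : ResolutionTree ⟨n, D'⟩) : ResolutionTree ⟨n, D⟩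
  | curlInsertion {n : ℕ} {D D' : PieceDiagram S n} {x y : Fin n × I}
      (h : D'.IsCurlRemoval D x y) (T' : ResolutionTree ⟨n, D'⟩) : ResolutionTree ⟨n, D⟩
  | circleRemoval {n : ℕ} {D : PieceDiagram S (n + 1)} {D' : PieceDiagram S n}
      (h : D.IsCircleRemoval D') (T' : ResolutionTree ⟨n, D'⟩) : ResolutionTree ⟨n + 1, D⟩
  | isotopy {D D' : Diagram S} (h : RegularlyIsotopic D D') (T' : ResolutionTree D') :
      ResolutionTree D

/-- The diagrams at the end vertices of a resolution tree. -/
def ResolutionTree.leaves {S : MarkedSurface F} {D : Diagram S} :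
    ResolutionTree D → List (Diagram S)
  | .leaf D => [D]
  | .crossing _ _ T' T₀ => T'.leaves ++ T₀.leaves
  | .curlRemoval _ T' => T'.leaves
  | .curlInsertion _ T' => T'.leaves
  | .circleRemoval _ T' => T'.leaves
  | .isotopy _ T' => T'.leaves

end

end HomflySkein

/-! Give every diagram the weight `z ^ k D`. The weighted root of a resolution tree lies in the span
over ℤ[v^±1, z] of the weighted end vertices, by induction on the tree. At a crossing, D = D' ± z
D₀. Switching does not change the homotopy classes of the curves, and smoothing creates at most one
more null-homotopic curve, which is paid for by the factor z in front of D₀. A curl costs a unit v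
or v⁻¹ and does not change k. Regular isotopy changes neither k nor the class in the skein. Removing
a null-homotopic circle lowers k by exactly one, and z D = (v⁻¹ - v) D', so that the lost factor z
of the weight is just what is needed to stay inside ℤ[v^±1, z].

Two ingredients carry this. The first is the behaviour of k. A closed curve is null-homotopic
exactly if its pieces lift compatibly to the universal cover (`IsClosedCurve.isNullHomotopic_iff`).
This criterion mentions neither a starting piece nor an order, so lifts can be transported along
homotopies and subdivisions, and glued when two curves are merged at a crossing
(`IsSmoothing.numNull_le`, `Subdivides.numNull_eq`, `LayerIsotopic.nullSets_eq`,
`IsCircleRemoval.numNull_eq`).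

The second is the value of a circle, `IsCircleRemoval.toSkein_eq`. A circle without crossings may be
pulled over the rest of the diagram, even if its disc contains other strands. Diagrams are not
empty, so it can be brought next to some piece that runs straight through a small disc. Adding a
curl to this piece with either choice of crossing gives v⁻¹ D' and v D', while smoothing the
crossing of the curl gives D' together with the circle. The skein relation becomes (v⁻¹ - v) D' = z
(D' ∪ circle). Most of the work is in making this picture exact: explicit curls, cutting and
renumbering of pieces, and isotopies of the surface that take the given circle to a standard round
one. -/

namespace HomflySkein

open Topology unitInterval

universe u

/-! ### Path lifting to the universal cover -/

section Slide

variable {F : Type u} [TopologicalSpace F] {x₀ x₁ a b c a' b' : F}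

/-- Homotopy classes of paths starting at `x₀`, that is, points of the universal cover. -/
abbrev Cover (x₀ : F) : Type u := Σ y : F, Path.Homotopic.Quotient x₀ y

/-- The point `w` of the universal cover is reached from `u` by lifting the path `p`. -/
def Slide (p : Path a b) (u w : Cover x₀) : Prop :=
  ∃ g : Path.Homotopic.Quotient x₀ a, u = ⟨a, g⟩ ∧ w = ⟨b, g.trans (.mk p)⟩

theorem Path.quotient_ind {P : Path.Homotopic.Quotient a b → Prop} (h : ∀ p, P (.mk p)) (g) :
    P g := by
  obtain ⟨p, rfl⟩ := Path.Homotopic.Quotient.mk_surjective g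
  exact h p

theorem quotient_trans_assoc {d : F} (f : Path.Homotopic.Quotient a b)
    (g : Path.Homotopic.Quotient b c) (h : Path.Homotopic.Quotient c d) :
    (f.trans g).trans h = f.trans (g.trans h) := by
  induction f using Path.quotient_ind
  induction g using Path.quotient_ind
  induction h using Path.quotient_ind
  simp only [← Path.Homotopic.Quotient.mk_trans, Path.Homotopic.Quotient.eq]
  exact ⟨Path.Homotopy.transAssoc _ _ _⟩

theorem quotient_trans_refl (f : Path.Homotopic.Quotient a b) :
    f.trans (.mk (Path.refl b)) = f := by
  induction f using Path.quotient_ind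
  simp only [← Path.Homotopic.Quotient.mk_trans, Path.Homotopic.Quotient.eq]
  exact ⟨Path.Homotopy.transRefl _⟩

theorem quotient_refl_trans (f : Path.Homotopic.Quotient a b) :
    (Path.Homotopic.Quotient.mk (Path.refl a)).trans f = f := by
  induction f using Path.quotient_ind
  simp only [← Path.Homotopic.Quotient.mk_trans, Path.Homotopic.Quotient.eq]
  exact ⟨Path.Homotopy.reflTrans _⟩

theorem mk_trans_symm (p : Path a b) :
    (Path.Homotopic.Quotient.mk p).trans (.mk p.symm) = .mk (Path.refl a) := by
  simp only [← Path.Homotopic.Quotient.mk_trans, Path.Homotopic.Quotient.eq]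
  exact ⟨(Path.Homotopy.reflTransSymm _).symm⟩

theorem mk_symm_trans (p : Path a b) :
    (Path.Homotopic.Quotient.mk p.symm).trans (.mk p) = .mk (Path.refl b) := by
  simpa only [Path.symm_symm] using mk_trans_symm p.symm

theorem Slide.fst_left {p : Path a b} {u w : Cover x₀} (h : Slide p u w) : u.1 = a := by
  obtain ⟨g, rfl, rfl⟩ := h; rfl

theorem Slide.fst_right {p : Path a b} {u w : Cover x₀} (h : Slide p u w) : w.1 = b := by
  obtain ⟨g, rfl, rfl⟩ := h; rfl

theorem Slide.exists (p : Path a b) {u : Cover x₀} (h : u.1 = a) : ∃ w, Slide p u w := by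
  obtain ⟨y, g⟩ := u
  obtain rfl : y = a := h
  exact ⟨_, g, rfl, rfl⟩

theorem Slide.unique {p : Path a b} {u w w' : Cover x₀} (h : Slide p u w) (h' : Slide p u w') :
    w = w' := by
  obtain ⟨g, rfl, rfl⟩ := h
  obtain ⟨g', hg, rfl⟩ := h'
  cases hg; rfl

theorem Slide.homotopic {p q : Path a b} {u w : Cover x₀} (h : Slide p u w)
    (hpq : p.Homotopic q) : Slide q u w := by
  obtain ⟨g, rfl, rfl⟩ := h
  exact ⟨g, rfl, by rw [Path.Homotopic.Quotient.eq.2 hpq]⟩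

theorem Slide.trans {p : Path a b} {q : Path b c} {u w x : Cover x₀} (h : Slide p u w)
    (h' : Slide q w x) : Slide (p.trans q) u x := by
  obtain ⟨g, rfl, rfl⟩ := h
  obtain ⟨g', hg, rfl⟩ := h'
  cases hg
  exact ⟨g, rfl, by rw [Path.Homotopic.Quotient.mk_trans, quotient_trans_assoc]⟩

theorem Slide.refl {u : Cover x₀} (h : u.1 = a) : Slide (Path.refl a) u u := by
  obtain ⟨y, g⟩ := u
  obtain rfl : y = a := h
  exact ⟨g, rfl, by rw [quotient_trans_refl]⟩

theorem Slide.symm {p : Path a b} {u w : Cover x₀} (h : Slide p u w) : Slide p.symm w u := by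
  obtain ⟨g, rfl, rfl⟩ := h
  exact ⟨_, rfl, by rw [quotient_trans_assoc, mk_trans_symm, quotient_trans_refl]⟩

theorem Slide.of_trans {p : Path a b} {q : Path b c} {u w x : Cover x₀}
    (h : Slide (p.trans q) u x) (h' : Slide p u w) : Slide q w x := by
  obtain ⟨x', hx'⟩ := Slide.exists q h'.fst_right
  rwa [h.unique (h'.trans hx')]

/-- Only the values of the paths are compared, so end points that are equal but not definitionally
equal need no casts. This is the reason for treating lifting as a relation between points of the
cover. -/
theorem Slide.congr {p : Path a b} {q : Path a' b'} {u w : Cover x₀} (h : Slide p u w)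
    (hpq : ∀ t, p t = q t) : Slide q u w := by
  obtain rfl : a = a' := by simpa using hpq 0
  obtain rfl : b = b' := by simpa using hpq 1
  obtain rfl : p = q := Path.ext (funext hpq)
  exact h

/-- Change of base point in the universal cover. -/
noncomputable def Cover.rebase (q : Path.Homotopic.Quotient x₁ x₀) (u : Cover x₀) : Cover x₁ :=
  ⟨u.1, q.trans u.2⟩

theorem Slide.rebase {p : Path a b} {u w : Cover x₀} (h : Slide p u w)
    (q : Path.Homotopic.Quotient x₁ x₀) : Slide p (u.rebase q) (w.rebase q) := by
  obtain ⟨g, rfl, rfl⟩ := h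
  exact ⟨q.trans g, rfl, by rw [quotient_trans_assoc]; rfl⟩

/-- The class `q` is `w` followed by the reverse of `u`. It serves to align the lifts of two curves
before they are glued. -/
theorem Cover.exists_rebase (u : Cover x₀) (w : Cover x₁) (h : u.1 = w.1) :
    ∃ q, u.rebase q = w := by
  obtain ⟨y, g⟩ := u
  obtain ⟨y', g'⟩ := w
  obtain rfl : y = y' := h
  induction g using Path.quotient_ind with | _ g
  refine ⟨g'.trans (.mk g.symm), ?_⟩
  simp only [Cover.rebase]
  rw [quotient_trans_assoc, mk_symm_trans, quotient_trans_refl]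

/-- Two paths in an open disc with the same end points are homotopic. -/
theorem homotopic_of_disc {φ : ℂ → F} (hφ : IsOpenEmbedding φ) (p q : Path a b)
    (hp : ∀ t, p t ∈ Set.range φ) (hq : ∀ t, q t ∈ Set.range φ) : p.Homotopic q := by
  let e := hφ.isEmbedding.toHomeomorph
  have lift : ∀ r : Path a b, ∀ hr : ∀ t, r t ∈ Set.range φ,
      ∃ r' : Path (e.symm ⟨a, by simpa using hr 0⟩) (e.symm ⟨b, by simpa using hr 1⟩),
        ∀ t, φ (r' t) = r t := by
    intro r hr
    refine ⟨⟨⟨fun t => e.symm ⟨r t, hr t⟩, by fun_prop⟩, by simp, by simp⟩, fun t => ?_⟩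
    exact congrArg Subtype.val (e.apply_symm_apply ⟨r t, hr t⟩)
  obtain ⟨p', hp'⟩ := lift p hp
  obtain ⟨q', hq'⟩ := lift q hq
  have h := (SimplyConnectedSpace.paths_homotopic p' q').map ⟨φ, hφ.continuous⟩
  have ha : a = φ (e.symm ⟨a, by simpa using hp 0⟩) := by rw [← p'.source, hp', p.source]
  have hb : b = φ (e.symm ⟨b, by simpa using hp 1⟩) := by rw [← p'.target, hp', p.target]
  have h' := h.pathCast ha hb
  convert h' using 1
  · ext t; exact (hp' t).symm
  · ext t; exact (hq' t).symm

theorem Slide.disc {φ : ℂ → F} (hφ : IsOpenEmbedding φ) {p q : Path a b}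
    (hp : ∀ t, p t ∈ Set.range φ) (hq : ∀ t, q t ∈ Set.range φ) {u w : Cover x₀}
    (h : Slide p u w) : Slide q u w :=
  h.homotopic (homotopic_of_disc hφ p q hp hq)

/-- The linear path between two parameters. -/
def paramPath (s t : I) : Path s t where
  toFun := Set.Icc.convexComb s t
  source' := by simp
  target' := by simp

/-- The part of a path between two parameters. -/
def part (γ : C(I, F)) (s t : I) : Path (γ s) (γ t) :=
  (paramPath s t).map γ.continuous

/-- The interval is contractible, so all reparametrisations with the same ends are homotopic. -/
theorem slide_map_interval {γ : C(I, F)} {s t : I} {p q : Path s t} {u w : Cover x₀}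
    (h : Slide (p.map γ.continuous) u w) : Slide (q.map γ.continuous) u w := by
  refine h.homotopic (Path.Homotopic.map ?_ γ)
  have : SimplyConnectedSpace I := by
    have : ContractibleSpace I := Convex.contractibleSpace (convex_Icc (0:ℝ) 1) ⟨0, by simp⟩
    infer_instance
  exact SimplyConnectedSpace.paths_homotopic p q

theorem Slide.part_trans {γ : C(I, F)} {r s t : I} {u w x : Cover x₀}
    (h : Slide (part γ r s) u w) (h' : Slide (part γ s t) w x) : Slide (part γ r t) u x := by
  have := h.trans h'
  rw [part, part, ← Path.map_trans] at this
  exact slide_map_interval this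

theorem Slide.of_part_trans {γ : C(I, F)} {r s t : I} {u w x : Cover x₀}
    (h : Slide (part γ r s) u w) (h' : Slide (part γ r t) u x) : Slide (part γ s t) w x := by
  obtain ⟨y, hy⟩ := Slide.exists (part γ s t) h.fst_right
  rwa [h'.unique (h.part_trans hy)]

theorem slide_part_self {γ : C(I, F)} {t : I} {u : Cover x₀} (h : u.1 = γ t) :
    Slide (part γ t t) u u := by
  refine (Slide.refl h).congr fun s => ?_
  simp [part, paramPath]

theorem slide_part_comp {γ : C(I, F)} {τ : C(I, I)} {s t : I} {u w : Cover x₀} :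
    Slide (part (γ.comp τ) s t) u w ↔ Slide (part γ (τ s) (τ t)) u w := by
  have key : ∀ r, part (γ.comp τ) s t r = ((part τ s t).map γ.continuous) r := fun r => rfl
  constructor
  · intro h
    exact slide_map_interval (h.congr key)
  · intro h
    exact Slide.congr (slide_map_interval (q := part τ s t) h) fun r => (key r).symm

end Slide

/-! ### Closed curves as minimal successor-closed sets of pieces -/

namespace PieceDiagram

variable {F : Type u} [TopologicalSpace F] {S : MarkedSurface F} {n m : ℕ}

theorem join_inr {D : PieceDiagram S n} {e f : Fin n} (h : D.next (Sum.inr e) = Sum.inr f) :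
    D.path e 1 = D.path f 0 := by
  simpa [h] using D.join (Sum.inr e)

/-- The piece `e` is followed by the piece `f`. -/
def Follows (D : PieceDiagram S n) (e f : Fin n) : Prop :=
  D.next (Sum.inr e) = Sum.inr f

theorem Follows.right_unique {D : PieceDiagram S n} {e f g : Fin n} (h : D.Follows e f)
    (h' : D.Follows e g) : f = g := by
  simpa using h.symm.trans h'

theorem Follows.left_unique {D : PieceDiagram S n} {e f g : Fin n} (h : D.Follows e g)
    (h' : D.Follows f g) : e = f := by
  simpa using D.next.injective (h.trans h'.symm)

/-- Every piece in the set is followed by a piece in the set. -/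
def IsClosedSet (D : PieceDiagram S n) (s : Finset (Fin n)) : Prop :=
  ∀ e ∈ s, ∃ f ∈ s, D.Follows e f

/-- The set consists of the pieces of one closed curve. -/
structure IsCycleSet (D : PieceDiagram S n) (s : Finset (Fin n)) : Prop where
  nonempty : s.Nonempty
  closed : D.IsClosedSet s
  minimal : ∀ t ⊆ s, t.Nonempty → D.IsClosedSet t → t = s

/-- Pieces in `s` lift compatibly to the universal cover. -/
def Lifts (D : PieceDiagram S n) (s : Finset (Fin n)) {x₀ : F} (G : Fin n → Cover x₀) : Prop :=
  ∀ e ∈ s, ∀ f, D.Follows e f → Slide (D.piece e) (G e) (G f)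

/-- The closing copy of `e`, at index `l.length + 1`, is left out, so that every index used here has
a successor in the chain. -/
theorem mem_toFinset_cons_iff {e : Fin n} {l : List (Fin n)} (a : Fin n) :
    a ∈ (e :: l).toFinset ↔ ∃ i, ∃ h : i < l.length + 1,
      (e :: (l ++ [e]))[i]'(by simp; omega) = a := by
  rw [List.mem_toFinset, List.mem_iff_getElem]
  constructor
  · rintro ⟨i, hi, rfl⟩
    refine ⟨i, by simpa using hi, ?_⟩
    simp only [← List.cons_append]
    rw [List.getElem_append_left]
  · rintro ⟨i, hi, rfl⟩
    refine ⟨i, by simpa using hi, ?_⟩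
    simp only [← List.cons_append]
    rw [List.getElem_append_left]

/-- Successors are unique, so a closed subset that contains one listed piece contains all later
ones, hence the closing copy of `e`, and from there the whole list. -/
theorem IsClosedCurve.isCycleSet {D : PieceDiagram S n} {e : Fin n} {l : List (Fin n)}
    (h : D.IsClosedCurve e l) : D.IsCycleSet (e :: l).toFinset := by
  have hch := List.isChain_iff_getElem.1 h.2
  have hlast : (e :: (l ++ [e]))[l.length + 1]'(by simp) = e := by simp
  have hmem : ∀ i, ∀ h : i < l.length + 2, (e :: (l ++ [e]))[i]'(by simp; omega) ∈
      (e :: l).toFinset := by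
    intro i hi
    rcases Nat.lt_or_ge i (l.length + 1) with h' | h'
    · exact (mem_toFinset_cons_iff _).2 ⟨i, h', rfl⟩
    · obtain rfl : i = l.length + 1 := by omega
      rw [hlast]; simp
  refine ⟨⟨e, by simp⟩, fun a ha => ?_, fun t hts ⟨a, ha⟩ ht => ?_⟩
  · obtain ⟨i, hi, rfl⟩ := (mem_toFinset_cons_iff a).1 ha
    exact ⟨_, hmem (i + 1) (by omega), hch i (by simp; omega)⟩
  · have step : ∀ i, ∀ h : i < l.length + 1, (e :: (l ++ [e]))[i]'(by simp; omega) ∈ t →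
        (e :: (l ++ [e]))[i+1]'(by simp; omega) ∈ t := by
      intro i hi hit
      obtain ⟨f, hf, hef⟩ := ht _ hit
      rwa [Follows.right_unique (D := D) (hch i (by simp; omega)) hef]
    obtain ⟨i, hi, rfl⟩ := (mem_toFinset_cons_iff a).1 (hts ha)
    have up : ∀ j, ∀ i, ∀ h : i + j < l.length + 2, (e :: (l ++ [e]))[i]'(by simp; omega) ∈ t →
        (e :: (l ++ [e]))[i+j]'(by simp; omega) ∈ t := by
      intro j
      induction j with
      | zero => intro i h h'; simpa using h'
      | succ j ih => intro i h h'; exact step (i + j) (by omega) (ih i (by omega) h')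
    have he : e ∈ t := by
      have := up (l.length + 1 - i) i (by omega) ha
      have h2 : i + (l.length + 1 - i) = l.length + 1 := by omega
      simp only [h2] at this
      rwa [hlast] at this
    refine Finset.Subset.antisymm hts fun b hb => ?_
    obtain ⟨j, hj, rfl⟩ := (mem_toFinset_cons_iff b).1 hb
    have := up j 0 (by omega) (by simpa using he)
    simpa using this

/-- Every tail of the orbit of `e` under the successor map `f` is closed, hence all of `s` by
minimality. The tail that starts at `f e` therefore contains `e`, so `e` is periodic, and one period
lists `s` without repetition. -/
theorem IsCycleSet.exists_closedCurve {D : PieceDiagram S n} {s : Finset (Fin n)}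
    (h : D.IsCycleSet s) : ∃ e l, s = (e :: l).toFinset ∧ D.IsClosedCurve e l := by
  classical
  obtain ⟨e, he⟩ := h.nonempty
  choose! f hfs hf using h.closed
  have hmem : ∀ k, f^[k] e ∈ s := by
    intro k
    induction k with
    | zero => exact he
    | succ k ih => rw [Function.iterate_succ_apply']; exact hfs _ ih
  have orbit : ∀ j, s.filter (fun a => ∃ k, f^[k + j] e = a) = s := by
    intro j
    refine h.minimal _ (Finset.filter_subset _ _) ⟨f^[j] e, ?_⟩ ?_
    · simp only [Finset.mem_filter]
      exact ⟨hmem j, 0, by simp⟩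
    · intro a ha
      simp only [Finset.mem_filter] at ha
      obtain ⟨ha, k, rfl⟩ := ha
      refine ⟨_, ?_, hf _ ha⟩
      simp only [Finset.mem_filter]
      refine ⟨hfs _ ha, k + 1, ?_⟩
      rw [← Function.iterate_succ_apply' f]; congr 1; omega
  have hper : e ∈ Function.periodicPts f := by
    have : e ∈ s.filter (fun a => ∃ k, f^[k + 1] e = a) := by rw [orbit]; exact he
    obtain ⟨k, hk⟩ := (Finset.mem_filter.1 this).2
    exact ⟨k + 1, by omega, hk⟩
  obtain ⟨p, hp⟩ : ∃ p, Function.minimalPeriod f e = p + 1 :=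
    ⟨_, (Nat.succ_pred_eq_of_pos (Function.minimalPeriod_pos_of_mem_periodicPts hper)).symm⟩
  have hlist : (e :: (List.range p).map fun k => f^[k + 1] e) =
      (List.range (p + 1)).map fun k => f^[k] e := by
    rw [List.range_succ_eq_map, List.map_cons, List.map_map]; rfl
  refine ⟨e, (List.range p).map fun k => f^[k + 1] e, ?_, ?_, ?_⟩
  · rw [hlist]
    ext a
    simp only [List.mem_toFinset, List.mem_map, List.mem_range]
    constructor
    · intro ha
      rw [← orbit 0] at ha
      obtain ⟨k, rfl⟩ := (Finset.mem_filter.1 ha).2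
      refine ⟨k % (p + 1), Nat.mod_lt _ (by omega), ?_⟩
      rw [← hp, Function.iterate_mod_minimalPeriod_eq]; simp
    · rintro ⟨k, -, rfl⟩; exact hmem k
  · rw [hlist]
    refine List.Nodup.map_on ?_ List.nodup_range
    intro x hx y hy hxy
    rw [List.mem_range, ← hp] at hx hy
    exact Function.iterate_injOn_Iio_minimalPeriod hx hy hxy
  · have hlist' : (e :: ((List.range p).map (fun k => f^[k + 1] e) ++ [e])) =
        (List.range (p + 2)).map fun k => f^[k] e := by
      rw [← List.cons_append, hlist, List.range_succ (n := p + 1)]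
      simp only [List.map_append, List.map_cons, List.map_nil]
      rw [← hp, Function.iterate_minimalPeriod]
    rw [hlist', List.isChain_iff_getElem]
    intro i hi
    simp only [List.getElem_map, List.getElem_range, Function.iterate_succ_apply']
    exact hf _ (hmem i)

/-- `G a` is the lift of the start of the piece `a`. Since the pieces are distinct, the values can
be prescribed one at a time. The end `w` is recorded separately, as the last piece has no successor
in the list. -/
theorem Traces.exists_lift {D : PieceDiagram S n} {l : List (Fin n)} {x y : F} {p : Path x y}
    (h : D.Traces l p) (hl : l.Nodup) {x₀ : F} (u : Cover x₀) (hu : u.1 = x) :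
    ∃ (G : Fin n → Cover x₀) (w : Cover x₀), Slide p u w ∧ (∀ a ∈ l.head?, G a = u) ∧
      l.IsChain (fun a b => Slide (D.piece a) (G a) (G b)) ∧
      ((l = [] ∧ w = u) ∨ ∃ a ∈ l.getLast?, Slide (D.piece a) (G a) w) := by
  induction h generalizing u with
  | nil x =>
    exact ⟨fun _ => u, u, Slide.refl hu, by simp, List.isChain_nil, Or.inl ⟨rfl, rfl⟩⟩
  | @cons e l x y p hx _ ih =>
    obtain ⟨w₁, hw₁⟩ := Slide.exists (D.piece e) hu
    obtain ⟨hel, hl⟩ := List.nodup_cons.1 hl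
    obtain ⟨G, w, hw, hG, hch, hlast⟩ := ih hl w₁ (hw₁.fst_right.trans hx)
    have hne : ∀ a ∈ l, a ≠ e := fun a ha h => hel (h ▸ ha)
    refine ⟨Function.update G e u, w, hw₁.trans (hw.congr fun _ => rfl), by simp, ?_, Or.inr ?_⟩
    · rw [List.isChain_cons]
      constructor
      · intro b hb
        rw [Function.update_self, Function.update_of_ne (hne b (List.mem_of_mem_head? hb)), hG b hb]
        exact hw₁
      · refine List.IsChain.imp_of_mem_imp (fun a b ha hb hab => ?_) hch
        rwa [Function.update_of_ne (hne _ ha), Function.update_of_ne (hne _ hb)]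
    · rcases hlast with ⟨rfl, rfl⟩ | ⟨a, ha, hs⟩
      · exact ⟨e, by simp, by rwa [Function.update_self]⟩
      · refine ⟨a, ?_, ?_⟩
        · rw [List.getLast?_cons]
          simp only [Option.mem_def] at ha ⊢
          rw [ha]; rfl
        · rwa [Function.update_of_ne (hne a (List.mem_of_mem_getLast? ha))]

/-- The closed curve is the case `f = e`; a general `f` is needed for the induction on the list. -/
theorem exists_traces {D : PieceDiagram S n} (l : List (Fin n)) (e f : Fin n)
    (h : List.IsChain D.Follows (e :: (l ++ [f]))) :
    ∃ p : Path (D.path e 0) (D.path f 0), D.Traces (e :: l) p ∧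
      ∀ {x₀ : F} (G : Fin n → Cover x₀), D.Lifts (e :: l).toFinset G → Slide p (G e) (G f) := by
  induction l generalizing e with
  | nil =>
    have hef : D.Follows e f := by simpa using h
    refine ⟨_, .cons e (Path.refl _) (join_inr hef) (.nil _), fun G hG => ?_⟩
    have := hG e (by simp) f hef
    exact this.trans ((Slide.refl (this.fst_right.trans (join_inr hef))).congr fun _ => rfl)
  | cons a l ih =>
    obtain ⟨hea, h⟩ := List.isChain_cons_cons.1 h
    obtain ⟨p, hp, hG⟩ := ih a h
    refine ⟨_, .cons e p (join_inr hea) hp, fun G hG' => ?_⟩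
    refine (hG' e (by simp) a hea).trans ((hG G ?_).congr fun _ => rfl)
    intro b hb c
    exact hG' b (by simp only [List.toFinset_cons, Finset.mem_insert] at hb ⊢; exact Or.inr hb) c

/-- A loop is null-homotopic if and only if some lift of it to the universal cover closes up.
Forwards, the lift ends where the lift of a constant path ends. Backwards, a closed lift gives `g =
g.trans (.mk p)`, and `g` can be cancelled. -/
theorem IsClosedCurve.isNullHomotopic_iff {D : PieceDiagram S n} {e : Fin n} {l : List (Fin n)}
    (h : D.IsClosedCurve e l) : D.IsNullHomotopic e l ↔
      ∃ (x₀ : F) (G : Fin n → Cover x₀), D.Lifts (e :: l).toFinset G := by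
  constructor
  · rintro ⟨x, p, hp, hnull⟩
    let u : Cover x := ⟨x, .mk (Path.refl x)⟩
    obtain ⟨G, w, hw, hG, hch, hlast⟩ := hp.exists_lift h.1 u rfl
    have hwu : w = u := (hw.homotopic hnull).unique (Slide.refl rfl)
    have hGe : G e = u := hG e (by simp)
    refine ⟨x, G, ?_⟩
    have hch' : List.IsChain (fun a b => Slide (D.piece a) (G a) (G b)) (e :: (l ++ [e])) := by
      rw [← List.cons_append, List.isChain_append]
      refine ⟨hch, by simp, ?_⟩
      rcases hlast with ⟨h, -⟩ | ⟨a, ha, hs⟩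
      · simp at h
      · intro a' ha' b hb
        obtain rfl : a = a' := by
          simp only [Option.mem_def] at ha ha'
          rw [ha] at ha'; exact Option.some.inj ha'
        obtain rfl : e = b := by simpa using hb
        rw [hGe, ← hwu]; exact hs
    intro a ha b hab
    obtain ⟨i, hi, rfl⟩ := (mem_toFinset_cons_iff a).1 ha
    rw [Follows.right_unique (D := D) hab (List.isChain_iff_getElem.1 h.2 i (by simp; omega))]
    exact List.isChain_iff_getElem.1 hch' i (by simp; omega)
  · rintro ⟨x₀, G, hG⟩
    obtain ⟨p, hp, hs⟩ := D.exists_traces l e e h.2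
    refine ⟨_, p, hp, ?_⟩
    obtain ⟨g, hg, hg'⟩ := hs G hG
    have : g = g.trans (.mk p) := eq_of_heq (Sigma.mk.inj (hg.symm.trans hg')).2
    induction g using Path.quotient_ind with | _ g
    have h2 : (Path.Homotopic.Quotient.mk g.symm).trans (.mk g) =
        (Path.Homotopic.Quotient.mk g.symm).trans ((Path.Homotopic.Quotient.mk g).trans (.mk p)) := by
      rw [← this]
    rw [← quotient_trans_assoc, mk_symm_trans, quotient_refl_trans] at h2
    exact (Path.Homotopic.Quotient.eq.1 h2).symm

/-- The null-homotopic closed curves of a diagram, as sets of pieces. -/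
def nullSets (D : PieceDiagram S n) : Set (Finset (Fin n)) :=
  {s | D.IsCycleSet s ∧ ∃ (x₀ : F) (G : Fin n → Cover x₀), D.Lifts s G}

theorem numNull_eq (D : PieceDiagram S n) : D.numNull = D.nullSets.ncard := by
  unfold numNull nullSets
  congr 1
  ext s
  constructor
  · rintro ⟨e, l, rfl, hc, hn⟩
    exact ⟨hc.isCycleSet, hc.isNullHomotopic_iff.1 hn⟩
  · rintro ⟨hc, hG⟩
    obtain ⟨e, l, rfl, hc'⟩ := hc.exists_closedCurve
    exact ⟨e, l, rfl, hc', hc'.isNullHomotopic_iff.2 hG⟩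

theorem IsCycleSet.congr {D D' : PieceDiagram S n} (h : D'.next = D.next) {s : Finset (Fin n)} :
    D'.IsCycleSet s ↔ D.IsCycleSet s := by
  have hf : D'.Follows = D.Follows := by unfold Follows; rw [h]
  have hc : D'.IsClosedSet = D.IsClosedSet := by unfold IsClosedSet; rw [hf]
  constructor <;> rintro ⟨h1, h2, h3⟩
  · exact ⟨h1, hc ▸ h2, hc ▸ h3⟩
  · exact ⟨h1, hc ▸ h2, hc ▸ h3⟩

end PieceDiagram

/-! ### Null-homotopic curves under isotopy, switching, curl and circle removal -/

namespace PieceDiagram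

variable {F : Type u} [TopologicalSpace F] {S : MarkedSurface F} {n m : ℕ}

/-- Diagrams whose pieces correspond to each other under a homotopy, compatible at the joints,
have the same null-homotopic curves. -/
theorem nullSets_eq_of_square {D D' : PieceDiagram S n} (hnext : D'.next = D.next)
    (p : ∀ e, Path (D.path e 0) (D'.path e 0)) (q : ∀ e, Path (D.path e 1) (D'.path e 1))
    (hsq : ∀ e, ((D.piece e).trans (q e)).Homotopic ((p e).trans (D'.piece e)))
    (hpq : ∀ e f, D.Follows e f → ∀ t, q e t = p f t) : D'.nullSets = D.nullSets := by
  have hF : D'.Follows = D.Follows := by unfold Follows; rw [hnext]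
  ext s
  refine and_congr (IsCycleSet.congr hnext) ⟨?_, ?_⟩
  · rintro ⟨x₀, G', hG'⟩
    -- Pieces outside `s` may be lifted over a wrong point; they get a value that is never used.
    have hbase : ∀ e, ∃ w : Cover x₀, (G' e).1 = D'.path e 0 → Slide (p e) w (G' e) := by
      intro e
      by_cases he : (G' e).1 = D'.path e 0
      · obtain ⟨w, hw⟩ := Slide.exists (p e).symm he
        exact ⟨w, fun _ => by simpa only [Path.symm_symm] using hw.symm⟩
      · exact ⟨G' e, fun h => absurd h he⟩
    choose G hG using hbase
    refine ⟨x₀, G, fun e he f hef => ?_⟩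
    have hs := hG' e he f (hF ▸ hef)
    have he' := hG e hs.fst_left
    have hf' := hG f (hs.fst_right.trans (join_inr (hF ▸ hef : D'.Follows e f)))
    obtain ⟨w, hw⟩ := Slide.exists (D.piece e) he'.fst_left
    obtain ⟨x, hx⟩ := Slide.exists (q e) hw.fst_right
    -- By the square, sliding along `D.piece e` and then `q e` ends where `D'.piece e` leads from
    -- `G' e`, that is, at `G' f`.
    have h1 := ((hw.trans hx).homotopic (hsq e)).of_trans he'
    obtain rfl := h1.unique hs
    have h2 : G f = w := hf'.symm.unique (hx.congr (hpq e f hef)).symm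
    rwa [h2]
  · rintro ⟨x₀, G, hG⟩
    have hbase : ∀ e, ∃ w : Cover x₀, (G e).1 = D.path e 0 → Slide (p e) (G e) w := by
      intro e
      by_cases he : (G e).1 = D.path e 0
      · obtain ⟨w, hw⟩ := Slide.exists (p e) he
        exact ⟨w, fun _ => hw⟩
      · exact ⟨G e, fun h => absurd h he⟩
    choose G' hG' using hbase
    refine ⟨x₀, G', fun e he f hef => ?_⟩
    have hef' : D.Follows e f := hF ▸ hef
    have hs := hG e he f hef'
    have hf := hG' f (hs.fst_right.trans (join_inr hef'))
    have hq : Slide (q e) (G f) (G' f) := hf.congr fun t => (hpq e f hef' t).symm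
    exact ((hs.trans hq).homotopic (hsq e)).of_trans (hG' e hs.fst_left)

/-- This is the homotopy square with constant sides. -/
theorem nullSets_eq_of_homotopic {D D' : PieceDiagram S n} (hnext : D'.next = D.next)
    (h0 : ∀ e, D.path e 0 = D'.path e 0) (h1 : ∀ e, D.path e 1 = D'.path e 1)
    (h : ∀ e, (D.piece e).Homotopic ((D'.piece e).cast (h0 e) (h1 e))) :
    D'.nullSets = D.nullSets := by
  refine nullSets_eq_of_square hnext (fun e => (Path.refl _).cast rfl (h0 e).symm)
    (fun e => (Path.refl _).cast rfl (h1 e).symm) (fun e => ?_) (fun e f hef t => ?_)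
  · rw [← Path.Homotopic.Quotient.eq, Path.Homotopic.Quotient.mk_trans,
      Path.Homotopic.Quotient.mk_trans, Path.Homotopic.Quotient.eq.2 (h e)]
    -- Stated for variable end points, so that the equations between them can be eliminated.
    have key : ∀ (a b a' b' : F) (p : Path a' b') (h0 : a = a') (h1 : b = b'),
        (Path.Homotopic.Quotient.mk (p.cast h0 h1)).trans
          (.mk ((Path.refl b).cast rfl h1.symm)) =
        (Path.Homotopic.Quotient.mk ((Path.refl a).cast rfl h0.symm)).trans (.mk p) := by
      rintro a b _ _ p rfl rfl
      simp only [Path.cast_rfl_rfl]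
      rw [quotient_trans_refl, quotient_refl_trans]
    exact key _ _ _ _ _ _ _
  · simpa using join_inr hef

/-- The isotopy carries each piece in `A` along, its ends running through the tracks of the isotopy,
while the ends of the other pieces rest. At a joint between the two kinds the isotopy is the
identity, so the tracks agree there. Crossings play no role. -/
theorem LayerIsotopic.nullSets_eq {D D' : PieceDiagram S n} (h : D.LayerIsotopic D') :
    D'.nullSets = D.nullSets := by
  classical
  obtain ⟨hnext, A, H, hH, H0, -, hU, hA, hA', -⟩ := h
  let K : ContinuousMap.Homotopy (ContinuousMap.id F) ⟨H 1, (H 1).continuous⟩ :=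
    { toFun := fun p => H p.1 p.2
      continuous_toFun := hH
      map_zero_left := H0
      map_one_left := fun _ => rfl }
  have key₀ : ∀ {a b a' b' : F} (P : Path a b) (P' : Path a' b') (ha : a' = H 1 a)
      (hb : b' = H 1 b), (∀ t, P' t = H 1 (P t)) →
      (P.trans ((K.evalAt b).cast rfl hb)).Homotopic
        (((K.evalAt a).cast rfl ha).trans P') := by
    rintro a b _ _ P P' rfl rfl h
    obtain rfl : P' = P.map (H 1).continuous := Path.ext (funext h)
    exact Path.Homotopic.map_trans_evalAt K P
  have key : ∀ e, ∃ (p : Path (D.path e 0) (D'.path e 0)) (q : Path (D.path e 1) (D'.path e 1)),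
      ((D.piece e).trans q).Homotopic (p.trans (D'.piece e)) ∧
      (e ∈ A → ∀ t, p t = H t (D.path e 0) ∧ q t = H t (D.path e 1)) ∧
      (e ∉ A → ∀ t, p t = D.path e 0 ∧ q t = D.path e 1) := by
    intro e
    by_cases he : e ∈ A
    · refine ⟨(K.evalAt _).cast rfl (hA e he 0), (K.evalAt _).cast rfl (hA e he 1), ?_,
        fun _ t => ⟨rfl, rfl⟩, fun h => absurd he h⟩
      exact key₀ (D.piece e) (D'.piece e) _ _ (hA e he)
    · have hp := hA' e he
      refine ⟨(Path.refl _).cast rfl (by rw [hp]), (Path.refl _).cast rfl (by rw [hp]), ?_,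
        fun h => absurd h he, fun _ t => ⟨rfl, rfl⟩⟩
      have h1 : ((D.piece e).trans (Path.refl _)).Homotopic
          ((Path.refl _).trans (D.piece e)) := by
        rw [← Path.Homotopic.Quotient.eq, Path.Homotopic.Quotient.mk_trans,
          Path.Homotopic.Quotient.mk_trans, quotient_trans_refl, quotient_refl_trans]
      convert h1.pathCast (rfl : D.path e 0 = _) (show D'.path e 1 = _ by rw [hp]) using 1
      · ext t; simp only [Path.trans_apply, Path.cast_coe]
      · ext t; simp only [Path.trans_apply, Path.cast_coe]
        split_ifs
        · rfl
        · exact congrArg (fun g : C(I, F) => g _) hp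
  choose p q hsq hpA hpA' using key
  refine nullSets_eq_of_square hnext p q hsq fun e f hef t => ?_
  have hj := join_inr hef
  by_cases he : e ∈ A <;> by_cases hf : f ∈ A
  · rw [(hpA e he t).2, (hpA f hf t).1, hj]
  · obtain ⟨U, hU, hfix⟩ := hU e f hef (by tauto)
    rw [(hpA e he t).2, (hpA' f hf t).1, hfix t _ (mem_of_mem_nhds hU), hj]
  · obtain ⟨U, hU, hfix⟩ := hU e f hef (by tauto)
    rw [(hpA' e he t).2, (hpA f hf t).1, ← hj, hfix t _ (mem_of_mem_nhds hU)]
  · rw [(hpA' e he t).2, (hpA' f hf t).1, hj]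

theorem IsSwitch.nullSets_eq {D D' : PieceDiagram S n} {x y : Fin n × I}
    (h : D.IsSwitch D' x y) : D'.nullSets = D.nullSets := by
  obtain ⟨-, hp, hn, -⟩ := h
  refine nullSets_eq_of_homotopic hn (fun e => by rw [hp]) (fun e => by rw [hp]) fun e => ?_
  have : D.piece e = (D'.piece e).cast (by rw [hp]) (by rw [hp]) := by
    ext t
    exact congrArg (fun g : Fin n → C(I, F) => g e t) hp.symm
  rw [← this]

theorem IsProperIn.mem_range {D : PieceDiagram S n} {φ : ℂ → F} {e : Fin n}
    (h : D.IsProperIn φ e) (t : I) : D.path e t ∈ Set.range φ := by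
  obtain ⟨h1, h2, h3⟩ := h
  rcases eq_or_ne t 0 with rfl | h0
  · exact Set.image_subset_range _ _ h2
  rcases eq_or_ne t 1 with rfl | h1'
  · exact Set.image_subset_range _ _ h3
  · exact Set.image_subset_range _ _ (h1 t ⟨unitInterval.pos_iff_ne_zero.2 h0,
      unitInterval.lt_one_iff_ne_one.2 h1'⟩)

/-- The curl and the arc that replaces it lie in one disc and share their ends, so they are
homotopic. -/
theorem IsCurlRemoval.nullSets_eq {D D' : PieceDiagram S n} {x y : Fin n × I}
    (h : D.IsCurlRemoval D' x y) : D'.nullSets = D.nullSets := by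
  obtain ⟨-, -, -, ⟨φ, hφ, hp, hp', -⟩, -, -, hpath, h0, h1, hn⟩ := h
  have e0 : ∀ e, D.path e 0 = D'.path e 0 := fun e => by
    rcases eq_or_ne e x.1 with rfl | he
    · exact h0.symm
    · rw [hpath e he]
  have e1 : ∀ e, D.path e 1 = D'.path e 1 := fun e => by
    rcases eq_or_ne e x.1 with rfl | he
    · exact h1.symm
    · rw [hpath e he]
  refine nullSets_eq_of_homotopic hn e0 e1 fun e => ?_
  rcases eq_or_ne e x.1 with rfl | he
  · exact homotopic_of_disc hφ _ _ hp.mem_range hp'.mem_range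
  · have : D.piece e = (D'.piece e).cast (e0 e) (e1 e) := by
      ext t
      exact congrArg (fun g : C(I, F) => g t) (hpath e he).symm
    rw [← this]

theorem IsClosedSet.inter {D : PieceDiagram S n} {s t : Finset (Fin n)} (hs : D.IsClosedSet s)
    (ht : D.IsClosedSet t) : D.IsClosedSet (s ∩ t) := by
  intro e he
  rw [Finset.mem_inter] at he
  obtain ⟨f, hf, hef⟩ := hs e he.1
  obtain ⟨g, hg, heg⟩ := ht e he.2
  obtain rfl := hef.right_unique heg
  exact ⟨f, Finset.mem_inter.2 ⟨hf, hg⟩, hef⟩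

/-- The intersection is closed and not empty, so by minimality it equals both sets. -/
theorem IsCycleSet.eq_of_mem {D : PieceDiagram S n} {s t : Finset (Fin n)} (hs : D.IsCycleSet s)
    (ht : D.IsCycleSet t) {e : Fin n} (h1 : e ∈ s) (h2 : e ∈ t) : s = t := by
  have hne : (s ∩ t).Nonempty := ⟨e, Finset.mem_inter.2 ⟨h1, h2⟩⟩
  have hc := hs.closed.inter ht.closed
  rw [← hs.minimal _ Finset.inter_subset_left hne hc]
  exact ht.minimal _ Finset.inter_subset_right hne hc

/-- The piece `c` follows only itself, so the closed curves of `D` are `{c}` and the renumbered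
closed curves of `D'`; the curve `{c}` is null-homotopic because it lies in a disc. -/
theorem IsCircleRemoval.numNull_eq {D : PieceDiagram S (n + 1)} {D' : PieceDiagram S n}
    (h : D.IsCircleRemoval D') : D.numNull = D'.numNull + 1 := by
  classical
  obtain ⟨c, hc, -, ⟨φ, hφ, hrange⟩, hpath, -, hnext⟩ := h
  have hF : ∀ e f, D'.Follows e f ↔ D.Follows (c.succAbove e) (c.succAbove f) := by
    intro e f
    have := hnext (Sum.inr e)
    simp only [Sum.map_inr] at this
    unfold Follows
    rw [← this]
    rcases D'.next (Sum.inr e) with b | g <;> simp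
  have hcc : D.Follows c c := hc
  have hF' : ∀ e f, D.Follows (c.succAbove e) f → ∃ g, f = c.succAbove g := by
    intro e f h
    refine Fin.exists_succAbove_eq (fun hfc => ?_) |>.imp fun _ h => h.symm
    subst hfc
    exact Fin.succAbove_ne _ _ (h.left_unique hcc)
  let ι : Finset (Fin n) → Finset (Fin (n + 1)) := Finset.map (Fin.succAboveEmb c)
  have hι : Function.Injective ι := Finset.map_injective _
  have hmem : ∀ t e, c.succAbove e ∈ ι t ↔ e ∈ t := fun t e =>
    Finset.mem_map' (Fin.succAboveEmb c)
  have hcι : ∀ t, c ∉ ι t := by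
    intro t h
    obtain ⟨e, -, he⟩ := Finset.mem_map.1 h
    exact Fin.succAbove_ne c e he
  have hsurj : ∀ s, c ∉ s → ∃ t, ι t = s := by
    intro s hs
    refine ⟨Finset.univ.filter fun e => c.succAbove e ∈ s, ?_⟩
    ext e
    rcases eq_or_ne e c with rfl | he
    · exact iff_of_false (hcι _) hs
    · obtain ⟨e, rfl⟩ := Fin.exists_succAbove_eq he
      rw [hmem]; simp
  have hclosed : ∀ t, D.IsClosedSet (ι t) ↔ D'.IsClosedSet t := by
    intro t
    constructor
    · intro h e he
      obtain ⟨f, hf, hef⟩ := h _ ((hmem t e).2 he)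
      obtain ⟨g, rfl⟩ := hF' _ _ hef
      exact ⟨g, (hmem t g).1 hf, (hF _ _).2 hef⟩
    · intro h e he
      obtain ⟨e, he', rfl⟩ := Finset.mem_map.1 he
      obtain ⟨f, hf, hef⟩ := h e he'
      exact ⟨_, (hmem t f).2 hf, (hF _ _).1 hef⟩
  have hcycle : ∀ t, D.IsCycleSet (ι t) ↔ D'.IsCycleSet t := by
    intro t
    constructor
    · rintro ⟨h1, h2, h3⟩
      refine ⟨Finset.map_nonempty.1 h1, (hclosed t).1 h2, fun r hr hne hrc => hι ?_⟩
      exact h3 _ (Finset.map_subset_map.2 hr) (Finset.map_nonempty.2 hne) ((hclosed r).2 hrc)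
    · rintro ⟨h1, h2, h3⟩
      refine ⟨Finset.map_nonempty.2 h1, (hclosed t).2 h2, fun r hr hne hrc => ?_⟩
      obtain ⟨r, rfl⟩ := hsurj r fun h => hcι t (hr h)
      rw [h3 r (Finset.map_subset_map.1 hr) (Finset.map_nonempty.1 hne) ((hclosed r).1 hrc)]
  have hlift : ∀ t, (∃ (x₀ : F) (G : Fin (n + 1) → Cover x₀), D.Lifts (ι t) G) ↔
      ∃ (x₀ : F) (G : Fin n → Cover x₀), D'.Lifts t G := by
    intro t
    constructor
    · rintro ⟨x₀, G, hG⟩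
      refine ⟨x₀, fun e => G (c.succAbove e), fun e he f hef => ?_⟩
      exact (hG _ ((hmem t e).2 he) _ ((hF _ _).1 hef)).congr fun s => by
        exact congrArg (fun g : C(I, F) => g s) (hpath e).symm
    · rintro ⟨x₀, G, hG⟩
      -- The value at `c` is arbitrary, since `c` is not in `ι t`.
      refine ⟨x₀, Fin.insertNth (α := fun _ => Cover x₀) c ⟨x₀, .mk (Path.refl _)⟩ G,
        fun e he f hef => ?_⟩
      obtain ⟨e, he', rfl⟩ := Finset.mem_map.1 he
      obtain ⟨g, rfl⟩ := hF' _ _ hef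
      have := hG e he' g ((hF _ _).2 hef)
      simp only [Fin.succAboveEmb_apply, Fin.insertNth_apply_succAbove]
      exact this.congr fun s => congrArg (fun g : C(I, F) => g s) (hpath e)
  have hset : D.nullSets = insert {c} (ι '' D'.nullSets) := by
    ext s
    simp only [Set.mem_insert_iff, Set.mem_image]
    have hcs : D.IsClosedSet {c} := fun e he => by
      obtain rfl := Finset.mem_singleton.1 he
      exact ⟨e, he, hcc⟩
    constructor
    · rintro ⟨h1, h2⟩
      by_cases hs : c ∈ s
      · left
        exact (h1.minimal {c} (by simpa using hs) (by simp) hcs).symm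
      · right
        obtain ⟨t, rfl⟩ := hsurj s hs
        exact ⟨t, ⟨(hcycle t).1 h1, (hlift t).1 h2⟩, rfl⟩
    · rintro (rfl | ⟨t, ⟨h1, h2⟩, rfl⟩)
      · refine ⟨⟨by simp, hcs, fun t ht hne _ => ?_⟩, ?_⟩
        · exact (Finset.subset_singleton_iff.1 ht).resolve_left hne.ne_empty
        -- In a disc the curve is homotopic to a constant path, so a constant lift is compatible.
        · refine ⟨D.path c 0, fun _ => ⟨D.path c 0, .mk (Path.refl _)⟩, fun e he f hef => ?_⟩
          obtain rfl := Finset.mem_singleton.1 he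
          obtain rfl := hcc.right_unique hef
          have hj := join_inr hcc
          have hr : ∀ t, D.path e t ∈ Set.range φ := fun t =>
            Set.image_subset_range _ _ (hrange ▸ Set.mem_range_self t)
          refine ((Slide.refl rfl).congr (q := (Path.refl (D.path e 0)).cast rfl hj)
            fun _ => rfl).disc hφ ?_ hr
          exact fun t => hr 0
      · exact ⟨(hcycle t).2 h1, (hlift t).2 h2⟩
  rw [D.numNull_eq, D'.numNull_eq, hset, Set.ncard_insert_of_notMem, Set.ncard_image_of_injective _ hι]
  rintro ⟨t, -, ht⟩
  exact hcι t (ht ▸ Finset.mem_singleton_self c)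

end PieceDiagram

/-! ### Smoothing creates at most one additional null-homotopic curve -/

section Disc

variable {F : Type u} [TopologicalSpace F] {x₀ a b a' b' : F}

theorem exists_path_of_disc {φ : ℂ → F} (hφ : IsOpenEmbedding φ) (ha : a ∈ Set.range φ)
    (hb : b ∈ Set.range φ) : ∃ p : Path a b, ∀ t, p t ∈ Set.range φ := by
  obtain ⟨a, rfl⟩ := ha
  obtain ⟨b, rfl⟩ := hb
  exact ⟨(PathConnectedSpace.somePath a b).map hφ.continuous, fun t => ⟨_, rfl⟩⟩

theorem Slide.disc' {φ : ℂ → F} (hφ : IsOpenEmbedding φ) {p : Path a b} {q : Path a' b'}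
    (ha : a = a') (hb : b = b') (hp : ∀ t, p t ∈ Set.range φ) (hq : ∀ t, q t ∈ Set.range φ)
    {u w : Cover x₀} (h : Slide p u w) : Slide q u w := by
  subst ha hb
  exact h.disc hφ hp hq

theorem Path.trans_mem {s : Set F} {c : F} {p : Path a b} {q : Path b c} (hp : ∀ t, p t ∈ s)
    (hq : ∀ t, q t ∈ s) (t : I) : p.trans q t ∈ s := by
  rw [Path.trans_apply]
  split_ifs
  · exact hp _
  · exact hq _

end Disc

namespace PieceDiagram

variable {F : Type u} [TopologicalSpace F] {S : MarkedSurface F} {n m : ℕ}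

/-- Only curves through the two smoothed strands can be new. If the strands lie on two different
null-homotopic curves of `D₀`, these merge into one curve of `D`, again null-homotopic, so two are
traded for one. Otherwise at most one null-homotopic curve of `D₀` uses the strands. -/
theorem IsSmoothing.numNull_le {D D₀ : PieceDiagram S n} {x y : Fin n × I}
    (h : D.IsSmoothing D₀ x y) : D₀.numNull ≤ D.numNull + 1 := by
  classical
  obtain ⟨-, hab, -, -, ⟨φ, hφ, hpa, hpb, hqa, hqb, -⟩, -, -, hpath, ha0, ha1, hb0, hb1, hnext⟩ := h
  generalize x.1 = a at *
  generalize y.1 = b at *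
  have Fa : ∀ f, D₀.Follows a f ↔ D.Follows b f := fun f => by
    unfold Follows; rw [hnext, Equiv.swap_apply_left]
  have Fb : ∀ f, D₀.Follows b f ↔ D.Follows a f := fun f => by
    unfold Follows; rw [hnext, Equiv.swap_apply_right]
  have Fe : ∀ e f, e ≠ a → e ≠ b → (D₀.Follows e f ↔ D.Follows e f) := fun e f h1 h2 => by
    unfold Follows; rw [hnext, Equiv.swap_apply_of_ne_of_ne (by simpa) (by simpa)]
  have hclosed : ∀ s, a ∉ s → b ∉ s → (D₀.IsClosedSet s ↔ D.IsClosedSet s) := by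
    intro s has hbs
    refine forall_congr' fun e => forall_congr' fun he => ?_
    refine exists_congr fun f => and_congr_right fun _ => ?_
    exact Fe e f (fun h => has (h ▸ he)) (fun h => hbs (h ▸ he))
  have hslide : ∀ e, e ≠ a → e ≠ b → ∀ {x₀ : F} {u w : Cover x₀}, Slide (D₀.piece e) u w →
      Slide (D.piece e) u w := fun e h1 h2 _ _ _ h =>
    h.congr fun t => congrArg (fun g : C(I, F) => g t) (hpath e h1 h2)
  have hM : ∀ s ∈ D₀.nullSets, a ∉ s → b ∉ s → s ∈ D.nullSets := by
    rintro s ⟨⟨h1, h2, h3⟩, x₀, G, hG⟩ has hbs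
    refine ⟨⟨h1, (hclosed s has hbs).1 h2, fun t hts hne ht => ?_⟩, x₀, G, fun e he f hef => ?_⟩
    · exact h3 t hts hne ((hclosed t (fun h => has (hts h)) fun h => hbs (hts h)).2 ht)
    · have ha : e ≠ a := fun h => has (h ▸ he)
      have hb : e ≠ b := fun h => hbs (h ▸ he)
      exact hslide e ha hb (hG e he f ((Fe e f ha hb).2 hef))
  have fin : ∀ (X : Set (Finset (Fin n))), X.Finite := fun X => Set.toFinite X
  -- The null-homotopic curves of `D₀` that avoid both strands; they are also curves of `D`.
  set M := {s ∈ D₀.nullSets | a ∉ s ∧ b ∉ s} with hMdef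
  have hMle : M ⊆ D.nullSets := fun s hs => hM s hs.1 hs.2.1 hs.2.2
  rw [numNull_eq, D.numNull_eq]
  by_cases hcase : ∃ s ∈ D₀.nullSets, ∃ t ∈ D₀.nullSets, a ∈ s ∧ b ∈ t ∧ s ≠ t
  · obtain ⟨s, hs, t, ht, has, hbt, hst⟩ := hcase
    have hdisj : ∀ e, e ∈ s → e ∉ t := fun e h1 h2 => hst (hs.1.eq_of_mem ht.1 h1 h2)
    have hsub : D₀.nullSets ⊆ insert s (insert t M) := by
      intro r hr
      by_cases ha : a ∈ r
      · exact Or.inl (hr.1.eq_of_mem hs.1 ha has)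
      by_cases hb : b ∈ r
      · exact Or.inr (Or.inl (hr.1.eq_of_mem ht.1 hb hbt))
      · exact Or.inr (Or.inr ⟨hr, ha, hb⟩)
    have hunion : s ∪ t ∈ D.nullSets := by
      refine ⟨⟨⟨a, Finset.mem_union_left _ has⟩, ?_, ?_⟩, ?_⟩
      · intro e he
        rcases eq_or_ne e a with rfl | hea
        · obtain ⟨f, hf, hef⟩ := ht.1.closed b hbt
          exact ⟨f, Finset.mem_union_right _ hf, (Fb f).1 hef⟩
        rcases eq_or_ne e b with rfl | heb
        · obtain ⟨f, hf, hef⟩ := hs.1.closed a has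
          exact ⟨f, Finset.mem_union_left _ hf, (Fa f).1 hef⟩
        rcases Finset.mem_union.1 he with he | he
        · obtain ⟨f, hf, hef⟩ := hs.1.closed e he
          exact ⟨f, Finset.mem_union_left _ hf, (Fe e f hea heb).1 hef⟩
        · obtain ⟨f, hf, hef⟩ := ht.1.closed e he
          exact ⟨f, Finset.mem_union_right _ hf, (Fe e f hea heb).1 hef⟩
      · intro r hr hne hrc
        -- Away from `a` and `b` the successors agree, and those of `a` and `b` are exchanged. Hence
        -- `r ∩ q` is closed in `D₀` as soon as `r` contains the other strand whenever `r ∩ q`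
        -- contains one.
        have inter : ∀ q, D₀.IsCycleSet q → (r ∩ q).Nonempty →
            (a ∈ r ∩ q → b ∈ r) → (b ∈ r ∩ q → a ∈ r) → q ⊆ r := by
          intro q hq hne h1 h2
          have : r ∩ q = q := by
            refine hq.minimal _ Finset.inter_subset_right hne fun e he => ?_
            obtain ⟨her, heq⟩ := Finset.mem_inter.1 he
            obtain ⟨f, hf, hef⟩ := hq.closed e heq
            refine ⟨f, Finset.mem_inter.2 ⟨?_, hf⟩, hef⟩
            rcases eq_or_ne e a with rfl | hea
            · obtain ⟨g, hg, hbg⟩ := hrc b (h1 he)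
              rwa [((Fa f).1 hef).right_unique hbg]
            rcases eq_or_ne e b with rfl | heb
            · obtain ⟨g, hg, hbg⟩ := hrc a (h2 he)
              rwa [((Fb f).1 hef).right_unique hbg]
            · obtain ⟨g, hg, hbg⟩ := hrc e her
              rwa [((Fe e f hea heb).1 hef).right_unique hbg]
          rw [← this]; exact Finset.inter_subset_left
        have hor : (r ∩ s).Nonempty ∨ (r ∩ t).Nonempty := by
          obtain ⟨e, he⟩ := hne
          rcases Finset.mem_union.1 (hr he) with h | h
          · exact Or.inl ⟨e, Finset.mem_inter.2 ⟨he, h⟩⟩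
          · exact Or.inr ⟨e, Finset.mem_inter.2 ⟨he, h⟩⟩
        have hnb : ∀ {P : Prop}, b ∈ r ∩ s → P := fun h =>
          absurd hbt (hdisj b (Finset.mem_inter.1 h).2)
        have hna : ∀ {P : Prop}, a ∈ r ∩ t → P := fun h =>
          absurd (Finset.mem_inter.1 h).2 (hdisj a has)
        -- If `r` contained only `a`, the successor of `a` in `D` would lie on the curve `t` of `b`,
        -- and `inter` would put `b` into `r`; likewise with the strands exchanged. If `r` contained
        -- neither, `inter` would apply to a curve that `r` meets.
        have hab' : a ∈ r ∧ b ∈ r := by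
          by_contra hcon
          by_cases har : a ∈ r
          · have hbr : b ∉ r := fun h => hcon ⟨har, h⟩
            obtain ⟨f, hf, haf⟩ := hrc a har
            obtain ⟨f', hf', hbf⟩ := ht.1.closed b hbt
            obtain rfl := haf.right_unique ((Fb f').1 hbf)
            exact hbr (inter t ht.1 ⟨f, Finset.mem_inter.2 ⟨hf, hf'⟩⟩ hna
              (fun _ => har) hbt)
          · by_cases hbr : b ∈ r
            · obtain ⟨f, hf, haf⟩ := hrc b hbr
              obtain ⟨f', hf', hbf⟩ := hs.1.closed a has
              obtain rfl := haf.right_unique ((Fa f').1 hbf)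
              exact har (inter s hs.1 ⟨f, Finset.mem_inter.2 ⟨hf, hf'⟩⟩ (fun _ => hbr)
                hnb has)
            · rcases hor with h | h
              · exact har (inter s hs.1 h (fun h => absurd (Finset.mem_inter.1 h).1 har) hnb has)
              · exact hbr (inter t ht.1 h hna (fun h => absurd (Finset.mem_inter.1 h).1 hbr) hbt)
        refine Finset.Subset.antisymm hr (Finset.union_subset ?_ ?_)
        · exact inter s hs.1 ⟨a, Finset.mem_inter.2 ⟨hab'.1, has⟩⟩ (fun _ => hab'.2) fun _ => hab'.1
        · exact inter t ht.1 ⟨b, Finset.mem_inter.2 ⟨hab'.2, hbt⟩⟩ (fun _ => hab'.2) fun _ => hab'.1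
      · obtain ⟨hs, x₀, G, hG⟩ := hs
        obtain ⟨ht, x₁, K, hK⟩ := ht
        -- The path `δ` joins the starts of the strands inside the disc, and the lift of `t` is
        -- rebased so that `δ` leads from the lift of `a` to that of `b`. In the disc, `a` in `D` is
        -- then homotopic to `δ` followed by `b` in `D₀`, and `b` in `D` to the reverse of `δ`
        -- followed by `a` in `D₀`.
        obtain ⟨δ, hδ⟩ := exists_path_of_disc hφ (hqa.mem_range 0) (hqb.mem_range 0)
        obtain ⟨fa, hfa, hafa⟩ := hs.closed a has
        obtain ⟨fb, hfb, hbfb⟩ := ht.closed b hbt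
        have hGa := hG a has fa hafa
        obtain ⟨w, hw⟩ := Slide.exists δ hGa.fst_left
        obtain ⟨q, hq⟩ := Cover.exists_rebase (K b) w
          ((hK b hbt fb hbfb).fst_left.trans hw.fst_right.symm)
        have hKb := (hK b hbt fb hbfb).rebase q
        rw [hq] at hKb
        refine ⟨x₀, fun e => if e ∈ s then G e else (K e).rebase q, fun e he f hef => ?_⟩
        rcases eq_or_ne e a with rfl | hea
        · obtain rfl := hef.right_unique ((Fb fb).1 hbfb)
          simp only [if_pos has, if_neg fun h => hdisj f h hfb]
          exact (hw.trans hKb).disc' hφ ha0 hb1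
            (Path.trans_mem hδ hqb.mem_range) hpa.mem_range
        rcases eq_or_ne e b with rfl | heb
        · obtain rfl := hef.right_unique ((Fa fa).1 hafa)
          simp only [if_pos hfa, if_neg fun h => hdisj e h hbt, hq]
          exact (hw.symm.trans hGa).disc' hφ hb0 ha1
            (Path.trans_mem (fun t => hδ _) hqa.mem_range) hpb.mem_range
        have hef' := (Fe e f hea heb).2 hef
        refine hslide e hea heb ?_
        rcases Finset.mem_union.1 he with he | he
        · obtain ⟨f', hf', h'⟩ := hs.closed e he
          obtain rfl := hef'.right_unique h'
          simp only [if_pos he, if_pos hf']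
          exact hG e he f hef'
        · obtain ⟨f', hf', h'⟩ := ht.closed e he
          obtain rfl := hef'.right_unique h'
          simp only [if_neg fun h => hdisj e h he, if_neg fun h => hdisj f h hf']
          exact (hK e he f hef').rebase q
    -- The count: `D₀` has at most `M.ncard + 2` null-homotopic curves, and `D` has at least
    -- `M.ncard + 1`.
    have hnot : s ∪ t ∉ M := fun h => h.2.1 (Finset.mem_union_left _ has)
    have h1 := Set.ncard_le_ncard hsub (fin _)
    have h2 := Set.ncard_insert_le s (insert t M)
    have h3 := Set.ncard_insert_le t M
    have h4 := Set.ncard_le_ncard (Set.insert_subset hunion hMle) (fin _)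
    rw [Set.ncard_insert_of_notMem hnot] at h4
    omega
  -- Now all null-homotopic curves through `a` or `b` coincide.
  · have : ∃ s, D₀.nullSets ⊆ insert s M := by
      by_cases h : ∃ s ∈ D₀.nullSets, a ∈ s ∨ b ∈ s
      · obtain ⟨s, hs, h⟩ := h
        refine ⟨s, fun r hr => ?_⟩
        by_cases hr' : a ∉ r ∧ b ∉ r
        · exact Or.inr ⟨hr, hr'⟩
        left
        rw [not_and_or, not_not, not_not] at hr'
        push Not at hcase
        rcases h with h | h <;> rcases hr' with hr' | hr'
        · exact hr.1.eq_of_mem hs.1 hr' h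
        · exact (hcase s hs r hr h hr').symm
        · exact hcase r hr s hs hr' h
        · exact hr.1.eq_of_mem hs.1 hr' h
      · push Not at h
        exact ⟨∅, fun r hr => Or.inr ⟨hr, (h r hr).1, (h r hr).2⟩⟩
    obtain ⟨s, hs⟩ := this
    have h1 := Set.ncard_le_ncard hs (fin _)
    have h2 := Set.ncard_insert_le s M
    have h3 := Set.ncard_le_ncard hMle (fin _)
    omega

/-- A curve of `D`, as a set of pieces, corresponds to the set of all parts of these pieces. Lifts
are extended to the parts by sliding along the pieces, and restricted to the first part of each
piece in the other direction. -/
theorem Subdivides.numNull_eq {D' : PieceDiagram S n} {D : PieceDiagram S m}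
    (h : D'.Subdivides D) : D'.numNull = D.numNull := by
  classical
  obtain ⟨π, τ, hτ, hsurj, hpath, habove, hnext, -, hout⟩ := h
  have mono0 : ∀ e, τ e 0 < τ e 1 := fun e => (hτ e).2 zero_lt_one
  -- Both parameters give one point of `D`. This is no crossing, because `above_ne` excludes a
  -- crossing of a parameter with itself; so `D'.meet` leaves equality or a joint.
  have hinj : ∀ e t f s, π e = π f → τ e t = τ f s → (e = f ∧ t = s) ∨ t = 1 ∨ s = 1 := by
    intro e t f s h1 h2
    have hp : D'.path (e, t).1 (e, t).2 = D'.path (f, s).1 (f, s).2 := by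
      simp only [hpath, h1, h2]
    rcases D'.meet _ _ hp with h | h | h | h | h
    · exact Or.inl (Prod.mk.inj h)
    · rw [habove] at h; exact absurd (by simp [h1, h2]) (D.above_ne _ _ h)
    · rw [habove] at h; exact absurd (by simp [h1, h2]) (D.above_ne _ _ h)
    · exact Or.inr (Or.inl h.1)
    · exact Or.inr (Or.inr h.1)
  have hcont : ∀ e, τ e 1 < 1 → ∃ f, π e = π f ∧ τ e 1 = τ f 0 ∧ D'.Follows e f := by
    intro e he
    rcases hf : D'.next (Sum.inr e) with b | f
    · exact absurd ((hout e b).1 hf).1 he.ne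
    · rcases (hnext e f).1 hf with h | h
      · exact ⟨f, h.1, h.2, hf⟩
      · exact absurd h.1 he.ne
  have hlast : ∀ g, ∃ e, π e = g ∧ τ e 1 = 1 := by
    intro g
    obtain ⟨e, t, h⟩ := hsurj (g, 1)
    obtain ⟨h1, h2⟩ := Prod.mk.inj h
    exact ⟨e, h1, le_antisymm le_top (h2.symm.le.trans ((hτ e).2.monotone unitInterval.le_one'))⟩
  have hfirst : ∀ g, ∃ e, π e = g ∧ τ e 0 = 0 := by
    intro g
    obtain ⟨e, t, h⟩ := hsurj (g, 0)
    obtain ⟨h1, h2⟩ := Prod.mk.inj h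
    exact ⟨e, h1, le_antisymm (((hτ e).2.monotone unitInterval.nonneg').trans h2.le) bot_le⟩
  choose first hfπ hfτ using hfirst
  have first_eq : ∀ e, τ e 0 = 0 → first (π e) = e := by
    intro e he
    rcases hinj (first (π e)) 0 e 0 (hfπ _) ((hfτ _).trans he.symm) with h | h | h
    · exact h.1
    · exact absurd h zero_ne_one
    · exact absurd h zero_ne_one
  -- Induction along the parts of one piece. To reach `e'`, take the last part with the property
  -- that starts no later than `e'`. If it ended before the start of `e'`, its successor would be a
  -- later choice; otherwise `e'` starts inside it, and the two coincide.
  have fiber : ∀ (g : Fin m) (P : Fin n → Prop), P (first g) →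
      (∀ e f, π e = g → π e = π f → τ e 1 = τ f 0 → D'.Follows e f → P e → P f) →
      ∀ e, π e = g → P e := by
    intro g P h0 hstep e' he'
    obtain ⟨e, he, hmax⟩ := (Finset.univ.filter fun e => π e = g ∧ P e ∧ τ e 0 ≤ τ e' 0)
      |>.exists_max_image (fun e => τ e 0)
      ⟨first g, by simp only [Finset.mem_filter, Finset.mem_univ, true_and]
                   exact ⟨hfπ g, h0, by rw [hfτ]; exact bot_le⟩⟩
    simp only [Finset.mem_filter, Finset.mem_univ, true_and] at he hmax
    obtain ⟨heg, hP, hle⟩ := he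
    rcases le_or_gt (τ e 1) (τ e' 0) with h | h
    · obtain ⟨f, hf1, hf2, hf3⟩ := hcont e (h.trans_lt ((mono0 e').trans_le le_top))
      have := hmax f ⟨hf1.symm.trans heg, hstep e f heg hf1 hf2 hf3 hP, hf2 ▸ h⟩
      exact absurd (mono0 e) (not_lt.2 (hf2 ▸ this))
    · obtain ⟨t, ht⟩ : τ e' 0 ∈ Set.range (τ e) :=
        mem_range_of_exists_le_of_exists_ge (hτ e).1 ⟨0, hle⟩ ⟨1, h.le⟩
      rcases hinj e t e' 0 (heg.trans he'.symm) ht with h' | h' | h'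
      · exact h'.1 ▸ hP
      · rw [h'] at ht; exact absurd ht h.ne'
      · exact absurd h' zero_ne_one
  let ι : Finset (Fin m) → Finset (Fin n) := fun K => Finset.univ.filter fun e => π e ∈ K
  have hι : ∀ K e, e ∈ ι K ↔ π e ∈ K := fun K e => by simp [ι]
  have hιsub : ∀ K L, ι K ⊆ ι L → K ⊆ L := by
    intro K L h g hg
    have := h ((hι K (first g)).2 (by rwa [hfπ]))
    rwa [hι, hfπ] at this
  have hιinj : Function.Injective ι := fun K L h =>
    Finset.Subset.antisymm (hιsub _ _ h.subset) (hιsub _ _ h.symm.subset)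
  have hιne : ∀ K, K.Nonempty → (ι K).Nonempty := fun K ⟨g, hg⟩ =>
    ⟨first g, (hι _ _).2 (by rwa [hfπ])⟩
  have hclosed : ∀ K, D.IsClosedSet K → D'.IsClosedSet (ι K) := by
    intro K hK e he
    rw [hι] at he
    rcases lt_or_eq_of_le (le_top : τ e 1 ≤ 1) with h | h
    · obtain ⟨f, hf1, -, hf3⟩ := hcont e h
      exact ⟨f, (hι _ _).2 (hf1 ▸ he), hf3⟩
    · obtain ⟨g, hg, hfg⟩ := hK _ he
      refine ⟨first g, (hι _ _).2 (by rwa [hfπ]), (hnext _ _).2 (Or.inr ⟨h, hfτ g, ?_⟩)⟩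
      rw [hfπ]; exact hfg
  have junction : ∀ e f, D'.Follows e f → τ e 1 = 1 → first (π f) = f ∧ D.Follows (π e) (π f) := by
    intro e f hef h1
    rcases (hnext e f).1 hef with h | h
    · have := mono0 f
      rw [← h.2, h1] at this
      exact absurd this (not_lt.2 le_top)
    · exact ⟨first_eq f h.2.1, h.2.2⟩
  -- A closed set that contains the first part of a piece contains all its parts, and then the first
  -- part of the next piece.
  have core : ∀ s, s.Nonempty → D'.IsClosedSet s →
      ∃ K : Finset (Fin m), K.Nonempty ∧ D.IsClosedSet K ∧ ι K ⊆ s := by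
    intro s hne hs
    refine ⟨Finset.univ.filter fun g => first g ∈ s, ?_, ?_, ?_⟩
    -- A part with the greatest end parameter ends its piece, since a successor within the piece
    -- would end later. Its successor is thus a first part.
    · obtain ⟨e, he, hmax⟩ := s.exists_max_image (fun e => τ e 1) hne
      obtain ⟨f, hf, hef⟩ := hs e he
      rcases lt_or_eq_of_le (le_top : τ e 1 ≤ 1) with h | h
      · obtain ⟨f', -, hf2, hf3⟩ := hcont e h
        obtain rfl := hef.right_unique hf3
        exact absurd (mono0 f) (not_lt.2 (hf2 ▸ hmax f hf))
      · exact ⟨π f, by simpa [(junction e f hef h).1] using hf⟩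
    · intro g hg
      simp only [Finset.mem_filter, Finset.mem_univ, true_and] at hg
      obtain ⟨e, heg, he1⟩ := hlast g
      have hes : e ∈ s := by
        refine fiber g (fun e => e ∈ s) hg (fun e f _ _ _ hef he => ?_) e heg
        obtain ⟨f', hf', hef'⟩ := hs e he
        rwa [hef.right_unique hef']
      obtain ⟨f, hf, hef⟩ := hs e hes
      obtain ⟨h1, h2⟩ := junction e f hef he1
      refine ⟨π f, by simpa [h1] using hf, heg ▸ h2⟩
    · intro e he
      rw [hι] at he
      simp only [Finset.mem_filter, Finset.mem_univ, true_and] at he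
      refine fiber (π e) (fun e => e ∈ s) he (fun e f _ _ _ hef he => ?_) e rfl
      obtain ⟨f', hf', hef'⟩ := hs e he
      rwa [hef.right_unique hef']
  have hcycle : ∀ K, D'.IsCycleSet (ι K) ↔ D.IsCycleSet K := by
    intro K
    constructor
    · rintro ⟨h1, h2, h3⟩
      obtain ⟨L, hL1, hL2, hL3⟩ := core _ h1 h2
      obtain rfl := hιinj (h3 _ hL3 (hιne L hL1) (hclosed L hL2))
      refine ⟨hL1, hL2, fun t ht hne htc => hιinj ?_⟩
      refine h3 _ (fun e he => ?_) (hιne t hne) (hclosed t htc)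
      rw [hι] at he ⊢; exact ht he
    · rintro ⟨h1, h2, h3⟩
      refine ⟨hιne K h1, hclosed K h2, fun t ht hne htc => ?_⟩
      obtain ⟨L, hL1, hL2, hL3⟩ := core t hne htc
      obtain rfl := h3 L (hιsub _ _ (hL3.trans ht)) hL1 hL2
      exact Finset.Subset.antisymm ht hL3
  have hex : ∀ s, D'.IsCycleSet s → ∃ K, ι K = s := by
    rintro s ⟨h1, h2, h3⟩
    obtain ⟨L, hL1, hL2, hL3⟩ := core s h1 h2
    exact ⟨L, h3 _ hL3 (hιne L hL1) (hclosed L hL2)⟩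
  have piece_iff : ∀ e {x₀ : F} {u w : Cover x₀}, Slide (D'.piece e) u w ↔
      Slide (part (D.path (π e)) (τ e 0) (τ e 1)) u w := by
    intro e x₀ u w
    refine Iff.trans ?_ (slide_part_comp (γ := D.path (π e)) (τ := ⟨τ e, (hτ e).1⟩) (s := 0) (t := 1))
    have : ∀ t, D'.piece e t = part ((D.path (π e)).comp ⟨τ e, (hτ e).1⟩) 0 1 t := by
      intro t
      exact (hpath e t).trans (by simp [part, paramPath])
    exact ⟨fun h => h.congr this, fun h => h.congr fun t => (this t).symm⟩
  have piece_part : ∀ g {x₀ : F} {u w : Cover x₀}, Slide (D.piece g) u w ↔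
      Slide (part (D.path g) 0 1) u w := by
    intro g x₀ u w
    have : ∀ t, D.piece g t = part (D.path g) 0 1 t := by
      intro t
      simp [part, paramPath, piece]
    exact ⟨fun h => h.congr this, fun h => h.congr fun t => (this t).symm⟩
  have hlift : ∀ K, D.IsClosedSet K → ((∃ (x₀ : F) (G : Fin n → Cover x₀), D'.Lifts (ι K) G) ↔
      ∃ (x₀ : F) (G : Fin m → Cover x₀), D.Lifts K G) := by
    intro K hK
    constructor
    · rintro ⟨x₀, G, hG⟩
      refine ⟨x₀, fun g => G (first g), fun g hg h hgh => ?_⟩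
      obtain ⟨f₀, hf₀, hff₀⟩ := hclosed K hK (first g) ((hι _ _).2 (by rwa [hfπ]))
      have hstart : (G (first g)).1 = D.path g 0 := by
        rw [(hG _ ((hι _ _).2 (by rwa [hfπ])) f₀ hff₀).fst_left, hpath, hfπ, hfτ]
      have claim : ∀ e, π e = g → Slide (part (D.path g) 0 (τ e 0)) (G (first g)) (G e) := by
        refine fiber g _ ?_ ?_
        · rw [hfτ]; exact slide_part_self hstart
        · intro e f he _ hef hF ih
          have h1 := (piece_iff e).1 (hG e ((hι _ _).2 (by rwa [he])) f hF)
          rw [he, hef] at h1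
          exact ih.part_trans h1
      obtain ⟨e, he, he1⟩ := hlast g
      have hF : D'.Follows e (first h) :=
        (hnext _ _).2 (Or.inr ⟨he1, hfτ h, by rw [he, hfπ]; exact hgh⟩)
      have h1 := (piece_iff e).1 (hG e ((hι _ _).2 (by rwa [he])) _ hF)
      rw [he, he1] at h1
      exact (piece_part g).2 ((claim e he).part_trans h1)
    · rintro ⟨x₀, G, hG⟩
      -- A part is lifted by sliding the lift of its piece up to the start of the part.
      have hbase : ∀ e, ∃ w : Cover x₀, (G (π e)).1 = D.path (π e) 0 →
          Slide (part (D.path (π e)) 0 (τ e 0)) (G (π e)) w := by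
        intro e
        by_cases he : (G (π e)).1 = D.path (π e) 0
        · obtain ⟨w, hw⟩ := Slide.exists (part (D.path (π e)) 0 (τ e 0)) he
          exact ⟨w, fun _ => hw⟩
        · exact ⟨G (π e), fun h => absurd h he⟩
      choose G' hG' using hbase
      refine ⟨x₀, G', fun e he f hef => (piece_iff e).2 ?_⟩
      rw [hι] at he
      obtain ⟨h, hh, hgh⟩ := hK _ he
      have hs := hG _ he h hgh
      have he' := hG' e hs.fst_left
      rcases (hnext e f).1 hef with ⟨h1, h2⟩ | ⟨h1, h2, h3⟩
      · have hf' := hG' f (h1 ▸ hs.fst_left)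
        rw [← h1, ← h2] at hf'
        exact he'.of_part_trans hf'
      · obtain rfl := hgh.right_unique h3
        have hst := hs.fst_right.trans (join_inr hgh)
        have hf' := hG' f hst
        rw [h2] at hf'
        rw [h1, hf'.unique (slide_part_self hst)]
        exact he'.of_part_trans ((piece_part _).1 hs)
  have hset : D'.nullSets = ι '' D.nullSets := by
    ext s
    constructor
    · rintro ⟨h1, h2⟩
      obtain ⟨K, rfl⟩ := hex s h1
      have hK := (hcycle K).1 h1
      exact ⟨K, ⟨hK, (hlift K hK.closed).1 h2⟩, rfl⟩
    · rintro ⟨K, ⟨h1, h2⟩, rfl⟩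
      exact ⟨(hcycle K).2 h1, (hlift K h1.closed).2 h2⟩
  rw [D'.numNull_eq, D.numNull_eq, hset, Set.ncard_image_of_injective _ hιinj]

end PieceDiagram

/-! ### Signs of crossings and identities in the skein -/

theorem RunsAlong.comp {F : Type u} {φ φ' : ℂ → F} {d d' : ℂ} {γ : I → F} {t : I} (h : RunsAlong φ d γ t)
    (h0 : φ' 0 = φ 0) (hd : ∀ r : ℝ, φ' (r * d') = φ (r * d)) : RunsAlong φ' d' γ t := by
  obtain ⟨h1, h2, h3⟩ := h
  refine ⟨h0.trans h1, h2.mono ?_, h3.mono ?_⟩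
  · rintro s ⟨_, ⟨r, hr, rfl⟩, hs⟩
    exact ⟨_, ⟨r, hr, rfl⟩, (hd r).trans hs⟩
  · rintro s ⟨_, ⟨r, hr, rfl⟩, hs⟩
    exact ⟨_, ⟨r, hr, rfl⟩, (hd r).trans hs⟩

variable {F : Type u} [TopologicalSpace F] {S : MarkedSurface F} {n m : ℕ}

namespace PieceDiagram

/-- If the chart of a transverse crossing is not positively oriented, its mirror image is. There the
strands run along `1` and `-I`, and a quarter turn, which is an isotopy and so preserves
orientation, brings them to `I` and `1`. -/
theorem isPositive_or_isNegative (D : PieceDiagram S n) {x y : Fin n × I} (h : D.above x y) :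
    D.IsPositive x y ∨ D.IsNegative x y := by
  obtain ⟨φ, hφ, hx, hy⟩ := D.transverse x y h
  by_cases hpos : φ ∈ S.pos
  · exact Or.inl ⟨h, φ, hpos, hx, hy⟩
  right
  have hψ : (fun w => φ (starRingEnd ℂ w)) ∈ S.pos := by
    by_contra hcon
    exact hpos ((S.pos_mirror φ hφ).2 hcon)
  have hψe := S.pos_isOpenEmbedding _ hψ
  let ρ : I → ℂ → ℂ := fun t w => Complex.exp (-(t : ℝ) * (Real.pi / 2) * Complex.I) * w
  have hρ : ∀ t, IsOpenEmbedding (ρ t) := fun t =>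
    (Homeomorph.mulLeft₀ _ (Complex.exp_ne_zero _)).isOpenEmbedding
  have hρ0 : ∀ w, ρ 0 w = w := fun w => by simp [ρ]
  have hρ1 : ∀ w, ρ 1 w = -Complex.I * w := fun w => by
    have : Complex.exp (-(Real.pi / 2) * Complex.I) = -Complex.I := by
      rw [neg_mul, Complex.exp_neg, Complex.exp_mul_I]
      have h1 : ((Real.pi : ℂ) / 2) = ((Real.pi / 2 : ℝ) : ℂ) := by push_cast; rfl
      rw [h1, ← Complex.ofReal_cos, ← Complex.ofReal_sin]
      simp
    simp only [ρ, Set.Icc.coe_one, Complex.ofReal_one, neg_mul, one_mul]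
    rw [← neg_mul, this, neg_mul]
  have hcont : Continuous (fun p : I × ℂ => ρ p.1 p.2) := by
    simp only [ρ]; fun_prop
  have hend := S.pos_isotopy (fun t w => φ (starRingEnd ℂ (ρ t w)))
    (hψe.continuous.comp hcont) (fun t => hψe.comp (hρ t)) (by simpa only [hρ0] using hψ)
  simp only [hρ1] at hend
  refine ⟨h, _, hend, hx.comp (by simp) fun r => ?_, hy.comp (by simp) fun r => ?_⟩
  · congr 1
    simp only [map_mul, map_neg, Complex.conj_I, Complex.conj_ofReal]
    ring_nf
    rw [Complex.I_sq]; ring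
  · congr 1
    simp [mul_comm]

theorem IsSwitch.symm {D D' : PieceDiagram S n} {x y : Fin n × I} (h : D.IsSwitch D' x y) :
    D'.IsSwitch D y x := by
  obtain ⟨h1, h2, h3, h4⟩ := h
  have hne := D.above_ne _ _ h1
  have has := D.above_asymm _ _ h1
  refine ⟨(h4 y x).2 (Or.inr ⟨rfl, rfl⟩), h2.symm, h3.symm, fun u w => ?_⟩
  rw [h4]
  constructor
  · intro h
    by_cases hu : u = x ∧ w = y
    · exact Or.inr hu
    · left
      refine ⟨Or.inl ⟨h, hu⟩, ?_⟩
      rintro ⟨rfl, rfl⟩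
      exact has h
  · rintro (⟨h | h, h'⟩ | ⟨rfl, rfl⟩)
    · exact h.1
    · exact absurd h h'
    · exact h1

theorem IsNegative.isPositive_switch {D D' : PieceDiagram S n} {x y : Fin n × I}
    (h : D.IsNegative x y) (h' : D.IsSwitch D' x y) : D'.IsPositive y x := by
  obtain ⟨-, φ, hφ, h1, h2⟩ := h
  refine ⟨h'.symm.1, φ, hφ, ?_, ?_⟩
  · rwa [h'.2.1]
  · rwa [h'.2.1]

theorem IsPositive.isNegative_switch {D D' : PieceDiagram S n} {x y : Fin n × I}
    (h : D.IsPositive x y) (h' : D.IsSwitch D' x y) : D'.IsNegative y x := by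
  obtain ⟨-, φ, hφ, h1, h2⟩ := h
  refine ⟨h'.symm.1, φ, hφ, ?_, ?_⟩
  · rwa [h'.2.1]
  · rwa [h'.2.1]

/-- The smoothing does not depend on which strand passes over; the two strands merely exchange their
roles. -/
theorem IsSmoothing.switch {D D' D₀ : PieceDiagram S n} {x y : Fin n × I}
    (h : D.IsSmoothing D₀ x y) (h' : D.IsSwitch D' x y) : D'.IsSmoothing D₀ y x := by
  obtain ⟨h1, h2, h3, h4, ⟨φ, hφ, p1, p2, p3, p4, p5⟩, h6, h7, h8, h9, h10, h11, h12, h13⟩ := h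
  have hs := h'.symm
  obtain ⟨-, hp, hn, ha⟩ := h'
  have hpr : ∀ e, D'.IsProperIn φ e ↔ D.IsProperIn φ e := fun e => by
    unfold IsProperIn; rw [hp]
  refine ⟨hs.1, h2.symm, by rwa [hp], by rwa [hp], ⟨φ, hφ, (hpr _).2 p2, (hpr _).2 p1, p4, p3,
    fun e he he' => by rw [hp]; exact p5 e he' he⟩, fun u w huw hor => ?_, fun u w => ?_,
    fun e he he' => by rw [hp]; exact h8 e he' he, by rw [hp]; exact h11, by rw [hp]; exact h12,
    by rw [hp]; exact h9, by rw [hp]; exact h10, fun z => ?_⟩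
  · rcases (ha u w).1 huw with h | h
    · exact absurd (h6 u w h.1 (by tauto)) h.2
    · exact h
  · rw [h7, ha]
    constructor
    · rintro ⟨h, h'⟩
      refine ⟨Or.inl ⟨h, h'⟩, ?_⟩
      rintro ⟨rfl, rfl⟩
      exact D.above_asymm _ _ h1 h
    · rintro ⟨h | h, h'⟩
      · exact h
      · exact absurd h h'
  · rw [h13, hn, Equiv.swap_comm]

end PieceDiagram

theorem v_mul_vInv : v * vInv = 1 := by
  rw [v, vInv, ← map_mul, ← map_mul, ← LaurentPolynomial.T_add]
  simp

theorem toSkein_sub {D : Diagram S} {r : Diagram S →₀ Coeff}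
    (h : SkeinRelation S (Finsupp.single D 1 - r)) :
    toSkein D = Submodule.Quotient.mk (p := Submodule.span Coeff {r | SkeinRelation S r}) r :=
  (Submodule.Quotient.eq _).2 (Submodule.subset_span h)

theorem IsotopyStep.toSkein_eq {D D' : Diagram S} (h : IsotopyStep S D D') :
    toSkein D = toSkein D' :=
  toSkein_sub (.isotopy h)

theorem PieceDiagram.Subdivides.toSkein_eq {D' : PieceDiagram S n} {D : PieceDiagram S m}
    (h : D'.Subdivides D) : toSkein ⟨n, D'⟩ = toSkein ⟨m, D⟩ :=
  (IsotopyStep.subdivide h).toSkein_eq.symm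

theorem PieceDiagram.IsPositive.toSkein_switch {D D' D₀ : PieceDiagram S n} {x y : Fin n × I}
    (h : D.IsPositive x y) (h' : D.IsSwitch D' x y) (h₀ : D.IsSmoothing D₀ x y) :
    toSkein ⟨n, D⟩ - toSkein ⟨n, D'⟩ = z • toSkein ⟨n, D₀⟩ := by
  have := toSkein_sub (r := formal D' + z • formal D₀)
    (by rw [← sub_sub]; exact SkeinRelation.crossing h h' h₀)
  rw [this, Submodule.Quotient.mk_add, Submodule.Quotient.mk_smul, sub_eq_iff_eq_add']
  rfl

theorem PieceDiagram.IsNegative.toSkein_switch {D D' D₀ : PieceDiagram S n} {x y : Fin n × I}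
    (h : D.IsNegative x y) (h' : D.IsSwitch D' x y) (h₀ : D.IsSmoothing D₀ x y) :
    toSkein ⟨n, D'⟩ - toSkein ⟨n, D⟩ = z • toSkein ⟨n, D₀⟩ :=
  (h.isPositive_switch h').toSkein_switch h'.symm (h₀.switch h')

theorem PieceDiagram.IsPositive.toSkein_curl {D D' : PieceDiagram S n} {x y : Fin n × I}
    (h : D.IsPositive x y) (h' : D.IsCurlRemoval D' x y) :
    toSkein ⟨n, D⟩ = vInv • toSkein ⟨n, D'⟩ :=
  toSkein_sub (r := vInv • formal D') (.positiveCurl h h')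

theorem PieceDiagram.IsNegative.toSkein_curl {D D' : PieceDiagram S n} {x y : Fin n × I}
    (h : D.IsNegative x y) (h' : D.IsCurlRemoval D' x y) :
    toSkein ⟨n, D⟩ = v • toSkein ⟨n, D'⟩ :=
  toSkein_sub (r := v • formal D') (.negativeCurl h h')

/-- The inverse is recorded within `integral` as well, because a resolution tree may also insert
curls. -/
theorem PieceDiagram.IsCurlRemoval.exists_unit {D D' : PieceDiagram S n} {x y : Fin n × I}
    (h : D.IsCurlRemoval D' x y) : ∃ a ∈ integral, ∃ b ∈ integral, a * b = 1 ∧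
      toSkein ⟨n, D⟩ = a • toSkein ⟨n, D'⟩ := by
  have hv : v ∈ integral := Subring.subset_closure (by simp)
  have hv' : vInv ∈ integral := Subring.subset_closure (by simp)
  rcases D.isPositive_or_isNegative h.1 with hs | hs
  · exact ⟨vInv, hv', v, hv, by rw [mul_comm, v_mul_vInv], hs.toSkein_curl h⟩
  · exact ⟨v, hv, vInv, hv', v_mul_vInv, hs.toSkein_curl h⟩

/-- Two ways of removing the same curl give the same element of the skein. -/
theorem PieceDiagram.IsCurlRemoval.toSkein_eq {D D₁ D₂ : PieceDiagram S n} {x y : Fin n × I}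
    (h₁ : D.IsCurlRemoval D₁ x y) (h₂ : D.IsCurlRemoval D₂ x y) :
    toSkein ⟨n, D₁⟩ = toSkein ⟨n, D₂⟩ := by
  rcases D.isPositive_or_isNegative h₁.1 with hs | hs
  · have := congrArg (fun x => v • x) ((hs.toSkein_curl h₁).symm.trans (hs.toSkein_curl h₂))
    simpa only [smul_smul, v_mul_vInv, one_smul] using this
  · have := congrArg (fun x => vInv • x) ((hs.toSkein_curl h₁).symm.trans (hs.toSkein_curl h₂))
    simpa only [smul_smul, mul_comm vInv, v_mul_vInv, one_smul] using this

theorem IsotopyStep.k_eq {D D' : Diagram S} (h : IsotopyStep S D D') : k D' = k D := by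
  cases h with
  | subdivide h => exact h.numNull_eq
  | layer h => simp only [k, PieceDiagram.numNull_eq, h.nullSets_eq]

theorem RegularlyIsotopic.k_eq {D D' : Diagram S} (h : RegularlyIsotopic D D') : k D' = k D := by
  induction h with
  | rel _ _ h => exact h.k_eq
  | refl => rfl
  | symm _ _ _ ih => exact ih.symm
  | trans _ _ _ _ _ ih₁ ih₂ => exact ih₂.trans ih₁

theorem RegularlyIsotopic.toSkein_eq {D D' : Diagram S} (h : RegularlyIsotopic D D') :
    toSkein D = toSkein D' := by
  induction h with
  | rel _ _ h => exact h.toSkein_eq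
  | refl => rfl
  | symm _ _ _ ih => exact ih.symm
  | trans _ _ _ _ _ ih₁ ih₂ => exact ih₁.trans ih₂

/-- The diagram with the power of `z` that counts its null-homotopic curves. -/
noncomputable def weighted (D : Diagram S) : Skein S := z ^ k D • toSkein D

/-! ### Subdivisions built from combinatorial data, and cutting a piece -/

/-- Near the parameter `t` the path is straight in a suitable chart. -/
def FlatAt (γ : I → F) (t : I) : Prop :=
  ∃ φ : ℂ → F, IsOpenEmbedding φ ∧ RunsAlong φ 1 γ t

theorem RunsAlong.comp_strictMono {F : Type u} {φ : ℂ → F} {d : ℂ} {γ : I → F} {τ : I → I} {t : I}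
    (h : RunsAlong φ d γ (τ t)) (hc : Continuous τ) (hm : StrictMono τ) :
    RunsAlong φ d (γ ∘ τ) t := by
  obtain ⟨h1, h2, h3⟩ := h
  refine ⟨h1, ?_, ?_⟩
  · have : Filter.Tendsto τ (𝓝[>] t) (𝓝[>] (τ t)) :=
      tendsto_nhdsWithin_of_tendsto_nhds_of_eventually_within _
        (hc.continuousAt.mono_left nhdsWithin_le_nhds)
        (eventually_nhdsWithin_of_forall fun s hs => hm hs)
    exact this.eventually h2
  · have : Filter.Tendsto τ (𝓝[<] t) (𝓝[<] (τ t)) :=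
      tendsto_nhdsWithin_of_tendsto_nhds_of_eventually_within _
        (hc.continuousAt.mono_left nhdsWithin_le_nhds)
        (eventually_nhdsWithin_of_forall fun s hs => hm hs)
    exact this.eventually h3

namespace PieceDiagram

/-- The data of a subdivision of the diagram `D` into `n` pieces. -/
structure Refinement (D : PieceDiagram S m) (n : ℕ) where
  π : Fin n → Fin m
  τ : Fin n → I → I
  next : Fin S.numIn ⊕ Fin n ≃ Fin S.numOut ⊕ Fin n
  cont : ∀ e, Continuous (τ e)
  mono : ∀ e, StrictMono (τ e)
  surj : ∀ x : Fin m × I, ∃ e t, (π e, τ e t) = x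
  next_inr_inr : ∀ e f, next (Sum.inr e) = Sum.inr f ↔ (π e = π f ∧ τ e 1 = τ f 0) ∨
    (τ e 1 = 1 ∧ τ f 0 = 0 ∧ D.next (Sum.inr (π e)) = Sum.inr (π f))
  next_inl_inr : ∀ a e, next (Sum.inl a) = Sum.inr e ↔
    τ e 0 = 0 ∧ D.next (Sum.inl a) = Sum.inr (π e)
  next_inr_inl : ∀ e b, next (Sum.inr e) = Sum.inl b ↔
    τ e 1 = 1 ∧ D.next (Sum.inr (π e)) = Sum.inl b
  next_inl_inl : ∀ a b, next (Sum.inl a) = Sum.inl b → D.next (Sum.inl a) = Sum.inl b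
  inj : ∀ e f t s, π e = π f → τ e t = τ f s → (e = f ∧ t = s) ∨
    (t = 1 ∧ s = 0 ∧ next (Sum.inr e) = Sum.inr f) ∨
    (s = 1 ∧ t = 0 ∧ next (Sum.inr f) = Sum.inr e)
  ends : ∀ e t x, t = 0 ∨ t = 1 → ¬ D.above (π e, τ e t) x ∧ ¬ D.above x (π e, τ e t)

namespace Refinement

variable {D : PieceDiagram S m} (R : D.Refinement n)

/-- The point of the original diagram at a parameter of the subdivision. -/
def proj (x : Fin n × I) : Fin m × I := (R.π x.1, R.τ x.1 x.2)

theorem inside {x : Fin n × I} {w : Fin m × I}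
    (h : D.above (R.proj x) w ∨ D.above w (R.proj x)) : x.2 ∈ Set.Ioo 0 1 := by
  have h0 : x.2 ≠ 0 := fun h0 => by
    rcases h with h | h
    · exact (R.ends x.1 x.2 w (Or.inl h0)).1 h
    · exact (R.ends x.1 x.2 w (Or.inl h0)).2 h
  have h1 : x.2 ≠ 1 := fun h0 => by
    rcases h with h | h
    · exact (R.ends x.1 x.2 w (Or.inr h0)).1 h
    · exact (R.ends x.1 x.2 w (Or.inr h0)).2 h
  exact ⟨unitInterval.pos_iff_ne_zero.2 h0, unitInterval.lt_one_iff_ne_one.2 h1⟩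

theorem proj_inj {x y : Fin n × I} (h : R.proj x = R.proj y) (hx : x.2 ∈ Set.Ioo 0 1) : x = y := by
  obtain ⟨h1, h2⟩ := Prod.mk.inj h
  rcases R.inj _ _ _ _ h1 h2 with h | h | h
  · exact Prod.ext h.1 h.2
  · exact absurd h.1 hx.2.ne
  · exact absurd h.2.1 hx.1.ne'

theorem eq_zero {e : Fin n} {t : I} (h : R.τ e t = 0) : t = 0 :=
  le_antisymm ((R.mono e).le_iff_le.1 (h.le.trans unitInterval.nonneg')) unitInterval.nonneg'

theorem eq_one {e : Fin n} {t : I} (h : R.τ e t = 1) : t = 1 :=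
  le_antisymm unitInterval.le_one' ((R.mono e).le_iff_le.1 (unitInterval.le_one'.trans h.ge))

/-- The subdivided diagram. -/
def toDiagram : PieceDiagram S n where
  pieces_pos := by
    obtain ⟨e, -⟩ := R.surj (⟨0, D.pieces_pos⟩, 0)
    exact e.pos
  path e := (D.path (R.π e)).comp ⟨R.τ e, R.cont e⟩
  next := R.next
  above x y := D.above (R.proj x) (R.proj y)
  join := by
    rintro (a | e)
    · rcases h : R.next (Sum.inl a) with b | f
      · simpa [R.next_inl_inl a b h] using D.join (Sum.inl a)
      · obtain ⟨h1, h2⟩ := (R.next_inl_inr a f).1 h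
        simpa [h1, h2] using D.join (Sum.inl a)
    · rcases h : R.next (Sum.inr e) with b | f
      · obtain ⟨h1, h2⟩ := (R.next_inr_inl e b).1 h
        simpa [h1, h2] using D.join (Sum.inr (R.π e))
      · rcases (R.next_inr_inr e f).1 h with ⟨h1, h2⟩ | ⟨h1, h2, h3⟩
        · simp [h1, h2]
        · simpa [h1, h2, h3] using D.join (Sum.inr (R.π e))
  boundary := by
    intro e t h
    rcases D.boundary _ _ h with ⟨h1, a, ha⟩ | ⟨h1, b, hb⟩
    · have := R.eq_zero h1
      subst this
      exact Or.inl ⟨rfl, a, (R.next_inl_inr a e).2 ⟨h1, ha⟩⟩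
    · have := R.eq_one h1
      subst this
      exact Or.inr ⟨rfl, b, (R.next_inr_inl e b).2 ⟨h1, hb⟩⟩
  above_point x y h := D.above_point _ _ h
  above_ne x y h := fun hxy => D.above_ne _ _ h (by rw [hxy])
  above_asymm x y h := D.above_asymm _ _ h
  above_inside x y h := ⟨R.inside (Or.inl h), R.inside (Or.inr h)⟩
  above_finite := by
    refine Set.Finite.preimage (f := Prod.map R.proj R.proj) ?_ D.above_finite
    rintro ⟨x, y⟩ h ⟨x', y'⟩ - hxy
    obtain ⟨h1, h2⟩ := Prod.mk.inj hxy
    exact Prod.ext (R.proj_inj h1 (R.inside (Or.inl h))) (R.proj_inj h2 (R.inside (Or.inr h)))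
  no_triple x y z h h' := by
    refine R.proj_inj (D.no_triple _ _ _ h h') ?_
    exact h.elim (fun h => R.inside (Or.inr h)) fun h => R.inside (Or.inl h)
  meet x y h := by
    rcases D.meet (R.proj x) (R.proj y) h with h | h | h | ⟨h1, h2, h3⟩ | ⟨h1, h2, h3⟩
    · obtain ⟨h1, h2⟩ := Prod.mk.inj h
      rcases R.inj _ _ _ _ h1 h2 with h | h | h
      · exact Or.inl (Prod.ext h.1 h.2)
      · exact Or.inr (Or.inr (Or.inr (Or.inl h)))
      · exact Or.inr (Or.inr (Or.inr (Or.inr h)))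
    · exact Or.inr (Or.inl h)
    · exact Or.inr (Or.inr (Or.inl h))
    · have hx := R.eq_one h1
      have hy := R.eq_zero h2
      refine Or.inr (Or.inr (Or.inr (Or.inl ⟨hx, hy, (R.next_inr_inr _ _).2 (Or.inr
        ⟨(congrArg (R.τ x.1) hx).symm.trans h1, (congrArg (R.τ y.1) hy).symm.trans h2, h3⟩)⟩)))
    · have hx := R.eq_one h1
      have hy := R.eq_zero h2
      refine Or.inr (Or.inr (Or.inr (Or.inr ⟨hx, hy, (R.next_inr_inr _ _).2 (Or.inr
        ⟨(congrArg (R.τ y.1) hx).symm.trans h1, (congrArg (R.τ x.1) hy).symm.trans h2, h3⟩)⟩)))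
  flat e := by
    refine ((D.flat (R.π e)).preimage (R.mono e).injective.injOn).subset fun t ht h => ht ?_
    obtain ⟨φ, hφ, hr⟩ := h
    exact ⟨φ, hφ, hr.comp_strictMono (R.cont e) (R.mono e)⟩
  transverse x y h := by
    obtain ⟨φ, hφ, h1, h2⟩ := D.transverse _ _ h
    exact ⟨φ, hφ, h1.comp_strictMono (R.cont _) (R.mono _), h2.comp_strictMono (R.cont _) (R.mono _)⟩

theorem subdivides : R.toDiagram.Subdivides D :=
  ⟨R.π, R.τ, fun e => ⟨R.cont e, R.mono e⟩, R.surj, fun _ _ => rfl, fun _ _ => Iff.rfl,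
    R.next_inr_inr, R.next_inl_inr, R.next_inr_inl⟩

theorem isPositive {x y : Fin n × I} (h : D.IsPositive (R.proj x) (R.proj y)) :
    R.toDiagram.IsPositive x y := by
  obtain ⟨h, φ, hφ, h1, h2⟩ := h
  exact ⟨h, φ, hφ, h1.comp_strictMono (R.cont _) (R.mono _),
    h2.comp_strictMono (R.cont _) (R.mono _)⟩

theorem isNegative {x y : Fin n × I} (h : D.IsNegative (R.proj x) (R.proj y)) :
    R.toDiagram.IsNegative x y := by
  obtain ⟨h, φ, hφ, h1, h2⟩ := h
  exact ⟨h, φ, hφ, h1.comp_strictMono (R.cont _) (R.mono _),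
    h2.comp_strictMono (R.cont _) (R.mono _)⟩

end Refinement

/-- Extend a joining of `n` pieces by a piece joined to itself. -/
def liftNext {A B : Type} (N : A ⊕ Fin n ≃ B ⊕ Fin n) : A ⊕ Fin (n + 1) ≃ B ⊕ Fin (n + 1) where
  toFun := Sum.elim (fun a => Sum.map id Fin.castSucc (N (Sum.inl a)))
    (Fin.lastCases (Sum.inr (Fin.last n)) fun i => Sum.map id Fin.castSucc (N (Sum.inr i)))
  invFun := Sum.elim (fun a => Sum.map id Fin.castSucc (N.symm (Sum.inl a)))
    (Fin.lastCases (Sum.inr (Fin.last n)) fun i => Sum.map id Fin.castSucc (N.symm (Sum.inr i)))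
  left_inv := by
    have key : ∀ x : A ⊕ Fin n, Sum.elim (fun a => Sum.map id Fin.castSucc (N.symm (Sum.inl a)))
        (Fin.lastCases (Sum.inr (Fin.last n)) fun i => Sum.map id Fin.castSucc (N.symm (Sum.inr i)))
        (Sum.map id Fin.castSucc (N x)) = Sum.map id Fin.castSucc x := by
      intro x
      obtain ⟨w, rfl⟩ := N.symm.surjective x
      rcases w with b | j <;> simp
    rintro (a | i)
    · exact key (Sum.inl a)
    · induction i using Fin.lastCases with
      | last => simp
      | cast i => simpa using key (Sum.inr i)
  right_inv := by
    have key : ∀ x : B ⊕ Fin n, Sum.elim (fun a => Sum.map id Fin.castSucc (N (Sum.inl a)))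
        (Fin.lastCases (Sum.inr (Fin.last n)) fun i => Sum.map id Fin.castSucc (N (Sum.inr i)))
        (Sum.map id Fin.castSucc (N.symm x)) = Sum.map id Fin.castSucc x := by
      intro x
      obtain ⟨w, rfl⟩ := N.surjective x
      rcases w with b | j <;> simp
    rintro (a | i)
    · exact key (Sum.inl a)
    · induction i using Fin.lastCases with
      | last => simp
      | cast i => simpa using key (Sum.inr i)

section liftNext

variable {A B : Type} (N : A ⊕ Fin n ≃ B ⊕ Fin n)

@[simp]
theorem liftNext_inl (a : A) :
    liftNext N (Sum.inl a) = Sum.map id Fin.castSucc (N (Sum.inl a)) := rfl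

@[simp]
theorem liftNext_castSucc (i : Fin n) :
    liftNext N (Sum.inr i.castSucc) = Sum.map id Fin.castSucc (N (Sum.inr i)) := by
  simp [liftNext]

@[simp]
theorem liftNext_last : liftNext N (Sum.inr (Fin.last n)) = Sum.inr (Fin.last n) := by
  simp [liftNext]

theorem map_eq_inr_castSucc {x : B ⊕ Fin n} {j : Fin n} :
    Sum.map id Fin.castSucc x = Sum.inr j.castSucc ↔ x = Sum.inr j := by
  rcases x with b | i <;> simp

theorem map_ne_inr_last {x : B ⊕ Fin n} : Sum.map id Fin.castSucc x ≠ Sum.inr (Fin.last n) := by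
  rcases x with b | i
  · simp
  · simp

theorem map_eq_inl {x : B ⊕ Fin n} {b : B} :
    Sum.map id (Fin.castSucc (n := n)) x = Sum.inl b ↔ x = Sum.inl b := by
  rcases x with b | i <;> simp

end liftNext

end PieceDiagram

/-- The affine reparametrisation of the interval from `a` to `b`. -/
def aff (a b : I) : C(I, I) := ⟨Set.Icc.convexComb a b, by fun_prop⟩

theorem coe_aff (a b t : I) : (aff a b t : ℝ) = (1 - t) * a + t * b := rfl

@[simp]
theorem aff_zero (a b : I) : aff a b 0 = a := by
  ext; simp [coe_aff]

@[simp]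
theorem aff_one (a b : I) : aff a b 1 = b := by
  ext; simp [coe_aff]

theorem aff_strictMono {a b : I} (h : a < b) : StrictMono (aff a b) := by
  intro s t hst
  rw [← Subtype.coe_lt_coe] at h hst ⊢
  rw [coe_aff, coe_aff]
  nlinarith

theorem exists_aff {a b t : I} (h1 : a ≤ t) (h2 : t ≤ b) : ∃ s, aff a b s = t :=
  mem_range_of_exists_le_of_exists_ge (aff a b).continuous ⟨0, by simpa⟩ ⟨1, by simpa⟩

theorem aff_mem {a b : I} (h : a < b) (s : I) : a ≤ aff a b s ∧ aff a b s ≤ b := by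
  have hm := (aff_strictMono h).monotone
  exact ⟨by simpa using hm (unitInterval.nonneg' (t := s)),
    by simpa using hm (unitInterval.le_one' (t := s))⟩

namespace PieceDiagram

/-- The piece `e` has no crossing at the parameter `t`. -/
def Uncrossed (D : PieceDiagram S n) (x : Fin n × I) : Prop :=
  ∀ y, ¬ D.above x y ∧ ¬ D.above y x

theorem uncrossed_zero (D : PieceDiagram S n) (e : Fin n) : D.Uncrossed (e, 0) := fun _ =>
  ⟨fun h => (D.above_inside _ _ h).1.1.false, fun h => (D.above_inside _ _ h).2.1.false⟩

theorem uncrossed_one (D : PieceDiagram S n) (e : Fin n) : D.Uncrossed (e, 1) := fun _ =>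
  ⟨fun h => (D.above_inside _ _ h).1.2.false, fun h => (D.above_inside _ _ h).2.2.false⟩

section cutNext

variable {A B : Type} [DecidableEq A] (N : A ⊕ Fin n ≃ B ⊕ Fin n) (e : Fin n)

/-- The joining of the pieces after cutting the piece `e`. -/
def cutNext : A ⊕ Fin (n + 1) ≃ B ⊕ Fin (n + 1) :=
  -- `liftNext` joins the new piece to itself. After the swap, `e` runs into the new piece, which
  -- inherits the old successor of `e`.
  (Equiv.swap (Sum.inr e.castSucc) (Sum.inr (Fin.last n))).trans (liftNext N)

@[simp]
theorem cutNext_inl (a : A) : cutNext N e (Sum.inl a) =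
    Sum.map id Fin.castSucc (N (Sum.inl a)) := by
  rw [cutNext, Equiv.trans_apply, Equiv.swap_apply_of_ne_of_ne (by simp) (by simp), liftNext_inl]

@[simp]
theorem cutNext_self : cutNext N e (Sum.inr e.castSucc) = Sum.inr (Fin.last n) := by
  rw [cutNext, Equiv.trans_apply, Equiv.swap_apply_left, liftNext_last]

@[simp]
theorem cutNext_last : cutNext N e (Sum.inr (Fin.last n)) =
    Sum.map id Fin.castSucc (N (Sum.inr e)) := by
  rw [cutNext, Equiv.trans_apply, Equiv.swap_apply_right, liftNext_castSucc]

theorem cutNext_of_ne {i : Fin n} (h : i ≠ e) : cutNext N e (Sum.inr i.castSucc) =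
    Sum.map id Fin.castSucc (N (Sum.inr i)) := by
  rw [cutNext, Equiv.trans_apply, Equiv.swap_apply_of_ne_of_ne (by simpa) (by simp),
    liftNext_castSucc]

end cutNext

/-- Cutting the piece `e` at the parameter `t`. The second part becomes the last piece. -/
def cut (D : PieceDiagram S n) (e : Fin n) (t : I) (h0 : 0 < t) (h1 : t < 1)
    (h : D.Uncrossed (e, t)) : D.Refinement (n + 1) where
  π := Fin.lastCases e id
  τ := Fin.lastCases (aff t 1) fun i => if i = e then aff 0 t else id
  next := cutNext D.next e
  cont i := by
    induction i using Fin.lastCases with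
    | last => simpa using (aff t 1).continuous
    | cast i =>
      rw [Fin.lastCases_castSucc]
      split_ifs
      · exact (aff 0 t).continuous
      · exact continuous_id
  mono i := by
    induction i using Fin.lastCases with
    | last => simpa using aff_strictMono h1
    | cast i =>
      rw [Fin.lastCases_castSucc]
      split_ifs
      · exact aff_strictMono h0
      · exact strictMono_id
  surj x := by
    obtain ⟨i, s⟩ := x
    by_cases hi : i = e
    · subst hi
      rcases le_total s t with hs | hs
      · obtain ⟨r, hr⟩ := exists_aff unitInterval.nonneg' hs
        exact ⟨i.castSucc, r, by simp [hr]⟩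
      · obtain ⟨r, hr⟩ := exists_aff hs unitInterval.le_one'
        exact ⟨Fin.last n, r, by simp [hr]⟩
    · exact ⟨i.castSucc, s, by simp [hi]⟩
  next_inr_inr i j := by
    induction i using Fin.lastCases with
    | last =>
      induction j using Fin.lastCases with
      | last => simp [map_ne_inr_last, h1.ne', h0.ne']
      | cast j =>
        rw [cutNext_last, map_eq_inr_castSucc]
        by_cases hj : j = e
        · subst hj; simp
        · simp [hj, Ne.symm hj]
    | cast i =>
      by_cases hi : i = e
      · subst hi
        induction j using Fin.lastCases with
        | last => simp
        | cast j =>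
          rw [cutNext_self]
          by_cases hj : j = i
          · subst hj; simp [h0.ne', h1.ne, (Fin.castSucc_lt_last j).ne']
          · simp [hj, Ne.symm hj, h1.ne, (Fin.castSucc_lt_last j).ne']
      · rw [cutNext_of_ne _ _ hi]
        induction j using Fin.lastCases with
        | last => simp [map_ne_inr_last, hi, h0.ne']
        | cast j =>
          rw [map_eq_inr_castSucc]
          by_cases hj : j = e
          · subst hj; simp [hi]
          · simp [hi, hj]
  next_inl_inr a i := by
    induction i using Fin.lastCases with
    | last => simp [map_ne_inr_last, h0.ne']
    | cast i =>
      rw [cutNext_inl, map_eq_inr_castSucc]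
      by_cases hi : i = e
      · subst hi; simp
      · simp [hi]
  next_inr_inl i b := by
    induction i using Fin.lastCases with
    | last => rw [cutNext_last, map_eq_inl]; simp
    | cast i =>
      by_cases hi : i = e
      · subst hi; rw [cutNext_self]; simp [h1.ne]
      · rw [cutNext_of_ne _ _ hi, map_eq_inl]; simp [hi]
  next_inl_inl a b h := by
    simpa [map_eq_inl] using h
  inj i j r s hπ hτ := by
    have split : ∀ r s, aff t 1 r = aff 0 t s → r = 0 ∧ s = 1 := by
      intro r s h
      have ha := (aff_mem h1 r).1
      have hb := (aff_mem h0 s).2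
      constructor
      · refine (aff_strictMono h1).injective ?_
        rw [aff_zero]; exact le_antisymm (h.le.trans hb) ha
      · refine (aff_strictMono h0).injective ?_
        rw [aff_one]; exact le_antisymm hb (ha.trans h.le)
    induction i using Fin.lastCases with
    | last =>
      induction j using Fin.lastCases with
      | last =>
        simp only [Fin.lastCases_last] at hτ
        exact Or.inl ⟨rfl, (aff_strictMono h1).injective hτ⟩
      | cast j =>
        simp only [Fin.lastCases_last, Fin.lastCases_castSucc, id] at hπ hτ
        subst hπ
        rw [if_pos rfl] at hτ
        obtain ⟨rfl, rfl⟩ := split _ _ hτ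
        exact Or.inr (Or.inr ⟨rfl, rfl, cutNext_self _ _⟩)
    | cast i =>
      induction j using Fin.lastCases with
      | last =>
        simp only [Fin.lastCases_last, Fin.lastCases_castSucc, id] at hπ hτ
        subst hπ
        rw [if_pos rfl] at hτ
        obtain ⟨rfl, rfl⟩ := split _ _ hτ.symm
        exact Or.inr (Or.inl ⟨rfl, rfl, cutNext_self _ _⟩)
      | cast j =>
        simp only [Fin.lastCases_castSucc, id] at hπ hτ
        subst hπ
        refine Or.inl ⟨rfl, ?_⟩
        split_ifs at hτ
        · exact (aff_strictMono h0).injective hτ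
        · exact hτ
  ends i s x hs := by
    induction i using Fin.lastCases with
    | last =>
      rcases hs with rfl | rfl
      · simpa using h x
      · simpa using D.uncrossed_one e x
    | cast i =>
      by_cases hi : i = e
      · subst hi
        rcases hs with rfl | rfl
        · simpa using D.uncrossed_zero i x
        · simpa using h x
      · rcases hs with rfl | rfl
        · simpa [hi] using D.uncrossed_zero i x
        · simpa [hi] using D.uncrossed_one i x

section cut

variable (D : PieceDiagram S n) (e : Fin n) (t : I) (h0 : 0 < t) (h1 : t < 1)
  (h : D.Uncrossed (e, t))

theorem cut_path_last (s : I) :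
    (D.cut e t h0 h1 h).toDiagram.path (Fin.last n) s = D.path e (aff t 1 s) := by
  simp [Refinement.toDiagram, cut]

theorem cut_path_self (s : I) :
    (D.cut e t h0 h1 h).toDiagram.path e.castSucc s = D.path e (aff 0 t s) := by
  simp [Refinement.toDiagram, cut]

theorem cut_path_of_ne {i : Fin n} (hi : i ≠ e) :
    (D.cut e t h0 h1 h).toDiagram.path i.castSucc = D.path i := by
  ext s
  simp [Refinement.toDiagram, cut, hi]

theorem cut_above (x y : Fin (n + 1) × I) : (D.cut e t h0 h1 h).toDiagram.above x y ↔
    D.above ((D.cut e t h0 h1 h).proj x) ((D.cut e t h0 h1 h).proj y) := Iff.rfl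

theorem cut_proj_last (s : I) :
    (D.cut e t h0 h1 h).proj (Fin.last n, s) = (e, aff t 1 s) := by
  simp [Refinement.proj, cut]

theorem cut_proj_self (s : I) :
    (D.cut e t h0 h1 h).proj (e.castSucc, s) = (e, aff 0 t s) := by
  simp [Refinement.proj, cut]

theorem cut_proj_of_ne {i : Fin n} (hi : i ≠ e) (s : I) :
    (D.cut e t h0 h1 h).proj (i.castSucc, s) = (i, s) := by
  simp [Refinement.proj, cut, hi]

end cut

end PieceDiagram

/-! ### The union of a diagram and a simple closed curve -/

/-- A simple closed curve in the interior of the surface, locally flat except at finitely many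
points. -/
structure IsLoop (κ : C(I, F)) : Prop where
  closed : κ 0 = κ 1
  inj : ∀ s t, κ s = κ t → s = t ∨ (s = 1 ∧ t = 0) ∨ (t = 1 ∧ s = 0)
  interior : ∀ t, IsInteriorPoint (κ t)
  flat : {t | ¬ FlatAt κ t}.Finite

namespace PieceDiagram

/-- A point of a diagram as a point of the diagram with one more piece. -/
def emb (x : Fin n × I) : Fin (n + 1) × I := (x.1.castSucc, x.2)

theorem emb_injective : Function.Injective (emb (n := n)) := by
  rintro ⟨i, s⟩ ⟨j, t⟩ h
  obtain ⟨h1, h2⟩ := Prod.mk.inj h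
  exact Prod.ext (Fin.castSucc_injective _ h1) h2

theorem emb_or_last (x : Fin (n + 1) × I) : (∃ x', x = emb x') ∨ x.1 = Fin.last n := by
  obtain ⟨i, s⟩ := x
  induction i using Fin.lastCases with
  | last => exact Or.inr rfl
  | cast i => exact Or.inl ⟨(i, s), rfl⟩

theorem emb_fst_ne (x : Fin n × I) : (emb x).1 ≠ Fin.last n := (Fin.castSucc_lt_last _).ne

/-- The disjoint union of a diagram and a simple closed curve, which becomes the last piece. -/
def addCircle (D : PieceDiagram S n) (κ : C(I, F)) (hκ : IsLoop κ)
    (hd : ∀ e t s, D.path e t ≠ κ s) : PieceDiagram S (n + 1) where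
  pieces_pos := n.succ_pos
  path := Fin.lastCases κ D.path
  next := liftNext D.next
  above x y := ∃ x' y', D.above x' y' ∧ x = emb x' ∧ y = emb y'
  join := by
    have key : ∀ x : Fin S.numOut ⊕ Fin n, Sum.elim S.outputs
        (fun e : Fin (n + 1) => (Fin.lastCases κ D.path e : C(I, F)) 0)
        (Sum.map id Fin.castSucc x) = Sum.elim S.outputs (fun e => D.path e 0) x := by
      rintro (b | f) <;> simp
    rintro (a | e)
    · rw [liftNext_inl, key, ← D.join]; rfl
    · induction e using Fin.lastCases with
      | last => simpa using hκ.closed.symm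
      | cast e => rw [liftNext_castSucc, key, ← D.join]; simp
  boundary e t h := by
    induction e using Fin.lastCases with
    | last => exact absurd (hκ.interior t) (by simpa using h)
    | cast e =>
      rw [Fin.lastCases_castSucc] at h
      rcases D.boundary e t h with ⟨h1, a, ha⟩ | ⟨h1, b, hb⟩
      · exact Or.inl ⟨h1, a, by simp [ha]⟩
      · exact Or.inr ⟨h1, b, by simp [hb]⟩
  above_point := by
    rintro _ _ ⟨x, y, h, rfl, rfl⟩
    simpa [emb] using D.above_point _ _ h
  above_ne := by
    rintro _ _ ⟨x, y, h, rfl, rfl⟩ he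
    exact D.above_ne _ _ h (emb_injective he)
  above_asymm := by
    rintro _ _ ⟨x, y, h, rfl, rfl⟩ ⟨x', y', h', h1, h2⟩
    obtain rfl := emb_injective h1
    obtain rfl := emb_injective h2
    exact D.above_asymm _ _ h h'
  above_inside := by
    rintro _ _ ⟨x, y, h, rfl, rfl⟩
    exact D.above_inside _ _ h
  above_finite := by
    refine (D.above_finite.image (Prod.map emb emb)).subset ?_
    rintro ⟨_, _⟩ ⟨x, y, h, h1, h2⟩
    exact ⟨(x, y), h, Prod.ext h1.symm h2.symm⟩
  no_triple := by
    have : ∀ x y : Fin (n + 1) × I, ((∃ x' y', D.above x' y' ∧ x = emb x' ∧ y = emb y') ∨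
        ∃ x' y', D.above x' y' ∧ y = emb x' ∧ x = emb y') →
        ∃ x' y', x = emb x' ∧ y = emb y' ∧ (D.above x' y' ∨ D.above y' x') := by
      rintro x y (⟨x', y', h, rfl, rfl⟩ | ⟨x', y', h, rfl, rfl⟩)
      · exact ⟨_, _, rfl, rfl, Or.inl h⟩
      · exact ⟨_, _, rfl, rfl, Or.inr h⟩
    intro x y z h h'
    obtain ⟨x₁, y₁, rfl, rfl, h1⟩ := this _ _ h
    obtain ⟨x₂, z₁, h2, rfl, h1'⟩ := this _ _ h'
    obtain rfl := emb_injective h2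
    rw [D.no_triple _ _ _ h1 h1']
  meet := by
    rintro ⟨i, s⟩ ⟨j, t⟩ h
    induction i using Fin.lastCases with
    | last =>
      induction j using Fin.lastCases with
      | last =>
        simp only [Fin.lastCases_last] at h
        rcases hκ.inj s t h with rfl | h | h
        · exact Or.inl rfl
        · exact Or.inr (Or.inr (Or.inr (Or.inl ⟨h.1, h.2, liftNext_last _⟩)))
        · exact Or.inr (Or.inr (Or.inr (Or.inr ⟨h.1, h.2, liftNext_last _⟩)))
      | cast j =>
        simp only [Fin.lastCases_last, Fin.lastCases_castSucc] at h
        exact absurd h.symm (hd j t s)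
    | cast i =>
      induction j using Fin.lastCases with
      | last =>
        simp only [Fin.lastCases_last, Fin.lastCases_castSucc] at h
        exact absurd h (hd i s t)
      | cast j =>
        simp only [Fin.lastCases_castSucc] at h
        rcases D.meet (i, s) (j, t) h with h | h | h | ⟨h1, h2, h3⟩ | ⟨h1, h2, h3⟩
        · cases h; exact Or.inl rfl
        · exact Or.inr (Or.inl ⟨_, _, h, rfl, rfl⟩)
        · exact Or.inr (Or.inr (Or.inl ⟨_, _, h, rfl, rfl⟩))
        · refine Or.inr (Or.inr (Or.inr (Or.inl ⟨h1, h2, ?_⟩)))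
          simp only at h3
          simp [h3]
        · refine Or.inr (Or.inr (Or.inr (Or.inr ⟨h1, h2, ?_⟩)))
          simp only at h3
          simp [h3]
  flat e := by
    induction e using Fin.lastCases with
    | last =>
      have := hκ.flat
      unfold FlatAt at this
      simpa using this
    | cast e => simpa using D.flat e
  transverse := by
    rintro _ _ ⟨x, y, h, rfl, rfl⟩
    simpa [emb] using D.transverse _ _ h

section addCircle

variable {D : PieceDiagram S n} {κ : C(I, F)} {hκ : IsLoop κ} {hd : ∀ e t s, D.path e t ≠ κ s}

@[simp]
theorem addCircle_path_castSucc (e : Fin n) : (D.addCircle κ hκ hd).path e.castSucc = D.path e := by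
  simp [addCircle]

@[simp]
theorem addCircle_path_last : (D.addCircle κ hκ hd).path (Fin.last n) = κ := by
  simp [addCircle]

theorem addCircle_next : (D.addCircle κ hκ hd).next = liftNext D.next := rfl

@[simp]
theorem addCircle_above_emb (x y : Fin n × I) :
    (D.addCircle κ hκ hd).above (emb x) (emb y) ↔ D.above x y := by
  constructor
  · rintro ⟨x', y', h, h1, h2⟩
    rwa [emb_injective h1, emb_injective h2]
  · intro h; exact ⟨_, _, h, rfl, rfl⟩

theorem addCircle_above {x y : Fin (n + 1) × I} :
    (D.addCircle κ hκ hd).above x y ↔ ∃ x' y', D.above x' y' ∧ x = emb x' ∧ y = emb y' := Iff.rfl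

theorem addCircle_not_above_last {x y : Fin (n + 1) × I} (h : x.1 = Fin.last n ∨ y.1 = Fin.last n) :
    ¬ (D.addCircle κ hκ hd).above x y := by
  rintro ⟨x', y', -, rfl, rfl⟩
  exact h.elim (emb_fst_ne _) (emb_fst_ne _)

end addCircle

/-- The circle has no crossings and is joined only to itself, so it is a simple closed curve
disjoint from the rest. Only the numbering of the pieces distinguishes `D` from `D'` with this curve
added. -/
theorem IsCircleRemoval.exists_addCircle {D : PieceDiagram S (n + 1)} {D' : PieceDiagram S n}
    (h : D.IsCircleRemoval D') : ∃ (φ : ℂ → F) (κ : C(I, F)) (hκ : IsLoop κ)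
      (hd : ∀ e t s, D'.path e t ≠ κ s), IsOpenEmbedding φ ∧
      Set.range κ = φ '' Metric.sphere 0 1 ∧
      toSkein ⟨n + 1, D⟩ = toSkein ⟨n + 1, D'.addCircle κ hκ hd⟩ := by
  obtain ⟨c, hc, hun, ⟨φ, hφ, hrange⟩, hpath, habove, hnext⟩ := h
  have hun' : ∀ s x, ¬ D.above (c, s) x ∧ ¬ D.above x (c, s) := fun s x =>
    ⟨fun h => (hun _ _ h).1 rfl, fun h => (hun _ _ h).2 rfl⟩
  have hκ : IsLoop (D.path c) := by
    refine ⟨?_, fun s t hst => ?_, fun t => ?_, D.flat c⟩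
    · exact (join_inr hc).symm
    · rcases D.meet (c, s) (c, t) hst with h | h | h | h | h
      · exact Or.inl (Prod.mk.inj h).2
      · exact absurd h (hun' _ _).1
      · exact absurd h (hun' _ _).1
      · exact Or.inr (Or.inl ⟨h.1, h.2.1⟩)
      · exact Or.inr (Or.inr ⟨h.1, h.2.1⟩)
    · have : D.path c t ∈ Set.range φ :=
        Set.image_subset_range _ _ (hrange ▸ Set.mem_range_self t)
      exact ⟨φ, hφ, this⟩
  have hnc : ∀ e, D.next (Sum.inr (c.succAbove e)) ≠ Sum.inr c := fun e h =>
    Fin.succAbove_ne c e (by simpa using D.next.injective (h.trans hc.symm))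
  have hd : ∀ e t s, D'.path e t ≠ D.path c s := by
    intro e t s h
    rw [hpath] at h
    rcases D.meet (c.succAbove e, t) (c, s) h with h | h | h | h | h
    · exact Fin.succAbove_ne c e (Prod.mk.inj h).1
    · exact (hun' _ _).2 h
    · exact (hun' _ _).1 h
    · exact hnc e h.2.2
    · refine Fin.succAbove_ne c e ?_
      have h3 : D.next (Sum.inr c) = Sum.inr (c.succAbove e) := h.2.2
      rw [hc] at h3
      simpa using h3.symm
  refine ⟨φ, D.path c, hκ, hd, hφ, hrange, ?_⟩
  have hin : ∀ a, D.next (Sum.inl a) ≠ Sum.inr c := fun a h => by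
    simpa using D.next.injective (h.trans hc.symm)
  have hlift : ∀ x : Fin S.numOut ⊕ Fin n, ∀ f, x = Sum.inr f ↔
      Sum.map id c.succAbove x = Sum.inr (c.succAbove f) := by
    rintro (b | e) f <;> simp
  -- Moving the piece `c` to the last place is a subdivision that cuts nothing.
  refine (PieceDiagram.Subdivides.toSkein_eq ⟨Fin.lastCases c c.succAbove, fun _ => id,
    fun _ => ⟨continuous_id, strictMono_id⟩, ?_, ?_, ?_, ?_, ?_, ?_⟩).symm
  · rintro ⟨e, t⟩
    rcases eq_or_ne e c with rfl | he
    · exact ⟨Fin.last n, t, by simp⟩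
    · obtain ⟨e, rfl⟩ := Fin.exists_succAbove_eq he
      exact ⟨e.castSucc, t, by simp⟩
  · intro e t
    induction e using Fin.lastCases with
    | last => simp
    | cast e => simp [hpath]
  · rintro ⟨i, s⟩ ⟨j, t⟩
    induction i using Fin.lastCases with
    | last =>
      refine iff_of_false (addCircle_not_above_last (Or.inl rfl)) ?_
      simpa using (hun' s _).1
    | cast i =>
      induction j using Fin.lastCases with
      | last =>
        refine iff_of_false (addCircle_not_above_last (Or.inr rfl)) ?_
        simpa using (hun' t _).2
      | cast j =>
        refine (addCircle_above_emb (i, s) (j, t)).trans ?_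
        simpa using habove (i, s) (j, t)
  · intro e f
    induction e using Fin.lastCases with
    | last =>
      induction f using Fin.lastCases with
      | last => simp [addCircle_next, hc]
      | cast f =>
        simp [addCircle_next, hc, (Fin.castSucc_lt_last f).ne']
    | cast e =>
      have := hnext (Sum.inr e)
      simp only [Sum.map_inr] at this
      induction f using Fin.lastCases with
      | last => simp [addCircle_next, map_ne_inr_last, hnc]
      | cast f =>
        simp only [addCircle_next, liftNext_castSucc, map_eq_inr_castSucc, hlift, this]
        simp
  · intro a e
    have := hnext (Sum.inl a)
    simp only [Sum.map_inl, id] at this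
    induction e using Fin.lastCases with
    | last => simp [addCircle_next, map_ne_inr_last, hin]
    | cast e =>
      rw [addCircle_next, liftNext_inl, map_eq_inr_castSucc, hlift, this]
      simp
  · intro e b
    induction e using Fin.lastCases with
    | last => simp [addCircle_next, hc]
    | cast e =>
      have := hnext (Sum.inr e)
      simp only [Sum.map_inr] at this
      rw [addCircle_next, liftNext_castSucc, map_eq_inl]
      simp only [Fin.lastCases_castSucc, ← this]
      rcases D'.next (Sum.inr e) with b' | f <;> simp

/-- A subdivision of a diagram gives one of its union with a simple closed curve. -/
theorem Refinement.addCircle_subdivides {D : PieceDiagram S m} (R : D.Refinement n) {κ : C(I, F)}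
    (hκ : IsLoop κ) (hd : ∀ e t s, D.path e t ≠ κ s)
    (hd' : ∀ e t s, R.toDiagram.path e t ≠ κ s) :
    (R.toDiagram.addCircle κ hκ hd').Subdivides (D.addCircle κ hκ hd) := by
  have hS := R.subdivides
  refine ⟨Fin.lastCases (Fin.last m) fun i => (R.π i).castSucc, Fin.lastCases id R.τ,
    ?_, ?_, ?_, ?_, ?_, ?_, ?_⟩
  · intro e
    induction e using Fin.lastCases with
    | last => simp [continuous_id, strictMono_id]
    | cast e => simpa using ⟨R.cont e, R.mono e⟩
  · rintro ⟨e, t⟩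
    induction e using Fin.lastCases with
    | last => exact ⟨Fin.last n, t, by simp⟩
    | cast e =>
      obtain ⟨f, s, h⟩ := R.surj (e, t)
      obtain ⟨h1, h2⟩ := Prod.mk.inj h
      exact ⟨f.castSucc, s, by simp [h1, h2]⟩
  · intro e t
    induction e using Fin.lastCases with
    | last => simp
    | cast e => simp [Refinement.toDiagram]
  · rintro ⟨i, s⟩ ⟨j, t⟩
    induction i using Fin.lastCases with
    | last =>
      refine iff_of_false (addCircle_not_above_last (Or.inl rfl)) ?_
      simpa using addCircle_not_above_last (Or.inl rfl)
    | cast i =>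
      induction j using Fin.lastCases with
      | last =>
        refine iff_of_false (addCircle_not_above_last (Or.inr rfl)) ?_
        simpa using addCircle_not_above_last (Or.inr rfl)
      | cast j =>
        refine (addCircle_above_emb (i, s) (j, t)).trans ?_
        simp only [Fin.lastCases_castSucc]
        exact (addCircle_above_emb (R.proj (i, s)) (R.proj (j, t))).symm
  · intro e f
    induction e using Fin.lastCases with
    | last =>
      induction f using Fin.lastCases with
      | last => simp [addCircle_next]
      | cast f => simp [addCircle_next, (Fin.castSucc_lt_last _).ne']
    | cast e =>
      induction f using Fin.lastCases with
      | last => simp [addCircle_next, map_ne_inr_last]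
      | cast f =>
        simp only [addCircle_next, liftNext_castSucc, map_eq_inr_castSucc, Fin.lastCases_castSucc,
          Fin.castSucc_inj]
        exact R.next_inr_inr e f
  · intro a e
    induction e using Fin.lastCases with
    | last => simp [addCircle_next, map_ne_inr_last]
    | cast e =>
      simp only [addCircle_next, liftNext_inl, map_eq_inr_castSucc, Fin.lastCases_castSucc]
      exact R.next_inl_inr a e
  · intro e b
    induction e using Fin.lastCases with
    | last => simp [addCircle_next]
    | cast e =>
      simp only [addCircle_next, liftNext_castSucc, map_eq_inl, Fin.lastCases_castSucc]
      exact R.next_inr_inl e b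

end PieceDiagram

/-! ### Concatenation of curves -/

/-- The midpoint of the interval. -/
noncomputable def half : I := ⟨1 / 2, by norm_num, by norm_num⟩

theorem half_pos : 0 < half := by
  rw [← Subtype.coe_lt_coe]; norm_num [half]

theorem half_lt_one : half < 1 := by
  rw [← Subtype.coe_lt_coe]; norm_num [half]

theorem exists_half (t : I) : ∃ s, t = aff 0 half s ∨ t = aff half 1 s := by
  rcases le_total t half with h | h
  · obtain ⟨s, hs⟩ := exists_aff unitInterval.nonneg' h
    exact ⟨s, Or.inl hs.symm⟩
  · obtain ⟨s, hs⟩ := exists_aff h unitInterval.le_one'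
    exact ⟨s, Or.inr hs.symm⟩

/-- The concatenation of two curves. -/
noncomputable def cat (p q : C(I, F)) (h : p 1 = q 0) : C(I, F) :=
  ((⟨p, rfl, rfl⟩ : Path (p 0) (p 1)).trans
    ((⟨q, rfl, rfl⟩ : Path (q 0) (q 1)).cast h rfl)).toContinuousMap

section cat

variable {p q : C(I, F)} {h : p 1 = q 0}

@[simp]
theorem cat_left (s : I) : cat p q h (aff 0 half s) = p s := by
  have hs : ((aff 0 half s : I) : ℝ) = s / 2 := by rw [coe_aff]; simp [half]; ring
  have hle : ((aff 0 half s : I) : ℝ) ≤ 1 / 2 := by rw [hs]; linarith [s.2.2]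
  refine (Path.trans_apply _ _ _).trans ?_
  rw [dif_pos hle]
  refine congrArg p (Subtype.ext ?_)
  simp only [hs]; ring

@[simp]
theorem cat_right (s : I) : cat p q h (aff half 1 s) = q s := by
  have hs : ((aff half 1 s : I) : ℝ) = (1 + s) / 2 := by rw [coe_aff]; simp [half]; ring
  rcases eq_or_ne s 0 with rfl | hs0
  · have : aff half 1 0 = aff 0 half 1 := by simp
    rw [this, cat_left, h]
  have hlt : ¬ ((aff half 1 s : I) : ℝ) ≤ 1 / 2 := by
    have : (0 : ℝ) < s := unitInterval.pos_iff_ne_zero.2 hs0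
    rw [hs]; linarith
  refine (Path.trans_apply _ _ _).trans ?_
  rw [dif_neg hlt]
  refine congrArg q (Subtype.ext ?_)
  simp only [hs]; ring

@[simp]
theorem cat_zero : cat p q h 0 = p 0 := by
  rw [← cat_left (h := h) 0, aff_zero]

@[simp]
theorem cat_one : cat p q h 1 = q 1 := by
  rw [← cat_right (h := h) 1, aff_one]

theorem cat_injective (hp : Function.Injective p) (hq : Function.Injective q)
    (hpq : ∀ s t, p s = q t → s = 1 ∧ t = 0) : Function.Injective (cat p q h) := by
  have key : ∀ s t, p s = q t → aff 0 half s = aff half 1 t := by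
    intro s t hst
    obtain ⟨rfl, rfl⟩ := hpq s t hst
    simp
  intro s t hst
  obtain ⟨s, rfl | rfl⟩ := exists_half s <;> obtain ⟨t, rfl | rfl⟩ := exists_half t <;>
    simp only [cat_left, cat_right] at hst
  · rw [hp hst]
  · exact key _ _ hst
  · exact (key _ _ hst.symm).symm
  · rw [hq hst]

end cat

/-- By the intermediate value theorem, `τ` maps one-sided neighbourhoods of `t` onto those of `τ t`.
Here `t` must be interior: at an end, one of the two conditions before reparametrisation would be
empty. -/
theorem RunsAlong.of_comp {F : Type u} {φ : ℂ → F} {d : ℂ} {γ : I → F} {τ : C(I, I)} {t : I}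
    (hm : StrictMono τ) (ht : t ∈ Set.Ioo 0 1) (h : RunsAlong φ d (γ ∘ τ) t) :
    RunsAlong φ d γ (τ t) := by
  obtain ⟨h1, h2, h3⟩ := h
  refine ⟨h1, ?_, ?_⟩
  · obtain ⟨u, hu, hP⟩ := (mem_nhdsGT_iff_exists_Ioo_subset' ht.2).1 h2
    refine (mem_nhdsGT_iff_exists_Ioo_subset' (hm ht.2)).2 ⟨τ u, hm hu, ?_⟩
    rintro s ⟨hs1, hs2⟩
    obtain ⟨r, hr⟩ := mem_range_of_exists_le_of_exists_ge τ.continuous ⟨t, hs1.le⟩ ⟨u, hs2.le⟩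
    rw [← hr] at hs1 hs2 ⊢
    exact hP ⟨hm.lt_iff_lt.1 hs1, hm.lt_iff_lt.1 hs2⟩
  · obtain ⟨u, hu, hP⟩ := (mem_nhdsLT_iff_exists_Ioo_subset' ht.1).1 h3
    refine (mem_nhdsLT_iff_exists_Ioo_subset' (hm ht.1)).2 ⟨τ u, hm hu, ?_⟩
    rintro s ⟨hs1, hs2⟩
    obtain ⟨r, hr⟩ := mem_range_of_exists_le_of_exists_ge τ.continuous ⟨u, hs1.le⟩ ⟨t, hs2.le⟩
    rw [← hr] at hs1 hs2 ⊢
    exact hP ⟨hm.lt_iff_lt.1 hs1, hm.lt_iff_lt.1 hs2⟩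

/-- A curve that is straight in suitable charts except at finitely many points. -/
def IsFlat (γ : I → F) : Prop := {t | ¬ FlatAt γ t}.Finite

theorem IsFlat.cat {p q : C(I, F)} {h : p 1 = q 0} (hp : IsFlat p) (hq : IsFlat q) :
    IsFlat (cat p q h) := by
  have key : ∀ (r : C(I, F)) (a b : I) (hab : a < b), IsFlat r →
      (∀ s, HomflySkein.cat p q h (aff a b s) = r s) →
      ((aff a b) '' {t | t ∈ Set.Ioo 0 1 ∧ ¬ FlatAt (HomflySkein.cat p q h) (aff a b t)}).Finite := by
    intro r a b hab hr hc
    refine (hr.subset ?_).image _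
    rintro t ⟨ht, hn⟩ ⟨φ, hφ, hrun⟩
    refine hn ⟨φ, hφ, RunsAlong.of_comp (aff_strictMono hab) ht ?_⟩
    rwa [show (⇑(HomflySkein.cat p q h) ∘ ⇑(aff a b)) = r from funext hc]
  -- Besides the exceptional points of the two parts, flatness may fail at the ends and at the
  -- joint.
  refine (((key p 0 half half_pos hp cat_left).union (key q half 1 half_lt_one hq cat_right)).union
    (Set.toFinite {0, half, 1})).subset ?_
  intro t ht
  obtain ⟨s, hs⟩ := exists_half t
  by_cases hs0 : s = 0
  · right; rcases hs with rfl | rfl <;> simp [hs0]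
  by_cases hs1 : s = 1
  · right; rcases hs with rfl | rfl <;> simp [hs1]
  have hsm : s ∈ Set.Ioo (0 : I) 1 :=
    ⟨unitInterval.pos_iff_ne_zero.2 hs0, unitInterval.lt_one_iff_ne_one.2 hs1⟩
  rcases hs with rfl | rfl
  · exact Or.inl (Or.inl ⟨s, ⟨hsm, ht⟩, rfl⟩)
  · exact Or.inl (Or.inr ⟨s, ⟨hsm, ht⟩, rfl⟩)

/-- A part of a flat curve is flat. -/
theorem IsFlat.comp {γ : I → F} {τ : I → I} (h : IsFlat γ) (hc : Continuous τ)
    (hm : StrictMono τ) : IsFlat (γ ∘ τ) := by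
  refine (Set.Finite.preimage (f := τ) hm.injective.injOn h).subset ?_
  rintro t ht ⟨φ, hφ, hr⟩
  exact ht ⟨φ, hφ, hr.comp_strictMono hc hm⟩

/-! ### Segments and charts -/

/-- The segment from `a` to `b`. -/
def seg (a b : ℂ) : C(I, ℂ) := ⟨fun t => a + t * (b - a), by fun_prop⟩

theorem seg_apply (a b : ℂ) (t : I) : seg a b t = a + t * (b - a) := rfl

@[simp]
theorem seg_zero (a b : ℂ) : seg a b 0 = a := by simp [seg_apply]

@[simp]
theorem seg_one (a b : ℂ) : seg a b 1 = b := by simp [seg_apply]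

theorem seg_injective {a b : ℂ} (h : a ≠ b) : Function.Injective (seg a b) := by
  intro s t hst
  have : (b - a) ≠ 0 := sub_ne_zero.2 h.symm
  exact Subtype.ext (by simpa [seg_apply, this] using hst)

/-- The affine chart of the plane with origin `p` and axes `a`, `b`. -/
def chart (p a b w : ℂ) : ℂ := p + w.re * a + w.im * b

theorem isOpenEmbedding_chart (p : ℂ) {a b : ℂ} (h : a.re * b.im - a.im * b.re ≠ 0) :
    IsOpenEmbedding (chart p a b) := by
  let L : ℂ →ₗ[ℝ] ℂ := Complex.reLm.smulRight a + Complex.imLm.smulRight b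
  have hL : Function.Injective L := by
    rw [← LinearMap.ker_eq_bot, LinearMap.ker_eq_bot']
    intro w hw
    have h1 := congrArg Complex.re hw
    have h2 := congrArg Complex.im hw
    simp only [L, LinearMap.add_apply, LinearMap.smulRight_apply, Complex.reLm_coe,
      Complex.imLm_coe, Complex.add_re, Complex.add_im, Complex.real_smul, Complex.mul_re,
      Complex.mul_im, Complex.ofReal_re, Complex.ofReal_im, Complex.zero_re, Complex.zero_im] at h1 h2
    refine Complex.ext (mul_right_cancel₀ h ?_) (mul_right_cancel₀ h ?_)
    · simp only [Complex.zero_re, zero_mul]; linear_combination b.im * h1 - b.re * h2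
    · simp only [Complex.zero_im, zero_mul]; linear_combination a.re * h2 - a.im * h1
  have := ((LinearEquiv.ofInjectiveEndo L hL).toContinuousLinearEquiv.toHomeomorph.trans
    (Homeomorph.addLeft p)).isOpenEmbedding
  convert this using 1
  ext1 w
  simp [chart, L, add_assoc]

theorem runsAlong_seg {F : Type u} {ω ψ : ℂ → F} {d a b : ℂ} {s : I} (h0 : ψ 0 = ω (seg a b s))
    (hd : ∀ r : ℝ, ψ (r * d) = ω (seg a b s + r * (b - a))) :
    RunsAlong ψ d (ω ∘ seg a b) s := by
  have key : ∀ s' : I, (ω ∘ seg a b) s' = ψ (((s' - s : ℝ) : ℂ) * d) := by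
    intro s'
    rw [hd, Function.comp]
    congr 1
    simp only [seg_apply, Complex.ofReal_sub]; ring
  refine ⟨h0, eventually_nhdsWithin_of_forall fun s' hs => ?_,
    eventually_nhdsWithin_of_forall fun s' hs => ?_⟩
  · exact ⟨_, ⟨s' - s, sub_pos.2 hs, rfl⟩, (key s').symm⟩
  · exact ⟨_, ⟨s' - s, sub_neg.2 hs, rfl⟩, (key s').symm⟩

theorem isFlat_seg {ω : ℂ → F} (hω : IsOpenEmbedding ω) {a b : ℂ} (hab : a ≠ b) :
    IsFlat (ω ∘ seg a b) := by
  suffices ∀ t, FlatAt (ω ∘ seg a b) t by simp [IsFlat, this]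
  intro t
  -- The chart has the axes `b - a` and its quarter turn; the determinant is the squared length of
  -- `b - a`.
  have : (b - a).re * (Complex.I * (b - a)).im - (b - a).im * (Complex.I * (b - a)).re ≠ 0 := by
    have h := Complex.normSq_pos.2 (sub_ne_zero.2 hab.symm)
    rw [Complex.normSq_apply] at h
    simp only [Complex.mul_re, Complex.mul_im, Complex.I_re, Complex.I_im]
    linarith
  refine ⟨_, hω.comp (isOpenEmbedding_chart (seg a b t) this), runsAlong_seg ?_ fun r => ?_⟩
  · simp [chart]
  · simp [chart]

/-! ### Replacing an arc inside a disc, and curls -/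

/-- An arc from `a` to `b` in the disc `φ`, which passes over itself as the relation `X` says. -/
structure IsArc (φ : ℂ → F) (a b : F) (X : I → I → Prop) (α : C(I, F)) : Prop where
  zero : α 0 = a
  one : α 1 = b
  mem_ball : ∀ t ∈ Set.Ioo 0 1, α t ∈ φ '' Metric.ball 0 1
  point : ∀ s t, X s t → α s = α t
  ne : ∀ s t, X s t → s ≠ t
  asymm : ∀ s t, X s t → ¬ X t s
  inside : ∀ s t, X s t → s ∈ Set.Ioo 0 1 ∧ t ∈ Set.Ioo 0 1
  finite : {p : I × I | X p.1 p.2}.Finite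
  no_triple : ∀ s t u, (X s t ∨ X t s) → (X s u ∨ X u s) → t = u
  meet : ∀ s t, α s = α t → s = t ∨ X s t ∨ X t s
  flat : IsFlat α
  transverse : ∀ s t, X s t → ∃ ψ : ℂ → F, IsOpenEmbedding ψ ∧
    RunsAlong ψ 1 α s ∧ RunsAlong ψ Complex.I α t

theorem IsArc.of_injective {φ : ℂ → F} {a b : F} {α : C(I, F)} (h0 : α 0 = a) (h1 : α 1 = b)
    (hm : ∀ t ∈ Set.Ioo 0 1, α t ∈ φ '' Metric.ball 0 1) (hi : Function.Injective α)
    (hf : IsFlat α) : IsArc φ a b (fun _ _ => False) α where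
  zero := h0
  one := h1
  mem_ball := hm
  point _ _ := False.elim
  ne _ _ := False.elim
  asymm _ _ := False.elim
  inside _ _ := False.elim
  finite := by simp
  no_triple _ _ _ h := by simp at h
  meet s t h := Or.inl (hi h)
  flat := hf
  transverse _ _ := False.elim

namespace PieceDiagram

/-- The disc `φ` contains only the piece `d`, which goes from boundary to boundary and has no
crossings. -/
structure Channel (D : PieceDiagram S n) (φ : ℂ → F) (d : Fin n) : Prop where
  emb : IsOpenEmbedding φ
  proper : D.IsProperIn φ d
  alone : ∀ e, e ≠ d → ∀ t, D.path e t ∉ φ '' Metric.ball 0 1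
  uncrossed : ∀ t, D.Uncrossed (d, t)
  ends_ne : D.path d 0 ≠ D.path d 1

section replaceArc

variable {D : PieceDiagram S n} {φ : ℂ → F} {d : Fin n} {X : I → I → Prop} {α : C(I, F)}

theorem Channel.fst_ne (c : D.Channel φ d) {x y : Fin n × I} (h : D.above x y) :
    x.1 ≠ d ∧ y.1 ≠ d := by
  obtain ⟨i, s⟩ := x
  obtain ⟨j, t⟩ := y
  refine ⟨?_, ?_⟩
  · rintro rfl; exact (c.uncrossed s _).1 h
  · rintro rfl; exact (c.uncrossed t _).2 h

theorem Channel.injective (c : D.Channel φ d) : Function.Injective (D.path d) := by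
  intro s t hst
  rcases D.meet (d, s) (d, t) hst with h | h | h | h | h
  · exact (Prod.mk.inj h).2
  · exact absurd h (c.uncrossed _ _).1
  · exact absurd h (c.uncrossed _ _).1
  · obtain ⟨h1, h2, -⟩ := h
    simp only at h1 h2
    exact absurd (h1 ▸ h2 ▸ hst.symm) c.ends_ne
  · obtain ⟨h1, h2, -⟩ := h
    simp only at h1 h2
    exact absurd (h1 ▸ h2 ▸ hst) c.ends_ne

theorem Channel.isArc (c : D.Channel φ d) :
    IsArc φ (D.path d 0) (D.path d 1) (fun _ _ => False) (D.path d) :=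
  IsArc.of_injective rfl rfl c.proper.1 c.injective (D.flat d)

/-- Replace the piece `d`, alone in a disc, by another arc in the disc. -/
def replaceArc (D : PieceDiagram S n) {φ : ℂ → F} {d : Fin n} (c : D.Channel φ d)
    {X : I → I → Prop} (α : C(I, F)) (hα : IsArc φ (D.path d 0) (D.path d 1) X α) :
    PieceDiagram S n where
  pieces_pos := D.pieces_pos
  path := Function.update D.path d α
  next := D.next
  above x y := D.above x y ∨ (x.1 = d ∧ y.1 = d ∧ X x.2 y.2)
  join := by
    have h0 : (fun e => Function.update D.path d α e 0) = fun e => D.path e 0 := by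
      ext1 e
      rcases eq_or_ne e d with rfl | h
      · simp [hα.zero]
      · simp [h]
    have h1 : (fun e => Function.update D.path d α e 1) = fun e => D.path e 1 := by
      ext1 e
      rcases eq_or_ne e d with rfl | h
      · simp [hα.one]
      · simp [h]
    rw [h0, h1]
    exact D.join
  boundary e t h := by
    rcases eq_or_ne e d with rfl | he
    · have hcase : t = 0 ∨ t = 1 ∨ t ∈ Set.Ioo (0 : I) 1 := by
        by_cases h0 : t = 0
        · exact Or.inl h0
        by_cases h1 : t = 1
        · exact Or.inr (Or.inl h1)
        exact Or.inr (Or.inr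
          ⟨unitInterval.pos_iff_ne_zero.2 h0, unitInterval.lt_one_iff_ne_one.2 h1⟩)
      have hmem : α t ∈ Set.range φ := by
        rcases hcase with rfl | rfl | ht
        · rw [hα.zero]; exact Set.image_subset_range _ _ c.proper.2.1
        · rw [hα.one]; exact Set.image_subset_range _ _ c.proper.2.2
        · exact Set.image_subset_range _ _ (hα.mem_ball t ht)
      rw [Function.update_self] at h
      exact absurd ⟨φ, c.emb, hmem⟩ h
    · rw [Function.update_of_ne he] at h
      exact D.boundary e t h
  above_point := by
    rintro ⟨i, s⟩ ⟨j, t⟩ (h | ⟨rfl, rfl, h⟩)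
    · have := c.fst_ne h
      simp only [Function.update_of_ne this.1, Function.update_of_ne this.2]
      exact D.above_point _ _ h
    · simpa using hα.point _ _ h
  above_ne := by
    rintro ⟨i, s⟩ ⟨j, t⟩ (h | ⟨rfl, rfl, h⟩) he
    · exact D.above_ne _ _ h he
    · exact hα.ne _ _ h (Prod.mk.inj he).2
  above_asymm := by
    rintro x y (h | ⟨h1, h2, h⟩) (h' | ⟨h1', h2', h'⟩)
    · exact D.above_asymm _ _ h h'
    · exact (c.fst_ne h).1 h2'
    · exact (c.fst_ne h').1 h2
    · exact hα.asymm _ _ h h'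
  above_inside := by
    rintro x y (h | ⟨h1, h2, h⟩)
    · exact D.above_inside _ _ h
    · exact hα.inside _ _ h
  above_finite := by
    refine (D.above_finite.union (hα.finite.image (Prod.map (Prod.mk d) (Prod.mk d)))).subset ?_
    rintro ⟨⟨i, s⟩, ⟨j, t⟩⟩ (h | ⟨h1, h2, h⟩)
    · exact Or.inl h
    · exact Or.inr ⟨(s, t), h, Prod.ext (Prod.ext h1.symm rfl) (Prod.ext h2.symm rfl)⟩
  no_triple := by
    have key : ∀ x y, ((D.above x y ∨ (x.1 = d ∧ y.1 = d ∧ X x.2 y.2)) ∨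
        (D.above y x ∨ (y.1 = d ∧ x.1 = d ∧ X y.2 x.2))) →
        (x.1 ≠ d ∧ (D.above x y ∨ D.above y x)) ∨
        (x.1 = d ∧ y.1 = d ∧ (X x.2 y.2 ∨ X y.2 x.2)) := by
      rintro x y ((h | ⟨h1, h2, h⟩) | (h | ⟨h1, h2, h⟩))
      · exact Or.inl ⟨(c.fst_ne h).1, Or.inl h⟩
      · exact Or.inr ⟨h1, h2, Or.inl h⟩
      · exact Or.inl ⟨(c.fst_ne h).2, Or.inr h⟩
      · exact Or.inr ⟨h2, h1, Or.inr h⟩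
    intro x y z hy hz
    rcases key _ _ hy with ⟨h1, h2⟩ | ⟨h1, h2, h3⟩ <;>
      rcases key _ _ hz with ⟨h1', h2'⟩ | ⟨h1', h2', h3'⟩
    · exact D.no_triple _ _ _ h2 h2'
    · exact absurd h1' h1
    · exact absurd h1 h1'
    · exact Prod.ext (h2.trans h2'.symm) (hα.no_triple _ _ _ h3 h3')
  meet := by
    -- The new arc meets other pieces at most in its end points, which it shares with the old arc;
    -- elsewhere it stays in the open disc, where `d` is alone.
    have key : ∀ s (y : Fin n × I), y.1 ≠ d → α s = D.path y.1 y.2 →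
        D.path d s = D.path y.1 y.2 := by
      intro s y hy h
      by_cases h0 : s = 0
      · subst h0; rw [← hα.zero, h]
      by_cases h1 : s = 1
      · subst h1; rw [← hα.one, h]
      refine absurd ?_ (c.alone y.1 hy y.2)
      rw [← h]
      exact hα.mem_ball s ⟨unitInterval.pos_iff_ne_zero.2 h0, unitInterval.lt_one_iff_ne_one.2 h1⟩
    have old : ∀ x y : Fin n × I, D.path x.1 x.2 = D.path y.1 y.2 →
        x = y ∨ (D.above x y ∨ (x.1 = d ∧ y.1 = d ∧ X x.2 y.2)) ∨
        (D.above y x ∨ (y.1 = d ∧ x.1 = d ∧ X y.2 x.2)) ∨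
        (x.2 = 1 ∧ y.2 = 0 ∧ D.next (Sum.inr x.1) = Sum.inr y.1) ∨
        (y.2 = 1 ∧ x.2 = 0 ∧ D.next (Sum.inr y.1) = Sum.inr x.1) := by
      intro x y h
      rcases D.meet x y h with h | h | h | h | h
      · exact Or.inl h
      · exact Or.inr (Or.inl (Or.inl h))
      · exact Or.inr (Or.inr (Or.inl (Or.inl h)))
      · exact Or.inr (Or.inr (Or.inr (Or.inl h)))
      · exact Or.inr (Or.inr (Or.inr (Or.inr h)))
    intro x y h
    by_cases hx : x.1 = d <;> by_cases hy : y.1 = d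
    · obtain ⟨i, s⟩ := x
      obtain ⟨j, t⟩ := y
      simp only at hx hy
      subst hx hy
      simp only [Function.update_self] at h
      rcases hα.meet _ _ h with h | h | h
      · exact Or.inl (by rw [h])
      · exact Or.inr (Or.inl (Or.inr ⟨rfl, rfl, h⟩))
      · exact Or.inr (Or.inr (Or.inl (Or.inr ⟨rfl, rfl, h⟩)))
    · refine old x y ?_
      rw [Function.update_of_ne hy, hx, Function.update_self] at h
      rw [hx]
      exact key _ _ hy h
    · refine old x y ?_
      rw [Function.update_of_ne hx, hy, Function.update_self] at h
      rw [hy]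
      exact (key _ _ hx h.symm).symm
    · refine old x y ?_
      rwa [Function.update_of_ne hx, Function.update_of_ne hy] at h
  flat e := by
    rcases eq_or_ne e d with rfl | he
    · rw [Function.update_self]; exact hα.flat
    · rw [Function.update_of_ne he]; exact D.flat e
  transverse := by
    rintro ⟨i, s⟩ ⟨j, t⟩ (h | ⟨rfl, rfl, h⟩)
    · have := c.fst_ne h
      simp only [Function.update_of_ne this.1, Function.update_of_ne this.2]
      exact D.transverse _ _ h
    · simpa using hα.transverse _ _ h

variable {c : D.Channel φ d} {hα : IsArc φ (D.path d 0) (D.path d 1) X α}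

@[simp]
theorem replaceArc_path_self : (D.replaceArc c α hα).path d = α := by
  simp [replaceArc]

theorem replaceArc_path_of_ne {e : Fin n} (h : e ≠ d) :
    (D.replaceArc c α hα).path e = D.path e := by
  simp [replaceArc, h]

theorem replaceArc_above {x y : Fin n × I} : (D.replaceArc c α hα).above x y ↔
    D.above x y ∨ (x.1 = d ∧ y.1 = d ∧ X x.2 y.2) := Iff.rfl

protected theorem ext {D D' : PieceDiagram S n} (h1 : D.path = D'.path) (h2 : D.next = D'.next)
    (h3 : ∀ x y, D.above x y ↔ D'.above x y) : D = D' := by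
  have h3 : D.above = D'.above := by
    ext x y; exact h3 x y
  cases D; cases D'
  cases h1; cases h2; cases h3
  rfl

theorem replaceArc_isProperIn : (D.replaceArc c α hα).IsProperIn φ d := by
  have := c.proper.2
  rw [← hα.zero, ← hα.one] at this
  rw [IsProperIn, replaceArc_path_self]
  exact ⟨hα.mem_ball, this⟩

/-- An arc with a single crossing is a curl, which can be removed. -/
theorem isCurlRemoval_replaceArc {p q : I} {α β : C(I, F)}
    (hα : IsArc φ (D.path d 0) (D.path d 1) (fun s t => s = p ∧ t = q) α)
    (hβ : IsArc φ (D.path d 0) (D.path d 1) (fun _ _ => False) β) :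
    (D.replaceArc c α hα).IsCurlRemoval (D.replaceArc c β hβ) (d, p) (d, q) := by
  refine ⟨Or.inr ⟨rfl, rfl, rfl, rfl⟩, rfl, ?_, ⟨φ, c.emb, replaceArc_isProperIn,
    replaceArc_isProperIn, ?_⟩, ?_, ?_, ?_, ?_, ?_, rfl⟩
  · simp only [replaceArc_path_self, hα.zero, hα.one]
    exact c.ends_ne
  · intro e he t
    rw [replaceArc_path_of_ne he]
    exact c.alone e he t
  · rintro ⟨i, s⟩ ⟨j, t⟩ (h | ⟨h1, h2, h3, h4⟩) h'
    · exact absurd h' (not_or.2 (c.fst_ne h))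
    · exact ⟨Prod.ext h1 h3, Prod.ext h2 h4⟩
  · rintro ⟨i, s⟩ ⟨j, t⟩
    simp only [replaceArc_above, and_false, or_false, Prod.mk.injEq]
    constructor
    · intro h
      exact ⟨Or.inl h, fun h' => (c.fst_ne h).1 h'.1.1⟩
    · rintro ⟨h | h, h'⟩
      · exact h
      · exact absurd ⟨⟨h.1, h.2.2.1⟩, h.2.1, h.2.2.2⟩ h'
  · intro e he
    rw [replaceArc_path_of_ne he, replaceArc_path_of_ne he]
  · simp [hα.zero, hβ.zero]
  · simp [hα.one, hβ.one]

/-- Removing a curl that was put on `d` can in this way lead back to `D` itself. -/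
theorem replaceArc_self (c : D.Channel φ d) : D.replaceArc c (D.path d) c.isArc = D := by
  refine PieceDiagram.ext ?_ rfl fun x y => ?_
  · simp [replaceArc]
  · simp [replaceArc_above]

theorem isCurlRemoval_replaceArc_self {p q : I} {α : C(I, F)}
    (hα : IsArc φ (D.path d 0) (D.path d 1) (fun s t => s = p ∧ t = q) α) :
    (D.replaceArc c α hα).IsCurlRemoval D (d, p) (d, q) := by
  have := isCurlRemoval_replaceArc (c := c) hα c.isArc
  rwa [replaceArc_self c] at this

end replaceArc

section addCircle

variable {D : PieceDiagram S n} {φ : ℂ → F} {d : Fin n} {κ : C(I, F)}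
  {hκ : IsLoop κ} {hd : ∀ e t s, D.path e t ≠ κ s}

theorem Channel.addCircle (c : D.Channel φ d) (hφ : ∀ t, κ t ∉ φ '' Metric.ball 0 1) :
    (D.addCircle κ hκ hd).Channel φ d.castSucc where
  emb := c.emb
  proper := by simpa [IsProperIn] using c.proper
  alone e he t := by
    induction e using Fin.lastCases with
    | last => simpa using hφ t
    | cast e => simpa using c.alone e (by simpa using he) t
  uncrossed t y := by
    refine ⟨?_, ?_⟩
    · rintro ⟨x', y', h, h1, h2⟩
      rw [← emb_injective (a₁ := (d, t)) h1] at h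
      exact (c.uncrossed t _).1 h
    · rintro ⟨x', y', h, h1, h2⟩
      rw [← emb_injective (a₁ := (d, t)) h2] at h
      exact (c.uncrossed t _).2 h
  ends_ne := by simpa using c.ends_ne

/-- With this, the invariance under replacing an arc also applies in the presence of a circle. -/
theorem replaceArc_addCircle (c : D.Channel φ d) (hφ : ∀ t, κ t ∉ φ '' Metric.ball 0 1)
    {β : C(I, F)} (hβ : IsArc φ (D.path d 0) (D.path d 1) (fun _ _ => False) β)
    (hβ' : IsArc φ ((D.addCircle κ hκ hd).path d.castSucc 0)
      ((D.addCircle κ hκ hd).path d.castSucc 1) (fun _ _ => False) β)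
    (hd' : ∀ e t s, (D.replaceArc c β hβ).path e t ≠ κ s) :
    (D.addCircle κ hκ hd).replaceArc (c.addCircle hφ) β hβ' =
      (D.replaceArc c β hβ).addCircle κ hκ hd' := by
  refine PieceDiagram.ext ?_ rfl fun x y => ?_
  · ext1 e
    induction e using Fin.lastCases with
    | last => rw [replaceArc_path_of_ne (Fin.castSucc_lt_last d).ne', addCircle_path_last,
        addCircle_path_last]
    | cast e =>
      rw [addCircle_path_castSucc]
      rcases eq_or_ne e d with rfl | he
      · simp
      · rw [replaceArc_path_of_ne he, replaceArc_path_of_ne (by simpa using he),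
          addCircle_path_castSucc]
  · simp [replaceArc_above, addCircle_above]

end addCircle

end PieceDiagram

/-! ### The standard curl -/

/-- The map of the plane which takes the unit disc to an ellipse. -/
noncomputable def stretch : ℂ → ℂ := chart 0 1 (2 * Complex.I)

theorem isOpenEmbedding_stretch : IsOpenEmbedding stretch :=
  isOpenEmbedding_chart 0 (by simp)

/-- The open ellipse with half-axes `1` and `2`. -/
def ellipse : Set ℂ := {w | w.re ^ 2 + w.im ^ 2 / 4 < 1}

theorem stretch_image_ball : stretch '' Metric.ball 0 1 = ellipse := by
  have key : ∀ w : ℂ, stretch w ∈ ellipse ↔ w ∈ Metric.ball (0 : ℂ) 1 := by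
    intro w
    rw [mem_ball_zero_iff, ← sq_lt_one_iff₀ (norm_nonneg w), Complex.sq_norm,
      Complex.normSq_apply]
    simp only [ellipse, stretch, chart, Set.mem_ofPred_eq]
    simp
    ring_nf
  ext w
  constructor
  · rintro ⟨w, hw, rfl⟩
    exact (key w).2 hw
  · intro h
    have hw : stretch ⟨w.re, w.im / 2⟩ = w := by
      apply Complex.ext <;> simp [stretch, chart]
    exact ⟨_, (key _).1 (hw.symm ▸ h :), hw⟩

theorem image_stretch {F : Type u} (ω : ℂ → F) :
    (ω ∘ stretch) '' Metric.ball 0 1 = ω '' ellipse := by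
  rw [Set.image_comp, stretch_image_ball]

/-- The start of the loop of the standard curl. -/
noncomputable def loopStart : ℂ := ⟨3 / 5, 4 / 5⟩

/-- The end of the loop of the standard curl. -/
noncomputable def loopEnd : ℂ := ⟨-3 / 5, 4 / 5⟩

/-- An arc that closes up the standard curl. -/
structure IsCurlLoop (ω : ℂ → F) (c : C(I, ℂ)) : Prop where
  zero : c 0 = loopStart
  one : c 1 = loopEnd
  inj : Function.Injective c
  le_im : ∀ t, 4 / 5 ≤ (c t).im
  mem_ellipse : ∀ t, c t ∈ ellipse
  flat : IsFlat (ω ∘ c)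

/-- The first straight part of the curl. -/
noncomputable def strandIn : C(I, ℂ) := seg (-1) loopStart

/-- The second straight part of the curl. -/
noncomputable def strandOut : C(I, ℂ) := seg loopEnd 1

theorem strandIn_re (t : I) : (strandIn t).re = -1 + 8 / 5 * t := by
  simp [strandIn, seg_apply, loopStart]; ring

theorem strandIn_im (t : I) : (strandIn t).im = 4 / 5 * t := by
  simp [strandIn, seg_apply, loopStart]; ring

theorem strandOut_re (t : I) : (strandOut t).re = -3 / 5 + 8 / 5 * t := by
  simp [strandOut, seg_apply, loopEnd]; ring

theorem strandOut_im (t : I) : (strandOut t).im = 4 / 5 - 4 / 5 * t := by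
  simp [strandOut, seg_apply, loopEnd]; ring

/-- The crossing on the first straight part. -/
noncomputable def crossIn : I := ⟨5 / 8, by norm_num, by norm_num⟩

/-- The crossing on the second straight part. -/
noncomputable def crossOut : I := ⟨3 / 8, by norm_num, by norm_num⟩

theorem crossIn_mem : crossIn ∈ Set.Ioo (0 : I) 1 := by
  constructor <;> rw [← Subtype.coe_lt_coe] <;> norm_num [crossIn]

theorem crossOut_mem : crossOut ∈ Set.Ioo (0 : I) 1 := by
  constructor <;> rw [← Subtype.coe_lt_coe] <;> norm_num [crossOut]

/-- Up to direction the strands are mirror images in the imaginary axis, and they meet only there,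
at `I / 2`. -/
theorem strand_eq {s t : I} (h : strandIn s = strandOut t) : s = crossIn ∧ t = crossOut := by
  have h1 := congrArg Complex.re h
  have h2 := congrArg Complex.im h
  rw [strandIn_re, strandOut_re] at h1
  rw [strandIn_im, strandOut_im] at h2
  constructor
  · refine Subtype.ext ?_; simp only [crossIn]; linarith
  · refine Subtype.ext ?_; simp only [crossOut]; linarith

theorem strandIn_cross : strandIn crossIn = Complex.I / 2 := by
  apply Complex.ext
  · rw [strandIn_re]; norm_num [crossIn]
  · rw [strandIn_im]; norm_num [crossIn]

theorem strandOut_cross : strandOut crossOut = Complex.I / 2 := by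
  apply Complex.ext
  · rw [strandOut_re]; norm_num [crossOut]
  · rw [strandOut_im]; norm_num [crossOut]

theorem loopStart_ne : (-1 : ℂ) ≠ loopStart := fun h => by
  have := congrArg Complex.im h; norm_num [loopStart] at this

theorem loopEnd_ne : loopEnd ≠ 1 := fun h => by
  have := congrArg Complex.im h; norm_num [loopEnd] at this

theorem strandIn_mem_ellipse {t : I} (ht : 0 < t) : strandIn t ∈ ellipse := by
  have h0 : (0 : ℝ) < t := ht
  have h1 := t.2.2
  simp only [ellipse, Set.mem_ofPred_eq, strandIn_re, strandIn_im]
  nlinarith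

theorem strandOut_mem_ellipse {t : I} (ht : t < 1) : strandOut t ∈ ellipse := by
  have h0 : (t : ℝ) < 1 := ht
  have h1 := t.2.1
  simp only [ellipse, Set.mem_ofPred_eq, strandOut_re, strandOut_im]
  nlinarith

section curl

variable {ω : ℂ → F} {c : C(I, ℂ)}

/-- The standard curl in the plane, from `-1` to `1`. -/
noncomputable def curl (hc : IsCurlLoop ω c) : C(I, ℂ) :=
  cat strandIn (cat c strandOut (by simp [hc.one, strandOut])) (by simp [hc.zero, strandIn])

/-- The crossing of the curl, on its first passage. -/
noncomputable def curlFirst : I := aff 0 half crossIn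

/-- The crossing of the curl, on its second passage. -/
noncomputable def curlSecond : I := aff half 1 (aff half 1 crossOut)

variable (hc : IsCurlLoop ω c)

@[simp]
theorem curl_in (t : I) : curl hc (aff 0 half t) = strandIn t := by simp [curl]

@[simp]
theorem curl_loop (t : I) : curl hc (aff half 1 (aff 0 half t)) = c t := by simp [curl]

@[simp]
theorem curl_out (t : I) : curl hc (aff half 1 (aff half 1 t)) = strandOut t := by simp [curl]

theorem exists_curl (t : I) : ∃ s, t = aff 0 half s ∨ t = aff half 1 (aff 0 half s) ∨
    t = aff half 1 (aff half 1 s) := by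
  obtain ⟨s, rfl | rfl⟩ := exists_half t
  · exact ⟨s, Or.inl rfl⟩
  · obtain ⟨r, rfl | rfl⟩ := exists_half s
    · exact ⟨r, Or.inr (Or.inl rfl)⟩
    · exact ⟨r, Or.inr (Or.inr rfl)⟩

/-- The strand has imaginary part below 4/5 except at its end, and the loop stays at or above 4/5.
-/
theorem strandIn_eq_loop (hc : IsCurlLoop ω c) {s t : I} (h : strandIn s = c t) :
    aff 0 half s = aff half 1 (aff 0 half t) := by
  have h2 := congrArg Complex.im h
  rw [strandIn_im] at h2
  have hs : s = 1 := by
    refine le_antisymm unitInterval.le_one' ?_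
    rw [← Subtype.coe_le_coe, Set.Icc.coe_one]
    linarith [hc.le_im t]
  subst hs
  have : c t = c 0 := by rw [← h, hc.zero]; simp [strandIn]
  rw [hc.inj this]
  simp

theorem loop_eq_strandOut (hc : IsCurlLoop ω c) {s t : I} (h : c s = strandOut t) :
    aff half 1 (aff 0 half s) = aff half 1 (aff half 1 t) := by
  have h2 := congrArg Complex.im h
  rw [strandOut_im] at h2
  have ht : t = 0 := by
    refine le_antisymm ?_ unitInterval.nonneg'
    rw [← Subtype.coe_le_coe, Set.Icc.coe_zero]
    linarith [hc.le_im s]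
  subst ht
  have : c s = c 1 := by rw [h, hc.one]; simp [strandOut]
  rw [hc.inj this]
  simp

theorem curl_meet {s t : I} (h : curl hc s = curl hc t) : s = t ∨
    (s = curlFirst ∧ t = curlSecond) ∨ (s = curlSecond ∧ t = curlFirst) := by
  obtain ⟨s, rfl | rfl | rfl⟩ := exists_curl s <;> obtain ⟨t, rfl | rfl | rfl⟩ := exists_curl t <;>
    simp only [curl_in, curl_loop, curl_out] at h
  · rw [seg_injective loopStart_ne h]; exact Or.inl rfl
  · exact Or.inl (strandIn_eq_loop hc h)
  · obtain ⟨rfl, rfl⟩ := strand_eq h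
    exact Or.inr (Or.inl ⟨rfl, rfl⟩)
  · exact Or.inl (strandIn_eq_loop hc h.symm).symm
  · rw [hc.inj h]; exact Or.inl rfl
  · exact Or.inl (loop_eq_strandOut hc h)
  · obtain ⟨rfl, rfl⟩ := strand_eq h.symm
    exact Or.inr (Or.inr ⟨rfl, rfl⟩)
  · exact Or.inl (loop_eq_strandOut hc h.symm).symm
  · rw [seg_injective loopEnd_ne h]; exact Or.inl rfl

theorem curl_mem_ellipse {t : I} (ht : t ∈ Set.Ioo 0 1) : curl hc t ∈ ellipse := by
  obtain ⟨s, rfl | rfl | rfl⟩ := exists_curl t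
  · rw [curl_in]
    refine strandIn_mem_ellipse (unitInterval.pos_iff_ne_zero.2 ?_)
    rintro rfl
    simp at ht
  · rw [curl_loop]; exact hc.mem_ellipse s
  · rw [curl_out]
    refine strandOut_mem_ellipse (unitInterval.lt_one_iff_ne_one.2 ?_)
    rintro rfl
    simp at ht

theorem curlFirst_mem : curlFirst ∈ Set.Ioo (0 : I) 1 := by
  have h := aff_strictMono half_pos
  refine ⟨?_, lt_trans ?_ half_lt_one⟩
  · simpa [curlFirst] using h crossIn_mem.1
  · simpa [curlFirst] using h crossIn_mem.2

theorem curlSecond_mem : curlSecond ∈ Set.Ioo (0 : I) 1 := by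
  have h := aff_strictMono half_lt_one
  have h0 : half < aff half 1 crossOut := by simpa using h crossOut_mem.1
  have h1 : aff half 1 crossOut < 1 := by simpa using h crossOut_mem.2
  refine ⟨half_pos.trans (by simpa [curlSecond] using h (half_pos.trans h0)), ?_⟩
  simpa [curlSecond] using h h1

theorem curlFirst_ne : curlFirst ≠ curlSecond := by
  intro h
  have h1 : curlFirst < half := by
    simpa [curlFirst] using aff_strictMono half_pos crossIn_mem.2
  rw [h] at h1
  exact absurd (aff_mem half_lt_one (aff half 1 crossOut)).1 (not_le.2 h1)

theorem curl_point : curl hc curlFirst = curl hc curlSecond := by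
  simp only [curlFirst, curlSecond, curl_in, curl_out, strandIn_cross, strandOut_cross]

theorem curl_runsAlong_first {ψ : ℂ → F} {d : ℂ} (h0 : ψ 0 = ω (Complex.I / 2))
    (hd : ∀ r : ℝ, ψ (r * d) = ω (Complex.I / 2 + r * (loopStart - -1))) :
    RunsAlong ψ d (ω ∘ curl hc) curlFirst := by
  refine RunsAlong.of_comp (aff_strictMono half_pos) crossIn_mem ?_
  have : (ω ∘ curl hc) ∘ aff 0 half = ω ∘ strandIn := by
    ext t; simp
  rw [this]
  exact runsAlong_seg (h0.trans (by rw [← strandIn_cross]; rfl)) fun r => by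
    rw [hd, ← strandIn_cross]; rfl

theorem curl_runsAlong_second {ψ : ℂ → F} {d : ℂ} (h0 : ψ 0 = ω (Complex.I / 2))
    (hd : ∀ r : ℝ, ψ (r * d) = ω (Complex.I / 2 + r * (1 - loopEnd))) :
    RunsAlong ψ d (ω ∘ curl hc) curlSecond := by
  have hm := aff_strictMono half_lt_one
  refine RunsAlong.of_comp hm ?_ (RunsAlong.of_comp hm crossOut_mem ?_)
  · exact ⟨half_pos.trans (by simpa using hm crossOut_mem.1), by simpa using hm crossOut_mem.2⟩
  have : ((ω ∘ curl hc) ∘ aff half 1) ∘ aff half 1 = ω ∘ strandOut := by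
    ext t; simp
  rw [this]
  exact runsAlong_seg (h0.trans (by rw [← strandOut_cross]; rfl)) fun r => by
    rw [hd, ← strandOut_cross]; rfl

/-- A continuous curve in the plane, drawn in a chart. -/
noncomputable def draw (ω : ℂ → F) (hω : IsOpenEmbedding ω) (c : C(I, ℂ)) : C(I, F) :=
  ⟨ω ∘ c, hω.continuous.comp c.continuous⟩

@[simp]
theorem draw_apply (hω : IsOpenEmbedding ω) (c : C(I, ℂ)) (t : I) :
    draw ω hω c t = ω (c t) := rfl

theorem isFlat_draw_cat (hω : IsOpenEmbedding ω) {p q : C(I, ℂ)} {h : p 1 = q 0}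
    (hp : IsFlat (ω ∘ p)) (hq : IsFlat (ω ∘ q)) : IsFlat (ω ∘ cat p q h) := by
  have h' : draw ω hω p 1 = draw ω hω q 0 := congrArg ω h
  have : ω ∘ cat p q h = cat (draw ω hω p) (draw ω hω q) h' := by
    ext t
    obtain ⟨s, rfl | rfl⟩ := exists_half t
    · rw [cat_left]; simp
    · rw [cat_right]; simp
  rw [this]
  exact IsFlat.cat hp hq

theorem isFlat_curl (hω : IsOpenEmbedding ω) : IsFlat (draw ω hω (curl hc)) := by
  exact isFlat_draw_cat hω (isFlat_seg hω loopStart_ne)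
    (isFlat_draw_cat hω hc.flat (isFlat_seg hω loopEnd_ne))

/-- The same curve is used with either strand on top. In the two cases the axes of the chart at the
crossing are interchanged. -/
theorem isArc_curl (hω : IsOpenEmbedding ω) :
    IsArc (ω ∘ stretch) (ω (-1)) (ω 1) (fun s t => s = curlFirst ∧ t = curlSecond)
      (draw ω hω (curl hc)) ∧
    IsArc (ω ∘ stretch) (ω (-1)) (ω 1) (fun s t => s = curlSecond ∧ t = curlFirst)
      (draw ω hω (curl hc)) := by
  have h0 : draw ω hω (curl hc) 0 = ω (-1) := by simp [curl, strandIn]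
  have h1 : draw ω hω (curl hc) 1 = ω 1 := by simp [curl, strandOut]
  have hm : ∀ t ∈ Set.Ioo 0 1, draw ω hω (curl hc) t ∈ (ω ∘ stretch) '' Metric.ball 0 1 := by
    intro t ht
    rw [image_stretch]
    exact ⟨_, curl_mem_ellipse hc ht, rfl⟩
  have hp : draw ω hω (curl hc) curlFirst = draw ω hω (curl hc) curlSecond :=
    congrArg ω (curl_point hc)
  -- The directions of the strands are linearly independent and hence serve as axes of an affine
  -- chart at the crossing.
  have hdet : (loopStart - -1).re * (1 - loopEnd).im - (loopStart - -1).im * (1 - loopEnd).re ≠ 0 := by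
    norm_num [loopStart, loopEnd]
  have hdet' : (1 - loopEnd).re * (loopStart - -1).im - (1 - loopEnd).im * (loopStart - -1).re ≠ 0 := by
    norm_num [loopStart, loopEnd]
  constructor
  · refine ⟨h0, h1, hm, ?_, ?_, ?_, ?_, ?_, ?_, ?_, isFlat_curl hc hω, ?_⟩
    · rintro _ _ ⟨rfl, rfl⟩; exact hp
    · rintro _ _ ⟨rfl, rfl⟩; exact curlFirst_ne
    · rintro _ _ ⟨rfl, rfl⟩ ⟨h, -⟩; exact curlFirst_ne h.symm
    · rintro _ _ ⟨rfl, rfl⟩; exact ⟨curlFirst_mem, curlSecond_mem⟩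
    · exact (Set.finite_singleton (curlFirst, curlSecond)).subset fun p hp => Prod.ext hp.1 hp.2
    · rintro s t u (⟨rfl, rfl⟩ | ⟨rfl, rfl⟩) (⟨h, rfl⟩ | ⟨rfl, h⟩)
      · rfl
      · exact absurd h curlFirst_ne
      · exact absurd h.symm curlFirst_ne
      · rfl
    · intro s t h
      rcases curl_meet hc (hω.injective h) with h | h | h
      · exact Or.inl h
      · exact Or.inr (Or.inl h)
      · exact Or.inr (Or.inr h.symm)
    · rintro _ _ ⟨rfl, rfl⟩
      refine ⟨_, hω.comp (isOpenEmbedding_chart (Complex.I / 2) hdet),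
        curl_runsAlong_first hc (by simp [chart]) fun r => by simp [chart],
        curl_runsAlong_second hc (by simp [chart]) fun r => by simp [chart]⟩
  · refine ⟨h0, h1, hm, ?_, ?_, ?_, ?_, ?_, ?_, ?_, isFlat_curl hc hω, ?_⟩
    · rintro _ _ ⟨rfl, rfl⟩; exact hp.symm
    · rintro _ _ ⟨rfl, rfl⟩; exact curlFirst_ne.symm
    · rintro _ _ ⟨rfl, rfl⟩ ⟨h, -⟩; exact curlFirst_ne h
    · rintro _ _ ⟨rfl, rfl⟩; exact ⟨curlSecond_mem, curlFirst_mem⟩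
    · exact (Set.finite_singleton (curlSecond, curlFirst)).subset fun p hp => Prod.ext hp.1 hp.2
    · rintro s t u (⟨rfl, rfl⟩ | ⟨rfl, rfl⟩) (⟨h, rfl⟩ | ⟨rfl, h⟩)
      · rfl
      · exact absurd h.symm curlFirst_ne
      · exact absurd h curlFirst_ne
      · rfl
    · intro s t h
      rcases curl_meet hc (hω.injective h) with h | h | h
      · exact Or.inl h
      · exact Or.inr (Or.inr h.symm)
      · exact Or.inr (Or.inl h)
    · rintro _ _ ⟨rfl, rfl⟩
      refine ⟨_, hω.comp (isOpenEmbedding_chart (Complex.I / 2) hdet'),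
        curl_runsAlong_second hc (by simp [chart]) fun r => by simp [chart],
        curl_runsAlong_first hc (by simp [chart]) fun r => by simp [chart]⟩

end curl

/-- A straight way of closing up the standard curl. -/
theorem isCurlLoop_seg {ω : ℂ → F} (hω : IsOpenEmbedding ω) :
    IsCurlLoop ω (seg loopStart loopEnd) where
  zero := by simp
  one := by simp
  inj := seg_injective fun h => by
    have := congrArg Complex.re h; norm_num [loopStart, loopEnd] at this
  le_im t := by simp [seg_apply, loopStart, loopEnd]
  mem_ellipse t := by
    have h0 := t.2.1
    have h1 := t.2.2
    simp only [ellipse, Set.mem_ofPred_eq, seg_apply, loopStart, loopEnd]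
    simp
    nlinarith
  flat := isFlat_seg hω fun h => by
    have := congrArg Complex.re h; norm_num [loopStart, loopEnd] at this

/-! ### Pieces in standard position -/

namespace PieceDiagram

/-- The piece `d` runs in the chart `ω` from `-1` to `1` and is all of the diagram in the ellipse
with these points as vertices. -/
structure InPosition (D : PieceDiagram S n) (ω : ℂ → F) (d : Fin n) : Prop where
  emb : IsOpenEmbedding ω
  channel : D.Channel (ω ∘ stretch) d
  start : D.path d 0 = ω (-1)
  finish : D.path d 1 = ω 1

/-- In the skein, a piece that is alone in an ellipse may be replaced by another simple arc. -/
theorem InPosition.toSkein_replaceArc {D : PieceDiagram S n} {ω : ℂ → F} {d : Fin n}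
    (h : D.InPosition ω d) {β : C(I, F)}
    (hβ : IsArc (ω ∘ stretch) (D.path d 0) (D.path d 1) (fun _ _ => False) β) :
    toSkein ⟨n, D.replaceArc h.channel β hβ⟩ = toSkein ⟨n, D⟩ := by
  -- Put a curl on the piece. Both the old arc and `β` arise by removing this same curl, at the cost
  -- of the same unit.
  have hα := (isArc_curl (isCurlLoop_seg h.emb) h.emb).1
  rw [← h.start, ← h.finish] at hα
  exact (isCurlRemoval_replaceArc (c := h.channel) hα hβ).toSkein_eq
    (isCurlRemoval_replaceArc_self hα)

theorem InPosition.addCircle {D : PieceDiagram S n} {ω : ℂ → F} {d : Fin n}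
    (h : D.InPosition ω d) {κ : C(I, F)} (hκ : IsLoop κ) (hd : ∀ e t s, D.path e t ≠ κ s)
    (hω : ∀ t, κ t ∉ ω '' ellipse) : (D.addCircle κ hκ hd).InPosition ω d.castSucc where
  emb := h.emb
  channel := h.channel.addCircle (by rwa [image_stretch])
  start := by simpa using h.start
  finish := by simpa using h.finish

theorem InPosition.toSkein_addCircle_replaceArc {D : PieceDiagram S n} {ω : ℂ → F} {d : Fin n}
    (h : D.InPosition ω d) {κ : C(I, F)} (hκ : IsLoop κ) (hd : ∀ e t s, D.path e t ≠ κ s)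
    (hω : ∀ t, κ t ∉ ω '' ellipse) {β : C(I, F)}
    (hβ : IsArc (ω ∘ stretch) (D.path d 0) (D.path d 1) (fun _ _ => False) β)
    (hd' : ∀ e t s, (D.replaceArc h.channel β hβ).path e t ≠ κ s) :
    toSkein ⟨n + 1, (D.replaceArc h.channel β hβ).addCircle κ hκ hd'⟩ =
      toSkein ⟨n + 1, D.addCircle κ hκ hd⟩ := by
  have hβ' : IsArc (ω ∘ stretch) ((D.addCircle κ hκ hd).path d.castSucc 0)
      ((D.addCircle κ hκ hd).path d.castSucc 1) (fun _ _ => False) β := by simpa using hβ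
  rw [← (h.addCircle hκ hd hω).toSkein_replaceArc hβ',
    replaceArc_addCircle h.channel (by rwa [image_stretch]) hβ hβ' hd']

end PieceDiagram

/-! ### Cutting the curl and the circle into matching pieces -/

namespace PieceDiagram

section cutTwice

variable (D : PieceDiagram S n) (d : Fin n) (t s : I) (ht0 : 0 < t) (ht1 : t < 1) (hs0 : 0 < s)
  (hs1 : s < 1) (h : D.Uncrossed (d, t)) (h' : D.Uncrossed (d, aff t 1 s))

theorem uncrossed_cut_last (D : PieceDiagram S n) (d : Fin n) (t s : I) (ht0 : 0 < t) (ht1 : t < 1)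
    (h : D.Uncrossed (d, t)) (h' : D.Uncrossed (d, aff t 1 s)) :
    (D.cut d t ht0 ht1 h).toDiagram.Uncrossed (Fin.last n, s) := fun y => by
  have := h' ((D.cut d t ht0 ht1 h).proj y)
  rwa [← cut_proj_last D d t ht0 ht1 h] at this

/-- Cutting the piece `d` into three parts. The middle part becomes the last piece but one, the
third part the last piece. -/
def cutTwice : (D.cut d t ht0 ht1 h).toDiagram.Refinement (n + 2) :=
  (D.cut d t ht0 ht1 h).toDiagram.cut (Fin.last n) s hs0 hs1
    (D.uncrossed_cut_last d t s ht0 ht1 h h')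

theorem cutTwice_toSkein : toSkein ⟨n + 2, (D.cutTwice d t s ht0 ht1 hs0 hs1 h h').toDiagram⟩ =
    toSkein ⟨n, D⟩ :=
  (Refinement.subdivides _).toSkein_eq.trans (Refinement.subdivides _).toSkein_eq

/-- The point of the original diagram. -/
def cutTwiceProj (x : Fin (n + 2) × I) : Fin n × I :=
  (D.cut d t ht0 ht1 h).proj ((D.cutTwice d t s ht0 ht1 hs0 hs1 h h').proj x)

theorem cutTwice_path (x : Fin (n + 2) × I) :
    (D.cutTwice d t s ht0 ht1 hs0 hs1 h h').toDiagram.path x.1 x.2 =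
      D.path (D.cutTwiceProj d t s ht0 ht1 hs0 hs1 h h' x).1
        (D.cutTwiceProj d t s ht0 ht1 hs0 hs1 h h' x).2 := rfl

theorem cutTwiceProj_last (r : I) : D.cutTwiceProj d t s ht0 ht1 hs0 hs1 h h' (Fin.last (n + 1), r) =
    (d, aff t 1 (aff s 1 r)) := by
  rw [cutTwiceProj, cutTwice, cut_proj_last, cut_proj_last]

theorem cutTwiceProj_middle (r : I) :
    D.cutTwiceProj d t s ht0 ht1 hs0 hs1 h h' ((Fin.last n).castSucc, r) =
      (d, aff t 1 (aff 0 s r)) := by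
  rw [cutTwiceProj, cutTwice, cut_proj_self, cut_proj_last]

theorem cutTwiceProj_self (r : I) :
    D.cutTwiceProj d t s ht0 ht1 hs0 hs1 h h' (d.castSucc.castSucc, r) = (d, aff 0 t r) := by
  rw [cutTwiceProj, cutTwice, cut_proj_of_ne _ _ _ _ _ _ (Fin.castSucc_lt_last d).ne,
    cut_proj_self]

theorem cutTwiceProj_of_ne {e : Fin n} (he : e ≠ d) (r : I) :
    D.cutTwiceProj d t s ht0 ht1 hs0 hs1 h h' (e.castSucc.castSucc, r) = (e, r) := by
  rw [cutTwiceProj, cutTwice, cut_proj_of_ne _ _ _ _ _ _ (Fin.castSucc_lt_last e).ne,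
    cut_proj_of_ne _ _ _ _ _ _ he]

theorem cutTwiceProj_inj {x y : Fin (n + 2) × I} (hx : x.2 ∈ Set.Ioo 0 1)
    (hx' : ((D.cutTwice d t s ht0 ht1 hs0 hs1 h h').proj x).2 ∈ Set.Ioo 0 1)
    (hxy : D.cutTwiceProj d t s ht0 ht1 hs0 hs1 h h' x =
      D.cutTwiceProj d t s ht0 ht1 hs0 hs1 h h' y) : x = y :=
  Refinement.proj_inj _ (Refinement.proj_inj _ hxy hx') hx

theorem exists_cutTwice (e : Fin (n + 2)) : (∃ i, i ≠ d ∧ e = i.castSucc.castSucc) ∨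
    e = d.castSucc.castSucc ∨ e = (Fin.last n).castSucc ∨ e = Fin.last (n + 1) := by
  induction e using Fin.lastCases with
  | last => exact Or.inr (Or.inr (Or.inr rfl))
  | cast e =>
    induction e using Fin.lastCases with
    | last => exact Or.inr (Or.inr (Or.inl rfl))
    | cast e =>
      by_cases he : e = d
      · exact Or.inr (Or.inl (by rw [he]))
      · exact Or.inl ⟨e, he, rfl⟩

end cutTwice

end PieceDiagram

/-- The strands are chords between the rational points ±1 and (±3/5, 4/5) of the unit circle. The
unit disc is therefore a disc in which the crossing can be smoothed, while the loop of the curl runs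
outside it, within the ellipse. -/
theorem isProper_strandIn {t : I} (ht : t ∈ Set.Ioo 0 1) : strandIn t ∈ Metric.ball (0 : ℂ) 1 := by
  have h0 : (0 : ℝ) < t := ht.1
  have h1 : (t : ℝ) < 1 := ht.2
  rw [mem_ball_zero_iff, ← sq_lt_one_iff₀ (norm_nonneg _), Complex.sq_norm, Complex.normSq_apply,
    strandIn_re, strandIn_im]
  nlinarith

theorem isProper_strandOut {t : I} (ht : t ∈ Set.Ioo 0 1) :
    strandOut t ∈ Metric.ball (0 : ℂ) 1 := by
  have h0 : (0 : ℝ) < t := ht.1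
  have h1 : (t : ℝ) < 1 := ht.2
  rw [mem_ball_zero_iff, ← sq_lt_one_iff₀ (norm_nonneg _), Complex.sq_norm, Complex.normSq_apply,
    strandOut_re, strandOut_im]
  nlinarith

theorem loopStart_mem_sphere : loopStart ∈ Metric.sphere (0 : ℂ) 1 := by
  rw [mem_sphere_zero_iff_norm, ← pow_eq_one_iff_of_nonneg (norm_nonneg _) two_ne_zero, Complex.sq_norm,
    Complex.normSq_apply]
  norm_num [loopStart]

theorem loopEnd_mem_sphere : loopEnd ∈ Metric.sphere (0 : ℂ) 1 := by
  rw [mem_sphere_zero_iff_norm, ← pow_eq_one_iff_of_nonneg (norm_nonneg _) two_ne_zero, Complex.sq_norm,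
    Complex.normSq_apply]
  norm_num [loopEnd]

theorem ball_subset_ellipse : Metric.ball (0 : ℂ) 1 ⊆ ellipse := by
  intro w hw
  rw [mem_ball_zero_iff, ← sq_lt_one_iff₀ (norm_nonneg _), Complex.sq_norm,
    Complex.normSq_apply] at hw
  simp only [ellipse, Set.mem_ofPred_eq]
  nlinarith [sq_nonneg w.im]

/-- A closed curve in the plane that goes from `loopStart` over the unit disc to `loopEnd` and back
through the unit disc. -/
structure IsGoodLoop (U : C(I, ℂ)) (t : I) : Prop where
  pos : 0 < t
  lt_one : t < 1
  zero : U 0 = loopStart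
  one : U 1 = loopStart
  mid : U t = loopEnd
  mem_ellipse : ∀ s, U s ∈ ellipse
  le_im : ∀ s, s ≤ t → 4 / 5 ≤ (U s).im
  notMem_ball : ∀ s, s ≤ t → U s ∉ Metric.ball 0 1
  mem_ball : ∀ s, t < s → s < 1 → U s ∈ Metric.ball 0 1

namespace PieceDiagram

section split

variable {D : PieceDiagram S n} {ω : ℂ → F} {d : Fin n} {κ : C(I, F)} {U : C(I, ℂ)} {t : I}

/-- The part of the circle outside the unit disc closes up the curl. It is injective because `t < 1`
keeps it away from the parameter at which the circle closes. -/
theorem isCurlLoop_of_isGoodLoop (hκ : IsLoop κ) (hU : ∀ s, κ s = ω (U s)) (h : IsGoodLoop U t) :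
    IsCurlLoop ω (U.comp (aff 0 t)) where
  zero := by simpa using h.zero
  one := by simpa using h.mid
  inj r s hrs := by
    have h1 := congrArg ω hrs
    simp only [ContinuousMap.comp_apply, ← hU] at h1
    have hm := aff_mem h.pos
    rcases hκ.inj _ _ h1 with h1 | ⟨h1, -⟩ | ⟨h1, -⟩
    · exact (aff_strictMono h.pos).injective h1
    · exact absurd (h1 ▸ (hm r).2) (not_le.2 h.lt_one)
    · exact absurd (h1 ▸ (hm s).2) (not_le.2 h.lt_one)
  le_im s := h.le_im _ (aff_mem h.pos s).2
  mem_ellipse s := h.mem_ellipse _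
  flat := by
    have : ω ∘ (U.comp (aff 0 t)) = κ ∘ aff 0 t := by
      ext s; simp [hU]
    rw [this]
    exact IsFlat.comp hκ.flat (aff 0 t).continuous (aff_strictMono h.pos)

theorem half_lt_aff {s : I} (h : 0 < s) : half < aff half 1 s := by
  simpa using aff_strictMono half_lt_one h

theorem curlFirst_lt_half : curlFirst < half := by
  simpa [curlFirst] using aff_strictMono half_pos crossIn_mem.2

/-- The curl is cut at the parameters 1/2 and 3/4, where it changes from strand to loop and back, so
that the three parts are exactly `strandIn`, the loop and `strandOut`. Cuts must avoid the crossing.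
-/
theorem half_ne_cross : half ≠ curlFirst ∧ half ≠ curlSecond :=
  ⟨curlFirst_lt_half.ne', (half_lt_aff (half_pos.trans (half_lt_aff crossOut_mem.1))).ne⟩

theorem aff_half_ne_cross : aff half 1 half ≠ curlFirst ∧ aff half 1 half ≠ curlSecond :=
  ⟨(curlFirst_lt_half.trans (half_lt_aff half_pos)).ne',
    (aff_strictMono half_lt_one (half_lt_aff crossOut_mem.1)).ne⟩

theorem uncrossed_replaceArc (c : D.Channel (ω ∘ stretch) d) {X : I → I → Prop} {α : C(I, F)}
    (hα : IsArc (ω ∘ stretch) (D.path d 0) (D.path d 1) X α) {r : I}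
    (hr : ∀ s, ¬ X r s ∧ ¬ X s r) : (D.replaceArc c α hα).Uncrossed (d, r) := by
  intro y
  constructor
  · rintro (h | ⟨-, -, h⟩)
    · exact (c.fst_ne h).1 rfl
    · exact (hr _).1 h
  · rintro (h | ⟨-, -, h⟩)
    · exact (c.fst_ne h).2 rfl
    · exact (hr _).2 h

/-- The diagram with a curl, cut up at the crossing. -/
noncomputable def splitCurl (D : PieceDiagram S n) (c : D.Channel (ω ∘ stretch) d)
    {X : I → I → Prop} (α : C(I, F))
    (hα : IsArc (ω ∘ stretch) (D.path d 0) (D.path d 1) X α)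
    (h1 : ∀ s, ¬ X half s ∧ ¬ X s half)
    (h2 : ∀ s, ¬ X (aff half 1 half) s ∧ ¬ X s (aff half 1 half)) : PieceDiagram S (n + 2) :=
  ((D.replaceArc c α hα).cutTwice d half half half_pos half_lt_one half_pos half_lt_one
    (uncrossed_replaceArc c hα h1) (uncrossed_replaceArc c hα h2)).toDiagram

end split

end PieceDiagram

namespace PieceDiagram

section split

variable {D : PieceDiagram S n} {ω : ℂ → F} {d : Fin n} {κ : C(I, F)} {U : C(I, ℂ)} {t : I}

section splitCurl

variable {c : D.Channel (ω ∘ stretch) d} {X : I → I → Prop} {α : C(I, F)}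
  {hα : IsArc (ω ∘ stretch) (D.path d 0) (D.path d 1) X α}
  {h1 : ∀ s, ¬ X half s ∧ ¬ X s half}
  {h2 : ∀ s, ¬ X (aff half 1 half) s ∧ ¬ X s (aff half 1 half)}

theorem splitCurl_toSkein : toSkein ⟨n + 2, D.splitCurl c α hα h1 h2⟩ =
    toSkein ⟨n, D.replaceArc c α hα⟩ :=
  cutTwice_toSkein _ _ _ _ _ _ _ _ _ _

/-- The crossing of the cut up curl, on the first strand. -/
noncomputable def splitFirst (d : Fin n) : Fin (n + 2) × I := (d.castSucc.castSucc, crossIn)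

/-- The crossing of the cut up curl, on the second strand. -/
noncomputable def splitSecond (n : ℕ) : Fin (n + 2) × I := (Fin.last (n + 1), crossOut)

theorem splitCurl_path_self (s : I) :
    (D.splitCurl c α hα h1 h2).path d.castSucc.castSucc s = α (aff 0 half s) := by
  refine (cutTwice_path _ _ _ _ _ _ _ _ _ _ (d.castSucc.castSucc, s)).trans ?_
  rw [cutTwiceProj_self, replaceArc_path_self]

theorem splitCurl_path_middle (s : I) :
    (D.splitCurl c α hα h1 h2).path (Fin.last n).castSucc s =
      α (aff half 1 (aff 0 half s)) := by
  refine (cutTwice_path _ _ _ _ _ _ _ _ _ _ ((Fin.last n).castSucc, s)).trans ?_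
  rw [cutTwiceProj_middle, replaceArc_path_self]

theorem splitCurl_path_last (s : I) :
    (D.splitCurl c α hα h1 h2).path (Fin.last (n + 1)) s =
      α (aff half 1 (aff half 1 s)) := by
  refine (cutTwice_path _ _ _ _ _ _ _ _ _ _ (Fin.last (n + 1), s)).trans ?_
  rw [cutTwiceProj_last, replaceArc_path_self]

theorem splitCurl_path_of_ne {i : Fin n} (hi : i ≠ d) (s : I) :
    (D.splitCurl c α hα h1 h2).path i.castSucc.castSucc s = D.path i s := by
  refine (cutTwice_path _ _ _ _ _ _ _ _ _ _ (i.castSucc.castSucc, s)).trans ?_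
  rw [cutTwiceProj_of_ne _ _ _ _ _ _ _ _ _ _ hi, replaceArc_path_of_ne hi]

theorem splitCurl_next : (D.splitCurl c α hα h1 h2).next =
    cutNext (cutNext D.next d) (Fin.last n) := rfl

/-- Each of the two crossing parameters comes from exactly one parameter of the cut diagram, as the
cuts are elsewhere. All four combinations are listed so that both choices of the upper strand are
covered. -/
theorem splitCurl_above (hX : ∀ r s, X r s → (r = curlFirst ∨ r = curlSecond) ∧
    (s = curlFirst ∨ s = curlSecond)) (x y : Fin (n + 2) × I) :
    (D.splitCurl c α hα h1 h2).above x y ↔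
      (∃ x' y', D.above x' y' ∧ x = emb (emb x') ∧ y = emb (emb y')) ∨
      (x = splitFirst d ∧ y = splitFirst d ∧ X curlFirst curlFirst) ∨
      (x = splitFirst d ∧ y = splitSecond n ∧ X curlFirst curlSecond) ∨
      (x = splitSecond n ∧ y = splitFirst d ∧ X curlSecond curlFirst) ∨
      (x = splitSecond n ∧ y = splitSecond n ∧ X curlSecond curlSecond) := by
  let E := D.replaceArc c α hα
  let P := E.cutTwiceProj d half half half_pos half_lt_one half_pos half_lt_one
    (uncrossed_replaceArc c hα h1) (uncrossed_replaceArc c hα h2)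
  have hfirst : P (splitFirst d) = (d, curlFirst) := cutTwiceProj_self _ _ _ _ _ _ _ _ _ _ _
  have hsecond : P (splitSecond n) = (d, curlSecond) := cutTwiceProj_last _ _ _ _ _ _ _ _ _ _ _
  have hfirst' : ∀ x, P x = (d, curlFirst) → x = splitFirst d := by
    intro x hx
    refine (cutTwiceProj_inj _ _ _ _ _ _ _ _ _ _ crossIn_mem ?_ (hfirst.trans hx.symm)).symm
    rw [cutTwice, splitFirst, cut_proj_of_ne _ _ _ _ _ _ (Fin.castSucc_lt_last d).ne]
    exact crossIn_mem
  have hsecond' : ∀ x, P x = (d, curlSecond) → x = splitSecond n := by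
    intro x hx
    refine (cutTwiceProj_inj _ _ _ _ _ _ _ _ _ _ crossOut_mem ?_ (hsecond.trans hx.symm)).symm
    rw [cutTwice, splitSecond, cut_proj_last]
    exact ⟨half_pos.trans (half_lt_aff crossOut_mem.1),
      by simpa using aff_strictMono half_lt_one crossOut_mem.2⟩
  have hne : ∀ i s, i ≠ d → P (emb (emb (i, s))) = (i, s) := fun i s hi =>
    cutTwiceProj_of_ne _ _ _ _ _ _ _ _ _ _ hi s
  have hne' : ∀ x, (P x).1 ≠ d → ∃ x', x = emb (emb x') ∧ P x = x' := by
    rintro ⟨e, s⟩ hx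
    rcases exists_cutTwice d e with ⟨i, hi, rfl⟩ | rfl | rfl | rfl
    · exact ⟨(i, s), rfl, hne i s hi⟩
    · exact absurd (congrArg Prod.fst (cutTwiceProj_self E d _ _ _ _ _ _ _ _ s)) hx
    · exact absurd (congrArg Prod.fst (cutTwiceProj_middle E d _ _ _ _ _ _ _ _ s)) hx
    · exact absurd (congrArg Prod.fst (cutTwiceProj_last E d _ _ _ _ _ _ _ _ s)) hx
  have key : (D.splitCurl c α hα h1 h2).above x y ↔
      D.above (P x) (P y) ∨ ((P x).1 = d ∧ (P y).1 = d ∧ X (P x).2 (P y).2) := Iff.rfl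
  rw [key]
  constructor
  · rintro (h | ⟨hx, hy, h⟩)
    · left
      obtain ⟨x', hx, hx'⟩ := hne' x (c.fst_ne h).1
      obtain ⟨y', hy, hy'⟩ := hne' y (c.fst_ne h).2
      rw [hx', hy'] at h
      exact ⟨x', y', h, hx, hy⟩
    · right
      obtain ⟨hx' | hx', hy' | hy'⟩ := hX _ _ h <;> rw [hx', hy'] at h
      · exact Or.inl ⟨hfirst' _ (Prod.ext hx hx'), hfirst' _ (Prod.ext hy hy'), h⟩
      · exact Or.inr (Or.inl ⟨hfirst' _ (Prod.ext hx hx'), hsecond' _ (Prod.ext hy hy'), h⟩)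
      · exact Or.inr (Or.inr (Or.inl
          ⟨hsecond' _ (Prod.ext hx hx'), hfirst' _ (Prod.ext hy hy'), h⟩))
      · exact Or.inr (Or.inr (Or.inr
          ⟨hsecond' _ (Prod.ext hx hx'), hsecond' _ (Prod.ext hy hy'), h⟩))
  · rintro (⟨⟨i, r⟩, ⟨j, s⟩, h, rfl, rfl⟩ | ⟨rfl, rfl, h⟩ | ⟨rfl, rfl, h⟩ | ⟨rfl, rfl, h⟩ |
      ⟨rfl, rfl, h⟩)
    · left
      rwa [hne _ _ (c.fst_ne h).1, hne _ _ (c.fst_ne h).2]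
    · right; rw [hfirst]; exact ⟨rfl, rfl, h⟩
    · right; rw [hfirst, hsecond]; exact ⟨rfl, rfl, h⟩
    · right; rw [hfirst, hsecond]; exact ⟨rfl, rfl, h⟩
    · right; rw [hsecond]; exact ⟨rfl, rfl, h⟩

/-- Signs of crossings are not changed by the cutting. -/
theorem splitCurl_isPositive {x y : Fin (n + 2) × I} {r s : I}
    (hx : (D.replaceArc c α hα).cutTwiceProj d half half half_pos half_lt_one half_pos half_lt_one
      (uncrossed_replaceArc c hα h1) (uncrossed_replaceArc c hα h2) x = (d, r))
    (hy : (D.replaceArc c α hα).cutTwiceProj d half half half_pos half_lt_one half_pos half_lt_one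
      (uncrossed_replaceArc c hα h1) (uncrossed_replaceArc c hα h2) y = (d, s)) :
    ((D.replaceArc c α hα).IsPositive (d, r) (d, s) →
      (D.splitCurl c α hα h1 h2).IsPositive x y) ∧
    ((D.replaceArc c α hα).IsNegative (d, r) (d, s) →
      (D.splitCurl c α hα h1 h2).IsNegative x y) := by
  rw [← hx, ← hy]
  exact ⟨fun h => Refinement.isPositive _ (Refinement.isPositive _ h),
    fun h => Refinement.isNegative _ (Refinement.isNegative _ h)⟩

end splitCurl

theorem addCircle_uncrossed_last {hκ : IsLoop κ} {hd : ∀ e t s, D.path e t ≠ κ s} (t : I) :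
    (D.addCircle κ hκ hd).Uncrossed (Fin.last n, t) := fun _ =>
  ⟨addCircle_not_above_last (Or.inl rfl), addCircle_not_above_last (Or.inr rfl)⟩

/-- The union of a diagram and a closed curve, the latter cut into two. -/
noncomputable def splitCircle (D : PieceDiagram S n) (hκ : IsLoop κ)
    (hd : ∀ e t s, D.path e t ≠ κ s) (t : I) (h0 : 0 < t) (h1 : t < 1) : PieceDiagram S (n + 2) :=
  ((D.addCircle κ hκ hd).cut (Fin.last n) t h0 h1
    (addCircle_uncrossed_last t)).toDiagram

section splitCircle

variable {hκ : IsLoop κ} {hd : ∀ e t s, D.path e t ≠ κ s} {h0 : 0 < t} {h1 : t < 1}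

theorem splitCircle_toSkein : toSkein ⟨n + 2, D.splitCircle hκ hd t h0 h1⟩ =
    toSkein ⟨n + 1, D.addCircle κ hκ hd⟩ :=
  (Refinement.subdivides _).toSkein_eq

theorem splitCircle_path_last (s : I) :
    (D.splitCircle hκ hd t h0 h1).path (Fin.last (n + 1)) s = κ (aff t 1 s) := by
  rw [splitCircle, cut_path_last, addCircle_path_last]

theorem splitCircle_path_middle (s : I) :
    (D.splitCircle hκ hd t h0 h1).path (Fin.last n).castSucc s = κ (aff 0 t s) := by
  rw [splitCircle, cut_path_self, addCircle_path_last]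

theorem splitCircle_path (i : Fin n) (s : I) :
    (D.splitCircle hκ hd t h0 h1).path i.castSucc.castSucc s = D.path i s := by
  rw [splitCircle, cut_path_of_ne _ _ _ _ _ _ (Fin.castSucc_lt_last i).ne,
    addCircle_path_castSucc]

theorem splitCircle_next : (D.splitCircle hκ hd t h0 h1).next =
    cutNext (liftNext D.next) (Fin.last n) := rfl

theorem splitCircle_above (x y : Fin (n + 2) × I) : (D.splitCircle hκ hd t h0 h1).above x y ↔
    ∃ x' y', D.above x' y' ∧ x = emb (emb x') ∧ y = emb (emb y') := by
  have hun : (D.addCircle κ hκ hd).Uncrossed (Fin.last n, t) := addCircle_uncrossed_last t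
  have hp : ∀ x : Fin (n + 1) × I, x.1 ≠ Fin.last n →
      ((D.addCircle κ hκ hd).cut (Fin.last n) t h0 h1 hun).proj (emb x) = x :=
    fun x hx => cut_proj_of_ne _ _ _ _ _ _ hx _
  have hp' : ∀ x (x' : Fin n × I),
      ((D.addCircle κ hκ hd).cut (Fin.last n) t h0 h1 hun).proj x = emb x' → x = emb (emb x') := by
    rintro ⟨e, s⟩ x' h
    rcases emb_or_last (e, s) with ⟨x, hx⟩ | rfl
    · rw [hx] at h ⊢
      by_cases hl : x.1 = Fin.last n
      · obtain ⟨i, r⟩ := x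
        simp only at hl
        subst hl
        have h := (cut_proj_self _ _ _ _ _ _ _).symm.trans h
        exact absurd (congrArg Prod.fst h).symm (emb_fst_ne _)
      · rw [← hp _ hl, h]
    · rw [cut_proj_last] at h
      exact absurd (congrArg Prod.fst h).symm (emb_fst_ne _)
  rw [splitCircle, cut_above, addCircle_above]
  constructor
  · rintro ⟨x', y', h, hx, hy⟩
    exact ⟨x', y', h, hp' _ _ hx, hp' _ _ hy⟩
  · rintro ⟨x', y', h, rfl, rfl⟩
    exact ⟨x', y', h, hp _ (emb_fst_ne _), hp _ (emb_fst_ne _)⟩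

end splitCircle

end split

end PieceDiagram

/-! ### The value of a closed curve beside a piece -/

namespace PieceDiagram

variable {D : PieceDiagram S n} {ω : ℂ → F} {d : Fin n} {κ : C(I, F)} {U : C(I, ℂ)} {t : I}

theorem loopStart_ne_loopEnd : loopStart ≠ loopEnd := fun h => by
  have := congrArg Complex.re h; norm_num [loopStart, loopEnd] at this

/-- Smoothing the crossing of a curl splits off a closed curve. -/
theorem isSmoothing_splitCurl (h : D.InPosition ω d)
    (hs : ∀ s ∈ Set.Ioo 0 1, D.path d s ∈ ω '' Metric.ball 0 1) (hκ : IsLoop κ)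
    (hd : ∀ e t s, D.path e t ≠ κ s) (hU : ∀ s, κ s = ω (U s)) (hg : IsGoodLoop U t)
    (hα : IsArc (ω ∘ stretch) (D.path d 0) (D.path d 1)
      (fun s t => s = curlFirst ∧ t = curlSecond)
      (draw ω h.emb (curl (isCurlLoop_of_isGoodLoop hκ hU hg))))
    (h1 : ∀ s, ¬ (half = curlFirst ∧ s = curlSecond) ∧ ¬ (s = curlFirst ∧ half = curlSecond))
    (h2 : ∀ s, ¬ (aff half 1 half = curlFirst ∧ s = curlSecond) ∧
      ¬ (s = curlFirst ∧ aff half 1 half = curlSecond)) :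
    (D.splitCurl h.channel _ hα h1 h2).IsSmoothing (D.splitCircle hκ hd t hg.pos hg.lt_one)
      (splitFirst d) (splitSecond n) := by
  have hinj := h.emb.injective
  have habove := splitCurl_above (D := D) (c := h.channel) (hα := hα) (h1 := h1) (h2 := h2)
    fun r s hrs => ⟨Or.inl hrs.1, Or.inr hrs.2⟩
  have hself : ∀ s, (D.splitCurl h.channel _ hα h1 h2).path d.castSucc.castSucc s =
      ω (strandIn s) := fun s => by
    rw [splitCurl_path_self, draw_apply, curl_in]
  have hlast : ∀ s, (D.splitCurl h.channel _ hα h1 h2).path (Fin.last (n + 1)) s =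
      ω (strandOut s) := fun s => by
    rw [splitCurl_path_last, draw_apply, curl_out]
  have hmiddle : ∀ s, (D.splitCurl h.channel _ hα h1 h2).path (Fin.last n).castSucc s =
      ω (U (aff 0 t s)) := fun s => by
    rw [splitCurl_path_middle, draw_apply, curl_loop]; rfl
  have hin0 : strandIn 0 = -1 := seg_zero _ _
  have hin1 : strandIn 1 = loopStart := seg_one _ _
  have hout0 : strandOut 0 = loopEnd := seg_zero _ _
  have hout1 : strandOut 1 = 1 := seg_one _ _
  have hm : (-1 : ℂ) ∈ Metric.sphere (0 : ℂ) 1 := by simp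
  have hp : (1 : ℂ) ∈ Metric.sphere (0 : ℂ) 1 := by simp
  have hdl : d.castSucc.castSucc ≠ Fin.last (n + 1) := (Fin.castSucc_lt_last _).ne
  simp only [IsSmoothing, IsProperIn, splitFirst, splitSecond, hself, hlast, splitCircle_path,
    splitCircle_path_last, hin0, hin1, hout0, hout1, aff_zero, aff_one, hU, hg.mid, hg.one]
  -- Inside the unit disc the two strands are replaced by the original piece `d`, from -1 to 1, and
  -- by the part of the circle that leads from `loopEnd` back to `loopStart`.
  refine ⟨?_, hdl, ?_, ?_, ⟨ω, h.emb, ⟨fun s hs => ⟨_, isProper_strandIn hs, rfl⟩,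
    ⟨_, hm, rfl⟩, ⟨_, loopStart_mem_sphere, rfl⟩⟩, ⟨fun s hs => ⟨_, isProper_strandOut hs, rfl⟩,
    ⟨_, loopEnd_mem_sphere, rfl⟩, ⟨_, hp, rfl⟩⟩, ⟨hs, ⟨_, hm, h.start.symm⟩,
    ⟨_, hp, h.finish.symm⟩⟩, ⟨fun s hs => ⟨_, ?_, rfl⟩, ⟨_, loopEnd_mem_sphere, rfl⟩,
    ⟨_, loopStart_mem_sphere, rfl⟩⟩, ?_⟩, ?_, ?_, ?_, h.start, h.finish, trivial, trivial, ?_⟩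
  · exact (habove _ _).2 (Or.inr (Or.inr (Or.inl ⟨rfl, rfl, rfl, rfl⟩)))
  · exact fun he => loopStart_ne_loopEnd (hinj he)
  · exact fun he => by
      have := hinj he
      norm_num [Complex.ext_iff] at this
  · refine hg.mem_ball _ ?_ ?_
    · simpa using aff_strictMono hg.lt_one hs.1
    · simpa using aff_strictMono hg.lt_one hs.2
  · intro e he1 he2 s
    rcases exists_cutTwice d e with ⟨i, hi, rfl⟩ | rfl | rfl | rfl
    · rw [splitCurl_path_of_ne hi]
      intro hmem
      refine h.channel.alone i hi s ?_
      rw [image_stretch]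
      exact Set.image_mono ball_subset_ellipse hmem
    · exact absurd rfl he1
    · rw [hmiddle]
      rintro ⟨w, hw, hw'⟩
      exact hg.notMem_ball _ (aff_mem hg.pos s).2 (hinj hw' ▸ hw)
    · exact absurd rfl he2
  · intro x y hxy hor
    rcases (habove _ _).1 hxy with ⟨⟨i, r⟩, ⟨j, s⟩, hD, rfl, rfl⟩ | h | h | h | h
    · have h3 := h.channel.fst_ne hD
      simp only [emb, Fin.castSucc_inj, h3.1, h3.2, (Fin.castSucc_lt_last _).ne, or_self] at hor
    · exact absurd h.2.2.2 curlFirst_ne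
    · exact ⟨h.1, h.2.1⟩
    · exact absurd h.2.2.1 curlFirst_ne.symm
    · exact absurd h.2.2.1 curlFirst_ne.symm
  · intro x y
    rw [splitCircle_above, habove]
    constructor
    · rintro ⟨x', y', hD, rfl, rfl⟩
      refine ⟨Or.inl ⟨_, _, hD, rfl, rfl⟩, fun h3 => ?_⟩
      exact (Fin.castSucc_lt_last _).ne (congrArg Prod.fst h3.2)
    · rintro ⟨h3 | h3 | h3 | h3 | h3, h4⟩
      · exact h3
      · exact absurd h3.2.2.2 curlFirst_ne
      · exact absurd ⟨h3.1, h3.2.1⟩ h4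
      · exact absurd h3.2.2.1 curlFirst_ne.symm
      · exact absurd h3.2.2.1 curlFirst_ne.symm
  · intro e he1 he2
    ext s
    rcases exists_cutTwice d e with ⟨i, hi, rfl⟩ | rfl | rfl | rfl
    · rw [splitCurl_path_of_ne hi, splitCircle_path]
    · exact absurd rfl he1
    · rw [hmiddle, splitCircle_path_middle, hU]
    · exact absurd rfl he2
  -- In the cut curl, `d` is followed by the middle part, this by the last part, and this by the old
  -- successor of `d`. After the exchange `d` continues as in `D`, and the middle and last parts
  -- follow each other as the circle.
  · intro x
    rw [splitCircle_next, splitCurl_next]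
    rcases x with a | e
    · rw [Equiv.swap_apply_of_ne_of_ne (by simp) (by simp)]
      simp
    · rcases exists_cutTwice d e with ⟨i, hi, rfl⟩ | rfl | rfl | rfl
      · rw [Equiv.swap_apply_of_ne_of_ne (by simpa using hi) (by simp [(Fin.castSucc_lt_last _).ne]),
          cutNext_of_ne _ _ (Fin.castSucc_lt_last _).ne,
          cutNext_of_ne _ _ (Fin.castSucc_lt_last _).ne, cutNext_of_ne _ _ hi, liftNext_castSucc]
      · rw [Equiv.swap_apply_left, cutNext_of_ne _ _ (Fin.castSucc_lt_last _).ne, cutNext_last,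
          cutNext_last, liftNext_castSucc]
      · rw [Equiv.swap_apply_of_ne_of_ne (by simp [(Fin.castSucc_lt_last _).ne'])
          (by simp [(Fin.castSucc_lt_last _).ne]), cutNext_self, cutNext_self]
      · rw [Equiv.swap_apply_right, cutNext_last, cutNext_of_ne _ _ (Fin.castSucc_lt_last _).ne,
          cutNext_self, liftNext_last]

/-- The value of a closed curve that is close to a piece of the diagram. -/
theorem InPosition.toSkein_addCircle (h : D.InPosition ω d)
    (hs : ∀ s ∈ Set.Ioo 0 1, D.path d s ∈ ω '' Metric.ball 0 1) (hκ : IsLoop κ)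
    (hd : ∀ e t s, D.path e t ≠ κ s) (hU : ∀ s, κ s = ω (U s)) (hg : IsGoodLoop U t) :
    z • toSkein ⟨n + 1, D.addCircle κ hκ hd⟩ = (vInv - v) • toSkein ⟨n, D⟩ := by
  have hc := isCurlLoop_of_isGoodLoop hκ hU hg
  have hα := isArc_curl hc h.emb
  rw [← h.start, ← h.finish] at hα
  obtain ⟨hα, hα'⟩ := hα
  have h1 : ∀ s, ¬ (half = curlFirst ∧ s = curlSecond) ∧ ¬ (s = curlFirst ∧ half = curlSecond) :=
    fun s => ⟨fun h => half_ne_cross.1 h.1, fun h => half_ne_cross.2 h.2⟩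
  have h1' : ∀ s, ¬ (half = curlSecond ∧ s = curlFirst) ∧ ¬ (s = curlSecond ∧ half = curlFirst) :=
    fun s => ⟨fun h => half_ne_cross.2 h.1, fun h => half_ne_cross.1 h.2⟩
  have h2 : ∀ s, ¬ (aff half 1 half = curlFirst ∧ s = curlSecond) ∧
      ¬ (s = curlFirst ∧ aff half 1 half = curlSecond) :=
    fun s => ⟨fun h => aff_half_ne_cross.1 h.1, fun h => aff_half_ne_cross.2 h.2⟩
  have h2' : ∀ s, ¬ (aff half 1 half = curlSecond ∧ s = curlFirst) ∧
      ¬ (s = curlSecond ∧ aff half 1 half = curlFirst) :=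
    fun s => ⟨fun h => aff_half_ne_cross.2 h.1, fun h => aff_half_ne_cross.1 h.2⟩
  have hsm := isSmoothing_splitCurl h hs hκ hd hU hg hα h1 h2
  have hR := isCurlRemoval_replaceArc_self (c := h.channel) hα
  have hR' := isCurlRemoval_replaceArc_self (c := h.channel) hα'
  have hsw : (D.splitCurl h.channel _ hα h1 h2).IsSwitch (D.splitCurl h.channel _ hα' h1' h2')
      (splitFirst d) (splitSecond n) := by
    refine ⟨hsm.1, rfl, rfl, fun x y => ?_⟩
    rw [splitCurl_above (hα := hα) fun r s hrs => ⟨Or.inl hrs.1, Or.inr hrs.2⟩,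
      splitCurl_above (hα := hα') fun r s hrs => ⟨Or.inr hrs.1, Or.inl hrs.2⟩]
    simp only [curlFirst_ne, curlFirst_ne.symm, and_true, and_false, false_or, or_false]
    constructor
    · rintro (⟨x', y', hD, rfl, rfl⟩ | h3)
      · refine Or.inl ⟨Or.inl ⟨_, _, hD, rfl, rfl⟩, fun h3 => ?_⟩
        exact (Fin.castSucc_lt_last _).ne (congrArg Prod.fst h3.2)
      · exact Or.inr h3
    · rintro (⟨h3 | h3, h4⟩ | h3)
      · exact Or.inl h3
      · exact absurd h3 h4
      · exact Or.inr h3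
  have hsw' : (D.replaceArc h.channel _ hα).IsSwitch (D.replaceArc h.channel _ hα')
      (d, curlFirst) (d, curlSecond) := by
    refine ⟨hR.1, rfl, rfl, fun x y => ?_⟩
    simp only [replaceArc_above]
    constructor
    · rintro (h3 | ⟨h3, h4, h5, h6⟩)
      · exact Or.inl ⟨Or.inl h3, fun h4 =>
          (h.channel.fst_ne h3).1 (congrArg Prod.fst h4.1)⟩
      · exact Or.inr ⟨Prod.ext h3 h5, Prod.ext h4 h6⟩
    · rintro (⟨h3 | h3, h4⟩ | ⟨rfl, rfl⟩)
      · exact Or.inl h3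
      · exact absurd ⟨Prod.ext h3.1 h3.2.2.1, Prod.ext h3.2.1 h3.2.2.2⟩ h4
      · exact Or.inr ⟨rfl, rfl, rfl, rfl⟩
  have hsign := splitCurl_isPositive (D := D) (c := h.channel) (hα := hα) (h1 := h1) (h2 := h2)
    (x := splitFirst d) (y := splitSecond n) (r := curlFirst) (s := curlSecond)
    (cutTwiceProj_self _ _ _ _ _ _ _ _ _ _ _) (cutTwiceProj_last _ _ _ _ _ _ _ _ _ _ _)
  rw [← splitCircle_toSkein (h0 := hg.pos) (h1 := hg.lt_one)]
  -- One of the two curls is positive and equals `vInv` times `D`, the other is negative and equals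
  -- `v` times `D`. The skein relation always takes the positive minus the negative one, so both
  -- cases give the same value.
  rcases isPositive_or_isNegative _ hR.1 with hpos | hneg
  · rw [← (hsign.1 hpos).toSkein_switch hsw hsm, splitCurl_toSkein, splitCurl_toSkein,
      hpos.toSkein_curl hR, (hpos.isNegative_switch hsw').toSkein_curl hR', sub_smul]
  · rw [← (hsign.2 hneg).toSkein_switch hsw hsm, splitCurl_toSkein, splitCurl_toSkein,
      hneg.toSkein_curl hR, (hneg.isPositive_switch hsw').toSkein_curl hR', sub_smul]

end PieceDiagram

/-! ### Isotopies of the surface -/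

/-- The homeomorphism is isotopic to the identity, by an isotopy that fixes the boundary. -/
def IsIsotopicToId (h : F ≃ₜ F) : Prop :=
  ∃ H : I → F ≃ₜ F, Continuous (fun p : I × F => H p.1 p.2) ∧ (∀ x, H 0 x = x) ∧
    (∀ t x, ¬ IsInteriorPoint x → H t x = x) ∧ ∀ x, H 1 x = h x

theorem IsIsotopicToId.trans {g h : F ≃ₜ F} (hg : IsIsotopicToId g) (hh : IsIsotopicToId h) :
    IsIsotopicToId (g.trans h) := by
  obtain ⟨G, hGc, hG0, hGb, hG1⟩ := hg
  obtain ⟨H, hHc, hH0, hHb, hH1⟩ := hh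
  refine ⟨fun t => (G t).trans (H t), hHc.comp (continuous_fst.prodMk hGc), fun x => ?_,
    fun t x hx => ?_, fun x => ?_⟩
  · simp [hG0, hH0]
  · simp [hGb t x hx, hHb t x hx]
  · simp [hG1, hH1]

/-- A bump function on the plane. -/
noncomputable def bump (R : ℝ) (x : ℂ) : ℝ := max 0 (min 1 (2 - ‖x‖ / R))

theorem bump_nonneg (R : ℝ) (x : ℂ) : 0 ≤ bump R x := le_max_left _ _

theorem bump_le_one (R : ℝ) (x : ℂ) : bump R x ≤ 1 := max_le zero_le_one (min_le_left _ _)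

theorem bump_eq_one {R : ℝ} (hR : 0 < R) {x : ℂ} (hx : ‖x‖ ≤ R) : bump R x = 1 := by
  have : ‖x‖ / R ≤ 1 := (div_le_one hR).2 hx
  rw [bump, min_eq_left (by linarith), max_eq_right zero_le_one]

theorem bump_eq_zero {R : ℝ} (hR : 0 < R) {x : ℂ} (hx : 2 * R ≤ ‖x‖) : bump R x = 0 := by
  have : 2 ≤ ‖x‖ / R := (le_div_iff₀ hR).2 hx
  rw [bump, min_eq_right (by linarith), max_eq_left (by linarith)]

theorem continuous_bump (R : ℝ) : Continuous (bump R) := by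
  unfold bump; fun_prop

theorem abs_bump_sub_le {R : ℝ} (hR : 0 < R) (x y : ℂ) : |bump R x - bump R y| ≤ ‖x - y‖ / R := by
  have h1 : |bump R x - bump R y| ≤ |(2 - ‖x‖ / R) - (2 - ‖y‖ / R)| := by
    unfold bump
    refine (abs_max_sub_max_le_max _ _ _ _).trans (max_le (by simp) ?_)
    exact (abs_min_sub_min_le_max _ _ _ _).trans (max_le (by simp) le_rfl)
  refine h1.trans ?_
  rw [show (2 - ‖x‖ / R) - (2 - ‖y‖ / R) = (‖y‖ - ‖x‖) / R by ring, abs_div, abs_of_pos hR]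
  gcongr
  rw [abs_sub_comm]
  exact abs_norm_sub_norm_le x y

/-- By the product rule for differences, the linear part contributes 1/8 and the bump, of slope 1 /
R, contributes 5/16, because `a * y + b` is at most 5/16 R on the support. The sum 7/16 is below
1/2. -/
theorem norm_bump_sub_le {R : ℝ} (hR : 0 < R) {a b : ℂ} (ha : ‖a‖ ≤ 1 / 8) (hb : 16 * ‖b‖ ≤ R)
    (x y : ℂ) : ‖bump R x * (a * x + b) - bump R y * (a * y + b)‖ ≤ 1 / 2 * ‖x - y‖ := by
  have key : ∀ x y : ℂ, ‖y‖ ≤ 2 * R →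
      ‖bump R x * (a * x + b) - bump R y * (a * y + b)‖ ≤ 1 / 2 * ‖x - y‖ := by
    intro x y hy
    have h1 : bump R x * (a * x + b) - bump R y * (a * y + b) =
        bump R x * (a * (x - y)) + (((bump R x - bump R y : ℝ) : ℂ)) * (a * y + b) := by
      push_cast; ring
    rw [h1]
    refine (norm_add_le _ _).trans ?_
    rw [norm_mul, norm_mul, norm_mul, Complex.norm_real, Complex.norm_real, Real.norm_eq_abs,
      Real.norm_eq_abs, abs_of_nonneg (bump_nonneg R x)]
    have h2 : bump R x * (‖a‖ * ‖x - y‖) ≤ 1 * (1 / 8 * ‖x - y‖) := by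
      gcongr
      exact bump_le_one R x
    have h3 : ‖a * y + b‖ ≤ 5 / 16 * R := by
      refine (norm_add_le _ _).trans ?_
      rw [norm_mul]
      have : ‖a‖ * ‖y‖ ≤ 1 / 8 * (2 * R) := by gcongr
      linarith
    have h4 : |bump R x - bump R y| * ‖a * y + b‖ ≤ ‖x - y‖ / R * (5 / 16 * R) := by
      gcongr
      exact abs_bump_sub_le hR x y
    have h5 : ‖x - y‖ / R * (5 / 16 * R) = 5 / 16 * ‖x - y‖ := by field_simp
    have := norm_nonneg (x - y)
    linarith
  rcases le_total ‖y‖ (2 * R) with hy | hy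
  · exact key x y hy
  rcases le_total ‖x‖ (2 * R) with hx | hx
  · rw [norm_sub_rev, norm_sub_rev x y]; exact key y x hx
  · rw [bump_eq_zero hR hx, bump_eq_zero hR hy]; simp

/-- Cut off the displacement `a * x + b` by a bump function so wide that the result is a
contraction. The identity plus a multiple, by a factor in `I`, of such a displacement is a
homeomorphism of the plane. -/
theorem exists_plane_isotopy {a b : ℂ} (ha : ‖a‖ ≤ 1 / 8) (R : ℝ) : ∃ G : I → ℂ ≃ₜ ℂ,
    Continuous (fun p : I × ℂ => G p.1 p.2) ∧ (∀ x, G 0 x = x) ∧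
    (∃ r, ∀ t x, r ≤ ‖x‖ → G t x = x) ∧ ∀ x, ‖x‖ ≤ R → G 1 x = x + (a * x + b) := by
  obtain ⟨Q, hQ, hQR, hQb⟩ : ∃ Q : ℝ, 0 < Q ∧ R ≤ Q ∧ 16 * ‖b‖ ≤ Q :=
    ⟨max 1 (max R (16 * ‖b‖)), by positivity, by simp, by simp⟩
  have happ : ∀ t : I, ApproximatesLinearOn (fun x : ℂ => x + t * (bump Q x * (a * x + b)))
      (ContinuousLinearEquiv.refl ℂ ℂ : ℂ →L[ℂ] ℂ) Set.univ (1 / 2) := by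
    intro t x _ y _
    have h1 : (x + t * (bump Q x * (a * x + b)) - (y + t * (bump Q y * (a * y + b))) -
        (ContinuousLinearEquiv.refl ℂ ℂ : ℂ →L[ℂ] ℂ) (x - y)) =
        t * (bump Q x * (a * x + b) - bump Q y * (a * y + b)) := by
      simp; ring
    have ht : ‖((t : ℝ) : ℂ)‖ ≤ 1 := by
      rw [Complex.norm_real, Real.norm_eq_abs, abs_of_nonneg t.2.1]; exact t.2.2
    rw [h1, norm_mul]
    calc _ ≤ 1 * (1 / 2 * ‖x - y‖) := by
          gcongr
          exact norm_bump_sub_le hQ ha hQb x y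
      _ = _ := by simp
  have hc : Subsingleton ℂ ∨ (1 / 2 : NNReal) <
      ‖((ContinuousLinearEquiv.refl ℂ ℂ).symm : ℂ →L[ℂ] ℂ)‖₊⁻¹ := by
    right
    have : ‖((ContinuousLinearEquiv.refl ℂ ℂ).symm : ℂ →L[ℂ] ℂ)‖₊ = 1 :=
      ContinuousLinearMap.nnnorm_id
    rw [this, inv_one]
    exact NNReal.half_lt_self one_ne_zero
  have hG : ∀ t x, (happ t).toHomeomorph _ hc x = x + t * (bump Q x * (a * x + b)) :=
    fun t x => rfl
  refine ⟨fun t => (happ t).toHomeomorph _ hc, ?_, fun x => ?_, ⟨2 * Q, fun t x hx => ?_⟩,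
    fun x hx => ?_⟩
  · simp only [hG]
    have := continuous_bump Q
    fun_prop
  · exact (hG _ _).trans (by simp)
  · exact (hG _ _).trans (by simp [bump_eq_zero hQ hx])
  · exact (hG _ _).trans (by simp [bump_eq_one hQ (hx.trans hQR)])

section extend

variable {φ : ℂ → F}

/-- The image of the closed ball of radius `r` is compact, hence closed as `F` is Hausdorff. Its
complement, where the extension is the identity, and the open image of the chart cover the surface.
-/
theorem continuous_extend [T2Space F] {T : Type*} [TopologicalSpace T] (hφ : IsOpenEmbedding φ)
    {G : T → ℂ → ℂ} (hG : Continuous fun p : T × ℂ => G p.1 p.2) {r : ℝ}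
    (hr : ∀ t x, r ≤ ‖x‖ → G t x = x) :
    Continuous fun p : T × F => Function.extend φ (φ ∘ G p.1) id p.2 := by
  rw [continuous_iff_continuousAt]
  rintro ⟨t, x⟩
  by_cases hx : x ∈ Set.range φ
  · obtain ⟨w, rfl⟩ := hx
    have h := (IsOpenEmbedding.id (X := T)).prodMap hφ
    refine (h.continuousAt_iff (x := (t, w))).1 ?_
    have : (fun p : T × F => Function.extend φ (φ ∘ G p.1) id p.2) ∘ Prod.map id φ =
        fun p => φ (G p.1 p.2) := by
      ext p
      simp [hφ.injective.extend_apply]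
    rw [this]
    exact (hφ.continuous.comp hG).continuousAt
  · have hK : IsClosed (φ '' Metric.closedBall 0 r) :=
      ((isCompact_closedBall 0 r).image hφ.continuous).isClosed
    have hmem : (t, x) ∈ {p : T × F | p.2 ∉ φ '' Metric.closedBall 0 r} := fun h =>
      hx (Set.image_subset_range _ _ h)
    refine (continuousAt_snd (p := (t, x))).congr ?_
    filter_upwards [(hK.isOpen_compl.preimage continuous_snd).mem_nhds hmem] with p hp
    by_cases h : p.2 ∈ Set.range φ
    · obtain ⟨w, hw⟩ := h
      have : r ≤ ‖w‖ := by
        by_contra hlt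
        exact hp ⟨w, by simpa using (not_le.1 hlt).le, hw⟩
      rw [← hw, hφ.injective.extend_apply, Function.comp, hr _ _ this]
    · rw [Function.extend_apply' _ _ _ h]; rfl

/-- A homeomorphism of the plane with compact support, extended by the identity. -/
noncomputable def extendHomeo [T2Space F] (hφ : IsOpenEmbedding φ) (g : ℂ ≃ₜ ℂ) {r : ℝ}
    (hr : ∀ x, r ≤ ‖x‖ → g x = x) : F ≃ₜ F where
  toFun := Function.extend φ (φ ∘ g) id
  invFun := Function.extend φ (φ ∘ g.symm) id
  left_inv x := by
    by_cases h : x ∈ Set.range φ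
    · obtain ⟨w, rfl⟩ := h
      simp [hφ.injective.extend_apply]
    · rw [Function.extend_apply' _ _ _ h, id, Function.extend_apply' _ _ _ h, id]
  right_inv x := by
    by_cases h : x ∈ Set.range φ
    · obtain ⟨w, rfl⟩ := h
      simp [hφ.injective.extend_apply]
    · rw [Function.extend_apply' _ _ _ h, id, Function.extend_apply' _ _ _ h, id]
  continuous_toFun := (continuous_extend (T := Unit) hφ (G := fun _ => g)
    (g.continuous.comp continuous_snd) fun _ => hr).comp (continuous_const (y := ()).prodMk
      continuous_id)
  continuous_invFun := (continuous_extend (T := Unit) hφ (G := fun _ => g.symm)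
    (g.symm.continuous.comp continuous_snd) fun _ x hx =>
      (g.symm_apply_eq).2 (hr x hx).symm).comp (continuous_const (y := ()).prodMk continuous_id)

/-- Isotopies can realise the affine map `x ↦ a * x + b` on any bounded part of a chart. -/
def Realises (φ : ℂ → F) (a b : ℂ) : Prop :=
  ∀ R : ℝ, ∃ h : F ≃ₜ F, IsIsotopicToId h ∧ ∀ x, ‖x‖ ≤ R → h (φ x) = φ (a * x + b)

theorem realises_of_near [T2Space F] (hφ : IsOpenEmbedding φ) {a b : ℂ} (ha : ‖a - 1‖ ≤ 1 / 8) :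
    Realises φ a b := by
  intro R
  obtain ⟨G, hGc, hG0, ⟨r, hr⟩, hG1⟩ := exists_plane_isotopy (b := b) ha R
  refine ⟨extendHomeo hφ (G 1) (hr 1), ⟨fun t => extendHomeo hφ (G t) (hr t), ?_, fun x => ?_,
    fun t x hx => ?_, fun x => rfl⟩, fun x hx => ?_⟩
  · exact continuous_extend hφ hGc hr
  · by_cases h : x ∈ Set.range φ
    · obtain ⟨w, rfl⟩ := h
      exact (hφ.injective.extend_apply _ _ _).trans (congrArg φ (hG0 w))
    · exact Function.extend_apply' _ _ _ h
  · exact Function.extend_apply' _ _ _ fun h => hx ⟨φ, hφ, h⟩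
  · refine (hφ.injective.extend_apply _ _ _).trans (congrArg φ ((hG1 x hx).trans ?_))
    ring

theorem Realises.comp {a b a' b' : ℂ} (h : Realises φ a b) (h' : Realises φ a' b') :
    Realises φ (a' * a) (a' * b + b') := by
  intro R
  obtain ⟨g, hg, hgR⟩ := h R
  obtain ⟨g', hg', hgR'⟩ := h' (‖a‖ * R + ‖b‖)
  refine ⟨g.trans g', hg.trans hg', fun x hx => ?_⟩
  rw [Homeomorph.trans_apply, hgR x hx, hgR']
  · congr 1; ring
  · refine (norm_add_le _ _).trans ?_
    rw [norm_mul]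
    gcongr

/-- A factor `a` far from 1 is the N-th power of `Complex.exp (Complex.log a / N)`, which is near 1
for large N; so N small isotopies and a translation are composed. -/
theorem realises [T2Space F] (hφ : IsOpenEmbedding φ) {a : ℂ} (ha : a ≠ 0) (b : ℂ) :
    Realises φ a b := by
  have hlim : Filter.Tendsto (fun N : ℕ => Complex.exp (Complex.log a / N)) Filter.atTop (𝓝 1) := by
    rw [← Complex.exp_zero]
    exact (Complex.continuous_exp.tendsto 0).comp
      (tendsto_const_div_atTop_nhds_zero_nat (Complex.log a))
  obtain ⟨N, hN, hN0⟩ := ((Metric.tendsto_nhds.1 hlim (1 / 8) (by norm_num)).and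
    (Filter.eventually_ne_atTop 0)).exists
  rw [dist_eq_norm] at hN
  have hpow : ∀ k : ℕ, Realises φ (Complex.exp (Complex.log a / N) ^ k) 0 := by
    intro k
    induction k with
    | zero => exact realises_of_near hφ (by simp)
    | succ k ih =>
      have := ih.comp (realises_of_near hφ (b := 0) hN.le)
      simpa [pow_succ'] using this
  have h := (hpow N).comp (realises_of_near hφ (a := 1) (b := b) (by simp))
  rwa [← Complex.exp_nat_mul, mul_div_cancel₀ _ (Nat.cast_ne_zero.2 hN0), Complex.exp_log ha,
    one_mul, mul_zero, zero_add] at h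

end extend

/-! ### Moving any interior point to any other -/

/-- The plane as the open upper half-plane. -/
noncomputable def upperChart (w : ℂ) : {w : ℂ // 0 ≤ w.im} :=
  ⟨⟨w.re, Real.exp w.im⟩, (Real.exp_pos _).le⟩

theorem isOpenEmbedding_upperChart : IsOpenEmbedding upperChart := by
  have h : IsOpenEmbedding (Subtype.val ∘ upperChart) := by
    have h1 : IsOpenEmbedding (Subtype.val : Set.Ioi (0 : ℝ) → ℝ) :=
      isOpen_Ioi.isOpenEmbedding_subtypeVal
    have h2 := Complex.equivRealProdCLM.symm.toHomeomorph.isOpenEmbedding.comp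
      ((((IsOpenEmbedding.id (X := ℝ)).prodMap
        (h1.comp Real.expOrderIso.toHomeomorph.isOpenEmbedding))).comp
        Complex.equivRealProdCLM.toHomeomorph.isOpenEmbedding)
    convert h2 using 1
    ext1 w
    apply Complex.ext <;> simp [upperChart]
  have hc : Continuous upperChart := by
    refine Continuous.subtype_mk ?_ _
    exact h.continuous
  refine ⟨IsEmbedding.of_comp hc continuous_subtype_val h.isEmbedding, ?_⟩
  have : Set.range upperChart = Subtype.val ⁻¹' (Set.range (Subtype.val ∘ upperChart)) := by
    rw [Set.range_comp, Set.preimage_image_eq _ Subtype.val_injective]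
  rw [this]
  exact h.isOpen_range.preimage continuous_subtype_val

theorem mem_range_upperChart {w : {w : ℂ // 0 ≤ w.im}} (h : 0 < (w : ℂ).im) :
    w ∈ Set.range upperChart :=
  ⟨⟨(w : ℂ).re, Real.log (w : ℂ).im⟩, Subtype.ext (Complex.ext rfl (Real.exp_log h))⟩

/-- An isotopy takes one point to the other. -/
def Reaches (x y : F) : Prop := ∃ h : F ≃ₜ F, IsIsotopicToId h ∧ h x = y

theorem Reaches.trans {x y w : F} (h : Reaches x y) (h' : Reaches y w) : Reaches x w := by
  obtain ⟨g, hg, rfl⟩ := h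
  obtain ⟨g', hg', rfl⟩ := h'
  exact ⟨g.trans g', hg.trans hg', rfl⟩

theorem reaches_of_chart [T2Space F] {φ : ℂ → F} (hφ : IsOpenEmbedding φ) (x y : ℂ) :
    Reaches (φ x) (φ y) := by
  obtain ⟨h, hh, hx⟩ := realises hφ one_ne_zero (y - x) ‖x‖
  exact ⟨h, hh, (hx x le_rfl).trans (by simp)⟩

/-- Every point of the surface has a neighbourhood in which any two interior points can be moved to
each other. -/
theorem exists_nhds_reaches (S : MarkedSurface F) (x : F) : ∃ U : Set F, IsOpen U ∧ x ∈ U ∧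
    ∀ y ∈ U, ∀ w ∈ U, IsInteriorPoint y → IsInteriorPoint w → Reaches y w := by
  have := S.t2
  rcases S.chart x with ⟨φ, hφ, hx⟩ | ⟨φ, hφ, hx⟩
  · refine ⟨Set.range φ, hφ.isOpen_range, hx, ?_⟩
    rintro _ ⟨y, rfl⟩ _ ⟨w, rfl⟩ - -
    exact reaches_of_chart hφ y w
  · refine ⟨Set.range φ, hφ.isOpen_range, ⟨_, hx⟩, ?_⟩
    have hup := hφ.comp isOpenEmbedding_upperChart
    -- An interior point is first moved, inside a disc `ψ` around it, to a point in the open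
    -- half-plane. Whether an interior point could lie on the edge of the half-plane need not be
    -- decided.
    have key : ∀ y ∈ Set.range φ, IsInteriorPoint y → ∃ w, Reaches y (φ (upperChart w)) ∧
        Reaches (φ (upperChart w)) y := by
      rintro _ ⟨y, rfl⟩ ⟨ψ, hψ, hy⟩
      have hopen : IsOpen (φ ⁻¹' Set.range ψ) := hψ.isOpen_range.preimage hφ.continuous
      obtain ⟨w, hw, hw'⟩ : ∃ w, w ∈ φ ⁻¹' Set.range ψ ∧ 0 < (w : ℂ).im := by
        -- The absolute value keeps the formula inside the half-plane for every real `t`.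
        have hlim : Filter.Tendsto (fun t : ℝ => (⟨(y : ℂ) + (|t| : ℝ) * Complex.I, by
            simpa using add_nonneg y.2 (abs_nonneg t)⟩ : {w : ℂ // 0 ≤ w.im})) (𝓝[>] 0) (𝓝 y) := by
          refine tendsto_nhdsWithin_of_tendsto_nhds ?_
          have : Continuous (fun t : ℝ => (⟨(y : ℂ) + (|t| : ℝ) * Complex.I, by
            simpa using add_nonneg y.2 (abs_nonneg t)⟩ : {w : ℂ // 0 ≤ w.im})) := by
            fun_prop
          convert this.tendsto 0 using 2
          exact Subtype.ext (by simp)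
        obtain ⟨t, ht, ht0⟩ := ((hlim.eventually (hopen.mem_nhds hy)).and
          self_mem_nhdsWithin).exists
        refine ⟨_, ht, ?_⟩
        have : 0 < |t| := abs_pos.2 (ne_of_gt ht0)
        simpa using add_pos_of_nonneg_of_pos y.2 this
      obtain ⟨w, rfl⟩ := mem_range_upperChart hw'
      obtain ⟨a, ha⟩ := hy
      obtain ⟨b, hb⟩ := hw
      refine ⟨w, ?_, ?_⟩
      · rw [← ha, ← hb]; exact reaches_of_chart hψ a b
      · rw [← ha, ← hb]; exact reaches_of_chart hψ b a
    intro y hy w hw hyi hwi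
    obtain ⟨a, ha, -⟩ := key y hy hyi
    obtain ⟨b, -, hb⟩ := key w hw hwi
    exact ha.trans ((reaches_of_chart hup a b).trans hb)

theorem exists_interior (S : MarkedSurface F) {U : Set F} (hU : IsOpen U) {x : F} (hx : x ∈ U) :
    ∃ y ∈ U, IsInteriorPoint y := by
  rcases S.chart x with h | ⟨φ, hφ, rfl⟩
  · exact ⟨x, hx, h⟩
  · have hopen : IsOpen (φ ⁻¹' U) := hU.preimage hφ.continuous
    have hc : Continuous (fun t : ℝ => (⟨(|t| : ℝ) * Complex.I, by
        simp⟩ : {w : ℂ // 0 ≤ w.im})) := by fun_prop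
    have h0 : (0 : ℝ) ∈ (fun t : ℝ => (⟨(|t| : ℝ) * Complex.I, by
        simp⟩ : {w : ℂ // 0 ≤ w.im})) ⁻¹' (φ ⁻¹' U) := by
      simpa using hx
    obtain ⟨t, ht, ht0⟩ := (𝓝[>] (0 : ℝ)).nonempty_of_mem (Filter.inter_mem
      (mem_nhdsWithin_of_mem_nhds ((hopen.preimage hc).mem_nhds h0)) self_mem_nhdsWithin)
    obtain ⟨w, hw⟩ := mem_range_upperChart (w := ⟨(|t| : ℝ) * Complex.I, by simp⟩)
      (by simpa using ne_of_gt ht0)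
    refine ⟨_, ht, φ ∘ upperChart, hφ.comp isOpenEmbedding_upperChart, w, congrArg φ hw⟩

/-- Any two interior points of a surface can be moved to each other. -/
theorem reaches (S : MarkedSurface F) {x y : F} (hx : IsInteriorPoint x) (hy : IsInteriorPoint y) :
    Reaches x y := by
  have := S.connected
  -- Connectedness is known only for the whole surface. Speaking of the interior points near `w`
  -- makes the condition meaningful also at boundary points, and open by its form.
  let T : Set F := {w | ∀ᶠ y in 𝓝 w, IsInteriorPoint y → Reaches x y}
  have hTopen : IsOpen T := isOpen_iff_mem_nhds.2 fun w hw => eventually_eventually_nhds.2 hw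
  have hTclosed : IsClosed T := by
    refine ⟨isOpen_iff_mem_nhds.2 fun w hw => ?_⟩
    obtain ⟨U, hU, hwU, hreach⟩ := exists_nhds_reaches S w
    refine Filter.mem_of_superset (hU.mem_nhds hwU) fun w' hw' hT => hw ?_
    obtain ⟨V, hV, hVo, hwV⟩ := eventually_nhds_iff.1 hT
    obtain ⟨y, ⟨hyU, hyV⟩, hyi⟩ := exists_interior S (hU.inter hVo) ⟨hw', hwV⟩
    filter_upwards [hU.mem_nhds hwU] with q hq hqi
    exact (hV y hyV hyi).trans (hreach y hyU q hq hyi hqi)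
  have hxT : x ∈ T := by
    obtain ⟨U, hU, hxU, hreach⟩ := exists_nhds_reaches S x
    filter_upwards [hU.mem_nhds hxU] with q hq hqi
    exact hreach x hxU q hq hx hqi
  have huniv : T = Set.univ := IsClopen.eq_univ ⟨hTclosed, hTopen⟩ ⟨x, hxT⟩
  have hyT : y ∈ T := huniv ▸ Set.mem_univ y
  exact hyT.self_of_nhds hy

theorem FlatAt.homeo {γ : I → F} {t : I} (h : FlatAt γ t) (g : F ≃ₜ F) : FlatAt (g ∘ γ) t := by
  obtain ⟨φ, hφ, h1, h2, h3⟩ := h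
  refine ⟨g ∘ φ, g.isOpenEmbedding.comp hφ, congrArg g h1, h2.mono fun s hs => ?_,
    h3.mono fun s hs => ?_⟩
  · rw [Set.image_comp]; exact Set.mem_image_of_mem g hs
  · rw [Set.image_comp]; exact Set.mem_image_of_mem g hs

/-- The image of a curve under a homeomorphism. -/
def moved (g : F ≃ₜ F) (κ : C(I, F)) : C(I, F) := ⟨g ∘ κ, g.continuous.comp κ.continuous⟩

@[simp]
theorem moved_apply (g : F ≃ₜ F) (κ : C(I, F)) (t : I) : moved g κ t = g (κ t) := rfl

theorem IsLoop.moved {κ : C(I, F)} (hκ : IsLoop κ) (g : F ≃ₜ F) : IsLoop (moved g κ) where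
  closed := congrArg g hκ.closed
  inj s t h := hκ.inj s t (g.injective h)
  interior t := by
    obtain ⟨φ, hφ, w, hw⟩ := hκ.interior t
    exact ⟨g ∘ φ, g.isOpenEmbedding.comp hφ, w, congrArg g hw⟩
  flat := hκ.flat.subset fun _ ht h => ht (h.homeo g)

/-- A closed curve without crossings may be moved by an isotopy of the surface. -/
theorem PieceDiagram.toSkein_addCircle_moved (D : PieceDiagram S n) {κ : C(I, F)} (hκ : IsLoop κ)
    (hd : ∀ e t s, D.path e t ≠ κ s) {g : F ≃ₜ F} (hg : IsIsotopicToId g)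
    (hd' : ∀ e t s, D.path e t ≠ moved g κ s) :
    toSkein ⟨n + 1, D.addCircle (moved g κ) (hκ.moved g) hd'⟩ =
      toSkein ⟨n + 1, D.addCircle κ hκ hd⟩ := by
  obtain ⟨H, hHc, hH0, hHb, hH1⟩ := hg
  suffices h : (D.addCircle κ hκ hd).LayerIsotopic (D.addCircle (moved g κ) (hκ.moved g) hd') from
    (IsotopyStep.toSkein_eq (.layer h)).symm
  -- Only the circle moves. It has no crossings before or after, so it counts as lying above all
  -- other pieces, whatever it passes over in between.
  refine ⟨rfl, {Fin.last n}, H, hHc, hH0, hHb, ?_, ?_, ?_, ?_, ?_⟩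
  · intro e f hef hne
    exfalso
    rw [addCircle_next] at hef
    induction e using Fin.lastCases with
    | last =>
      rw [liftNext_last] at hef
      rw [← Sum.inr.inj hef] at hne
      exact hne Iff.rfl
    | cast e =>
      rw [liftNext_castSucc] at hef
      induction f using Fin.lastCases with
      | last => exact map_ne_inr_last hef
      | cast f => simp [(Fin.castSucc_lt_last _).ne] at hne
  · rintro e he t
    rw [Set.mem_singleton_iff] at he
    subst he
    simp [hH1]
  · intro e he
    induction e using Fin.lastCases with
    | last => exact absurd rfl he
    | cast e => simp
  · intro x y _
    rw [addCircle_above, addCircle_above]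
  · intro x y _ hy
    exact ⟨addCircle_not_above_last (Or.inr hy), addCircle_not_above_last (Or.inr hy)⟩

/-! ### A round circle through the ends of the loop of the curl -/

/-- A simple parametrisation of the unit circle, starting at `1`. -/
structure IsUnitLoop (w : C(I, ℂ)) : Prop where
  zero : w 0 = 1
  one : w 1 = 1
  norm : ∀ t, ‖w t‖ = 1
  inj : ∀ s t, w s = w t → s = t ∨ (s = 1 ∧ t = 0) ∨ (t = 1 ∧ s = 0)
  surj : ∀ x, ‖x‖ = 1 → ∃ t, w t = x

/-- The mirror image of a curve in the plane. -/
noncomputable def mirror (w : C(I, ℂ)) : C(I, ℂ) :=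
  ⟨fun t => starRingEnd ℂ (w t), Complex.continuous_conj.comp w.continuous⟩

@[simp]
theorem mirror_apply (w : C(I, ℂ)) (t : I) : mirror w t = starRingEnd ℂ (w t) := rfl

theorem IsUnitLoop.mirror {w : C(I, ℂ)} (hw : IsUnitLoop w) : IsUnitLoop (mirror w) where
  zero := by simp [hw.zero]
  one := by simp [hw.one]
  norm t := by simp [hw.norm]
  inj s t h := hw.inj s t ((starRingEnd ℂ).injective h)
  surj x hx := by
    obtain ⟨t, ht⟩ := hw.surj (starRingEnd ℂ x) (by simpa using hx)
    exact ⟨t, by simp [ht]⟩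

/-- The circle about `i` through the ends of the loop of the standard curl. -/
noncomputable def ring (w : C(I, ℂ)) : C(I, ℂ) :=
  ⟨fun t => Complex.I + (loopStart - Complex.I) * w t, by fun_prop⟩

theorem ring_apply (w : C(I, ℂ)) (t : I) :
    ring w t = Complex.I + (loopStart - Complex.I) * w t := rfl

theorem loopStart_sub_ne : loopStart - Complex.I ≠ 0 := fun h => by
  have := congrArg Complex.re h; norm_num [loopStart] at this

section ring

variable {w : C(I, ℂ)}

theorem normSq_eq {x : ℂ} (hx : ‖x‖ = 1) : x.re ^ 2 + x.im ^ 2 = 1 := by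
  have := Complex.sq_norm x
  rw [hx, Complex.normSq_apply] at this
  linarith

theorem ring_re (w : C(I, ℂ)) (t : I) : (ring w t).re = 3 / 5 * (w t).re + 1 / 5 * (w t).im := by
  simp [ring_apply, loopStart]; norm_num

theorem ring_im (w : C(I, ℂ)) (t : I) : (ring w t).im = 1 + 3 / 5 * (w t).im - 1 / 5 * (w t).re := by
  simp [ring_apply, loopStart]; norm_num; ring

theorem ring_eq (hw : IsUnitLoop w) (t : I) : (ring w t).re ^ 2 + ((ring w t).im - 1) ^ 2 = 2 / 5 := by
  have := normSq_eq (hw.norm t)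
  rw [ring_re, ring_im]
  linear_combination 2 / 5 * this

/-- With real part x and imaginary part y, x² + y²/4 equals 11/15 - 3/4 (y - 4/3)² on this circle.
-/
theorem ring_mem_ellipse (hw : IsUnitLoop w) (t : I) : ring w t ∈ ellipse := by
  have := ring_eq hw t
  simp only [ellipse, Set.mem_ofPred_eq]
  nlinarith [sq_nonneg ((ring w t).im - 4 / 3)]

theorem ring_im_pos (hw : IsUnitLoop w) (t : I) : 0 < (ring w t).im := by
  have := ring_eq hw t
  nlinarith [sq_nonneg (ring w t).re]

theorem ring_zero (hw : IsUnitLoop w) : ring w 0 = loopStart := by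
  rw [ring_apply, hw.zero]; ring

theorem ring_one (hw : IsUnitLoop w) : ring w 1 = loopStart := by
  rw [ring_apply, hw.one]; ring

theorem ring_inj (hw : IsUnitLoop w) {s t : I} (h : ring w s = ring w t) :
    s = t ∨ (s = 1 ∧ t = 0) ∨ (t = 1 ∧ s = 0) := by
  refine hw.inj s t ?_
  simpa [ring_apply, loopStart_sub_ne] using h

theorem ring_surj (hw : IsUnitLoop w) {x : ℂ} (hx : x.re ^ 2 + (x.im - 1) ^ 2 = 2 / 5) :
    ∃ t, ring w t = x := by
  obtain ⟨t, ht⟩ := hw.surj ((x - Complex.I) / (loopStart - Complex.I)) (by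
    rw [norm_div, div_eq_one_iff_eq (norm_ne_zero_iff.2 loopStart_sub_ne),
      ← sq_eq_sq₀ (norm_nonneg _) (norm_nonneg _), Complex.sq_norm, Complex.sq_norm,
      Complex.normSq_apply, Complex.normSq_apply]
    simp only [Complex.sub_re, Complex.sub_im, Complex.I_re, Complex.I_im, loopStart]
    linarith)
  refine ⟨t, ?_⟩
  rw [ring_apply, ht, mul_div_cancel₀ _ loopStart_sub_ne]
  ring

/-- The line of height 4/5 meets the circle only in `loopStart` and `loopEnd`. -/
theorem ring_im_ne (hw : IsUnitLoop w) {t r : I} (hr : ring w r = loopEnd) (h0 : 0 < t) (h1 : t < 1)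
    (htr : t ≠ r) : (ring w t).im ≠ 4 / 5 := by
  intro h
  have := ring_eq hw t
  rw [h] at this
  have h2 : ((ring w t).re - 3 / 5) * ((ring w t).re + 3 / 5) = 0 := by linarith
  rcases mul_eq_zero.1 h2 with h3 | h3
  · have : ring w t = ring w 0 := by
      rw [ring_zero hw]
      exact Complex.ext (sub_eq_zero.1 h3) h
    rcases ring_inj hw this with h4 | h4 | h4
    · exact h0.ne' h4
    · exact h1.ne h4.1
    · exact h0.ne' h4.2
  · have : ring w t = ring w r := by
      rw [hr]
      exact Complex.ext (by simp only [loopEnd]; linarith) h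
    rcases ring_inj hw this with h4 | h4 | h4
    · exact htr h4
    · exact h1.ne h4.1
    · exact h0.ne' h4.2

theorem forall_lt_or_forall_gt {f : I → ℝ} (hf : Continuous f) {a b : I} {c : ℝ}
    (h : ∀ t ∈ Set.Ioo a b, f t ≠ c) :
    (∀ t ∈ Set.Ioo a b, c < f t) ∨ (∀ t ∈ Set.Ioo a b, f t < c) := by
  by_contra! hcon
  obtain ⟨⟨s, hs, hsc⟩, t, ht, htc⟩ := hcon
  obtain ⟨r, hr, hrc⟩ := isPreconnected_Ioo.intermediate_value hs ht hf.continuousOn ⟨hsc, htc⟩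
  exact h r hr hrc

/-- The circle is divided by the ends of the loop into an upper and a lower arc. -/
theorem exists_ring_arcs (hw : IsUnitLoop w) : ∃ r, 0 < r ∧ r < 1 ∧ ring w r = loopEnd ∧
    (((∀ t ∈ Set.Ioo 0 r, 4 / 5 < (ring w t).im) ∧ ∀ t ∈ Set.Ioo r 1, (ring w t).im < 4 / 5) ∨
      ∀ t ∈ Set.Ioo 0 r, (ring w t).im < 4 / 5) := by
  obtain ⟨r, hr⟩ := ring_surj hw (x := loopEnd) (by norm_num [loopEnd])
  have hr0 : 0 < r := unitInterval.pos_iff_ne_zero.2 (by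
    rintro rfl; exact PieceDiagram.loopStart_ne_loopEnd ((ring_zero hw).symm.trans hr))
  have hr1 : r < 1 := unitInterval.lt_one_iff_ne_one.2 (by
    rintro rfl; exact PieceDiagram.loopStart_ne_loopEnd ((ring_one hw).symm.trans hr))
  refine ⟨r, hr0, hr1, hr, ?_⟩
  have hc : Continuous fun t => (ring w t).im := Complex.continuous_im.comp (ring w).continuous
  have hsq : √(2 / 5) ^ 2 = 2 / 5 := Real.sq_sqrt (by norm_num)
  -- The lowest point of the circle shows that not both arcs are upper arcs.
  have hlow : ∃ t, (ring w t).im < 4 / 5 := by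
    obtain ⟨t, ht⟩ := ring_surj hw (x := ⟨0, 1 - √(2 / 5)⟩) (by simp only; linarith)
    refine ⟨t, ?_⟩
    rw [ht]
    nlinarith [Real.sqrt_nonneg (2 / 5)]
  obtain ⟨t, ht⟩ := hlow
  rcases forall_lt_or_forall_gt hc (a := 0) (b := r) (c := 4 / 5) fun t ht' =>
    ring_im_ne hw hr ht'.1 (ht'.2.trans hr1) ht'.2.ne with h | h
  · refine Or.inl ⟨h, ?_⟩
    rcases forall_lt_or_forall_gt hc (a := r) (b := 1) (c := 4 / 5) fun t ht' =>
      ring_im_ne hw hr (hr0.trans ht'.1) ht'.2 ht'.1.ne' with h' | h'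
    · exfalso
      rcases lt_trichotomy t r with htr | rfl | htr
      · by_cases ht0 : t = 0
        · rw [ht0, ring_zero hw] at ht; norm_num [loopStart] at ht
        · exact (h t ⟨unitInterval.pos_iff_ne_zero.2 ht0, htr⟩).not_gt ht
      · rw [hr] at ht; norm_num [loopEnd] at ht
      · by_cases ht1 : t = 1
        · rw [ht1, ring_one hw] at ht; norm_num [loopStart] at ht
        · exact (h' t ⟨htr, unitInterval.lt_one_iff_ne_one.2 ht1⟩).not_gt ht
    · exact h'
  · exact Or.inr h

theorem isGoodLoop_ring (hw : IsUnitLoop w) {r : I} (hr0 : 0 < r) (hr1 : r < 1)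
    (hr : ring w r = loopEnd) (h : ∀ t ∈ Set.Ioo 0 r, 4 / 5 < (ring w t).im)
    (h' : ∀ t ∈ Set.Ioo r 1, (ring w t).im < 4 / 5) : IsGoodLoop (ring w) r := by
  have hle : ∀ s, s ≤ r → 4 / 5 ≤ (ring w s).im := by
    intro s hs
    rcases eq_or_ne s 0 with rfl | hs0
    · rw [ring_zero hw]; norm_num [loopStart]
    rcases eq_or_lt_of_le hs with rfl | hs1
    · rw [hr]; norm_num [loopEnd]
    · exact (h s ⟨unitInterval.pos_iff_ne_zero.2 hs0, hs1⟩).le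
  -- On the circle the squared norm is 2y - 3/5, where y is the imaginary part.
  have hball : ∀ s, ring w s ∈ Metric.ball (0 : ℂ) 1 ↔ (ring w s).im < 4 / 5 := by
    intro s
    have := ring_eq hw s
    rw [mem_ball_zero_iff, ← sq_lt_one_iff₀ (norm_nonneg _), Complex.sq_norm, Complex.normSq_apply]
    constructor <;> intro h <;> nlinarith
  refine ⟨hr0, hr1, ring_zero hw, ring_one hw, hr, ring_mem_ellipse hw, hle, fun s hs hmem => ?_,
    fun s hs hs1 => (hball s).2 (h' s ⟨hs, hs1⟩)⟩
  exact (hle s hs).not_gt ((hball s).1 hmem)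

/-- The circle, or else its mirror image, runs through the upper arc first. -/
theorem exists_isGoodLoop (hw : IsUnitLoop w) :
    (∃ r, IsGoodLoop (ring w) r) ∨ ∃ r, IsGoodLoop (ring (mirror w)) r := by
  obtain ⟨r, hr0, hr1, hr, ⟨h, h'⟩ | h⟩ := exists_ring_arcs hw
  · exact Or.inl ⟨r, isGoodLoop_ring hw hr0 hr1 hr h h'⟩
  obtain ⟨r', hr0', hr1', hr', ⟨g, g'⟩ | g⟩ := exists_ring_arcs hw.mirror
  · exact Or.inr ⟨r', isGoodLoop_ring hw.mirror hr0' hr1' hr' g g'⟩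
  exfalso
  -- If both circles started downwards, adding the two inequalities at a common small parameter
  -- would give a real part of `w t` greater than 1.
  obtain ⟨t, ht0, ht⟩ := exists_between (lt_min hr0 hr0')
  have h1 := h t ⟨ht0, ht.trans_le (min_le_left _ _)⟩
  have h2 := g t ⟨ht0, ht.trans_le (min_le_right _ _)⟩
  rw [ring_im] at h1 h2
  simp only [mirror_apply, Complex.conj_re, Complex.conj_im] at h2
  have h3 := normSq_eq (hw.norm t)
  nlinarith [sq_nonneg (w t).im]

end ring

/-! ### Circles in a disc through which a piece runs straight -/

namespace PieceDiagram

theorem image_comp_conj {F : Type u} (φ : ℂ → F) {A : Set ℂ}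
    (hA : ∀ w, starRingEnd ℂ w ∈ A ↔ w ∈ A) : (φ ∘ starRingEnd ℂ) '' A = φ '' A := by
  rw [Set.image_comp]
  congr 1
  ext w
  constructor
  · rintro ⟨w, hw, rfl⟩; exact (hA w).2 hw
  · intro hw; exact ⟨starRingEnd ℂ w, (hA w).2 hw, by simp⟩

theorem conj_mem_ball (w : ℂ) : starRingEnd ℂ w ∈ Metric.ball (0 : ℂ) 1 ↔
    w ∈ Metric.ball (0 : ℂ) 1 := by simp

theorem conj_mem_sphere (w : ℂ) : starRingEnd ℂ w ∈ Metric.sphere (0 : ℂ) 1 ↔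
    w ∈ Metric.sphere (0 : ℂ) 1 := by simp

theorem isOpenEmbedding_conj : IsOpenEmbedding (starRingEnd ℂ) :=
  Complex.conjCLE.toHomeomorph.isOpenEmbedding

/-- Conjugation fixes the points ±1, preserves disc and circle, and commutes with `stretch`. The
mirrored chart serves for circles that are traversed in the opposite sense. -/
theorem InPosition.conj {D : PieceDiagram S n} {ω : ℂ → F} {d : Fin n} (h : D.InPosition ω d) :
    D.InPosition (ω ∘ starRingEnd ℂ) d := by
  have hs : (ω ∘ starRingEnd ℂ) ∘ stretch = (ω ∘ stretch) ∘ starRingEnd ℂ := by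
    ext w
    simp only [Function.comp]
    congr 1
    apply Complex.ext <;> simp [stretch, chart]
  refine ⟨h.emb.comp isOpenEmbedding_conj, ?_, by simpa using h.start, by simpa using h.finish⟩
  rw [hs]
  have c := h.channel
  refine ⟨c.emb.comp isOpenEmbedding_conj, ?_, ?_, c.uncrossed, c.ends_ne⟩
  · have := c.proper
    rwa [IsProperIn, ← image_comp_conj _ conj_mem_ball, ← image_comp_conj _ conj_mem_sphere] at this
  · have := c.alone
    rwa [← image_comp_conj _ conj_mem_ball] at this

variable {D : PieceDiagram S n} {ω : ℂ → F} {d : Fin n} {κ : C(I, F)}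

/-- In its new place the circle misses the diagram: it lies strictly above the real axis, on which
`d` runs, and inside the ellipse, where `d` is alone. -/
theorem InPosition.toSkein_addCircle_of_isotopic (h : D.InPosition ω d)
    (hs : ∀ s ∈ Set.Ioo 0 1, D.path d s ∈ ω '' Metric.ball 0 1)
    (hreal : ∀ s, ∃ r : ℝ, D.path d s = ω r) (hκ : IsLoop κ)
    (hd : ∀ e t s, D.path e t ≠ κ s) {g : F ≃ₜ F} (hg : IsIsotopicToId g) {w : C(I, ℂ)} {r : I}
    (hw : IsUnitLoop w) (hgood : IsGoodLoop (ring w) r) (hgκ : ∀ t, g (κ t) = ω (ring w t)) :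
    z • toSkein ⟨n + 1, D.addCircle κ hκ hd⟩ = (vInv - v) • toSkein ⟨n, D⟩ := by
  have hd' : ∀ e t s, D.path e t ≠ moved g κ s := by
    intro e t s he
    rw [moved_apply, hgκ] at he
    rcases eq_or_ne e d with rfl | hne
    · obtain ⟨r, hr⟩ := hreal t
      have := congrArg Complex.im (h.emb.injective (hr.symm.trans he))
      rw [Complex.ofReal_im] at this
      exact (ring_im_pos hw s).ne this
    · refine h.channel.alone e hne t ?_
      rw [image_stretch, he]
      exact Set.mem_image_of_mem _ (ring_mem_ellipse hw s)
  rw [← D.toSkein_addCircle_moved hκ hd hg hd']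
  exact h.toSkein_addCircle hs _ _ hgκ hgood

/-- The value of a closed curve that bounds a disc, if a piece of the diagram runs straight through
a disc to which it can be moved. -/
theorem toSkein_addCircle_of_disc [T2Space F] {f : ℂ → F} (hf : IsOpenEmbedding f) {p c : ℂ}
    (hc : c ≠ 0) (h : D.InPosition (fun w => f (p + c * w)) d)
    (hs : ∀ s ∈ Set.Ioo 0 1, D.path d s ∈ (fun w => f (p + c * w)) '' Metric.ball 0 1)
    (hreal : ∀ s, ∃ r : ℝ, D.path d s = f (p + c * r)) (hκ : IsLoop κ)
    (hd : ∀ e t s, D.path e t ≠ κ s) {g : F ≃ₜ F} (hg : IsIsotopicToId g) {u : C(I, ℂ)}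
    (hu : ∀ t, ‖u t‖ = 1) (hsurj : ∀ x, ‖x‖ = 1 → ∃ t, u t = x) (hgκ : ∀ t, g (κ t) = f (u t)) :
    z • toSkein ⟨n + 1, D.addCircle κ hκ hd⟩ = (vInv - v) • toSkein ⟨n, D⟩ := by
  have hu0 : u 0 ≠ 0 := fun h0 => by simpa [h0] using hu 0
  have hinj : ∀ s t, u s = u t → κ s = κ t := fun s t hst =>
    g.injective (by rw [hgκ, hgκ, hst])
  let w : C(I, ℂ) := ⟨fun t => u t / u 0, by fun_prop⟩
  have hwt : ∀ t, w t = u t / u 0 := fun t => rfl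
  have hu1 : u 1 = u 0 := hf.injective (by rw [← hgκ, ← hgκ, hκ.closed])
  have hw : IsUnitLoop w := by
    refine ⟨by simp [hwt, hu0], by simp [hwt, hu0, hu1], fun t => by simp [hwt, hu],
      fun s t hst => hκ.inj s t (hinj s t ?_), fun x hx => ?_⟩
    · rw [hwt, hwt] at hst
      exact (div_left_inj' hu0).1 hst
    · obtain ⟨t, ht⟩ := hsurj (x * u 0) (by simp [hx, hu])
      exact ⟨t, by rw [hwt, ht, mul_div_cancel_right₀ _ hu0]⟩
  have conj_ne : starRingEnd ℂ (loopStart - Complex.I) ≠ 0 :=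
    (map_ne_zero _).2 loopStart_sub_ne
  -- The affine maps that isotopies realise preserve orientation, so the sense of the circle cannot
  -- be chosen. With the wrong sense, the circle is placed on the other side of the piece and viewed
  -- in the mirrored chart.
  rcases exists_isGoodLoop hw with ⟨r, hr⟩ | ⟨r, hr⟩
  · obtain ⟨g', hg', hg'f⟩ := realises hf
      (a := c * (loopStart - Complex.I) / u 0) (div_ne_zero (mul_ne_zero hc loopStart_sub_ne) hu0)
      (p + c * Complex.I) 1
    refine h.toSkein_addCircle_of_isotopic hs hreal hκ hd (hg.trans hg') hw hr fun t => ?_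
    rw [Homeomorph.trans_apply, hgκ, hg'f _ (hu t).le, ring_apply, hwt]
    congr 1
    ring
  · obtain ⟨g', hg', hg'f⟩ := realises hf
      (a := c * starRingEnd ℂ (loopStart - Complex.I) / u 0)
      (div_ne_zero (mul_ne_zero hc conj_ne) hu0) (p - c * Complex.I) 1
    refine h.conj.toSkein_addCircle_of_isotopic ?_ (fun s => ?_) hκ hd (hg.trans hg') hw.mirror hr
      fun t => ?_
    · rwa [image_comp_conj _ conj_mem_ball]
    · obtain ⟨r, hr⟩ := hreal s
      exact ⟨r, by simp [hr]⟩
    · rw [Homeomorph.trans_apply, hgκ, hg'f _ (hu t).le, ring_apply, mirror_apply, hwt]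
      simp only [Function.comp, map_add, map_mul, Complex.conj_I, Complex.conj_conj]
      congr 1
      ring

end PieceDiagram

/-! ### Bringing a piece of the diagram into position -/

namespace PieceDiagram

/-- The diagram `D'` represents the same element of the skein as `D`, also after the addition of
`κ`, and consists of points of `D`. -/
structure Represents (D' : PieceDiagram S m) (D : PieceDiagram S n) (κ : C(I, F)) : Prop where
  toSkein_eq : toSkein ⟨m, D'⟩ = toSkein ⟨n, D⟩
  disjoint : (∀ e t s, D.path e t ≠ κ s) → ∀ e t s, D'.path e t ≠ κ s
  toSkein_addCircle_eq : ∀ (hκ : IsLoop κ) (hd : ∀ e t s, D.path e t ≠ κ s)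
    (hd' : ∀ e t s, D'.path e t ≠ κ s),
    toSkein ⟨m + 1, D'.addCircle κ hκ hd'⟩ = toSkein ⟨n + 1, D.addCircle κ hκ hd⟩

theorem Represents.trans {k : ℕ} {D'' : PieceDiagram S k} {D' : PieceDiagram S m}
    {D : PieceDiagram S n} {κ : C(I, F)} (h' : D''.Represents D' κ) (h : D'.Represents D κ) :
    D''.Represents D κ where
  toSkein_eq := h'.toSkein_eq.trans h.toSkein_eq
  disjoint hd := h'.disjoint (h.disjoint hd)
  toSkein_addCircle_eq hκ hd hd' :=
    (h'.toSkein_addCircle_eq hκ (h.disjoint hd) hd').trans (h.toSkein_addCircle_eq hκ hd _)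

theorem Refinement.represents {D : PieceDiagram S n} (R : D.Refinement m) (κ : C(I, F)) :
    R.toDiagram.Represents D κ where
  toSkein_eq := R.subdivides.toSkein_eq
  disjoint hd _ _ s := hd _ _ s
  toSkein_addCircle_eq hκ hd hd' := (R.addCircle_subdivides hκ hd hd').toSkein_eq

theorem InPosition.represents_replaceArc {D : PieceDiagram S n} {ω : ℂ → F} {d : Fin n}
    (h : D.InPosition ω d) {κ : C(I, F)} (hω : ∀ t, κ t ∉ ω '' ellipse) {β : C(I, F)}
    (hβ : IsArc (ω ∘ stretch) (D.path d 0) (D.path d 1) (fun _ _ => False) β) :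
    (D.replaceArc h.channel β hβ).Represents D κ where
  toSkein_eq := h.toSkein_replaceArc hβ
  disjoint hd e t s := by
    rcases eq_or_ne e d with rfl | he
    · rw [replaceArc_path_self]
      by_cases ht0 : t = 0
      · subst ht0; rw [hβ.zero]; exact hd _ _ _
      by_cases ht1 : t = 1
      · subst ht1; rw [hβ.one]; exact hd _ _ _
      intro he
      refine hω s ?_
      rw [← image_stretch, ← he]
      exact hβ.mem_ball t
        ⟨unitInterval.pos_iff_ne_zero.2 ht0, unitInterval.lt_one_iff_ne_one.2 ht1⟩
    · rw [replaceArc_path_of_ne he]; exact hd _ _ _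
  toSkein_addCircle_eq hκ hd hd' := h.toSkein_addCircle_replaceArc hκ hd hω hβ hd'

/-- A piece can be cut so that a given part of it gets into position. -/
theorem exists_inPosition (D : PieceDiagram S n) {e : Fin n} {a b : I} (ha : 0 < a) (hab : a < b)
    (hb : b < 1) {ω : ℂ → F} (hω : IsOpenEmbedding ω) (h0 : D.path e a = ω (-1))
    (h1 : D.path e b = ω 1) (hin : ∀ t, D.path e t ∈ ω '' ellipse ↔ t ∈ Set.Ioo a b)
    (halone : ∀ i, i ≠ e → ∀ t, D.path i t ∉ ω '' ellipse)
    (hun : ∀ t ∈ Set.Icc a b, D.Uncrossed (e, t)) (κ : C(I, F)) :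
    ∃ (D' : PieceDiagram S (n + 2)) (d : Fin (n + 2)), D'.InPosition ω d ∧ D'.Represents D κ ∧
      (∀ s, ∃ t ∈ Set.Icc a b, D'.path d s = D.path e t) ∧
      ∀ s ∈ Set.Ioo 0 1, ∃ t ∈ Set.Ioo a b, D'.path d s = D.path e t := by
  have ha1 : a < 1 := hab.trans hb
  -- The second cut is made on the part beyond `a`, where `b` has the parameter `s`.
  obtain ⟨s, hs⟩ := exists_aff hab.le hb.le
  have hm := aff_strictMono ha1
  have hs0 : 0 < s := by
    rw [← hm.lt_iff_lt, aff_zero, hs]; exact hab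
  have hs1 : s < 1 := by
    rw [← hm.lt_iff_lt, aff_one, hs]; exact hb
  have hua : D.Uncrossed (e, a) := hun a ⟨le_rfl, hab.le⟩
  have hub : D.Uncrossed (e, aff a 1 s) := by rw [hs]; exact hun b ⟨hab.le, le_rfl⟩
  let R := D.cutTwice e a s ha ha1 hs0 hs1 hua hub
  have hp : ∀ x, R.toDiagram.path x.1 x.2 = D.path (D.cutTwiceProj e a s ha ha1 hs0 hs1 hua hub x).1
    (D.cutTwiceProj e a s ha ha1 hs0 hs1 hua hub x).2 := fun x => rfl
  have hmid : ∀ r, R.toDiagram.path (Fin.last n).castSucc r = D.path e (aff a 1 (aff 0 s r)) := by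
    intro r
    rw [hp ((Fin.last n).castSucc, r), cutTwiceProj_middle]
  have hself : ∀ r, R.toDiagram.path e.castSucc.castSucc r = D.path e (aff 0 a r) := by
    intro r
    rw [hp (e.castSucc.castSucc, r), cutTwiceProj_self]
  have hlast : ∀ r, R.toDiagram.path (Fin.last (n + 1)) r = D.path e (aff a 1 (aff s 1 r)) := by
    intro r
    rw [hp (Fin.last (n + 1), r), cutTwiceProj_last]
  have hne : ∀ i, i ≠ e → ∀ r, R.toDiagram.path i.castSucc.castSucc r = D.path i r := by
    intro i hi r
    rw [hp (i.castSucc.castSucc, r), cutTwiceProj_of_ne _ _ _ _ _ _ _ _ _ _ hi]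
  have hIcc : ∀ r, aff a 1 (aff 0 s r) ∈ Set.Icc a b := by
    intro r
    refine ⟨(aff_mem ha1 _).1, ?_⟩
    rw [← hs]
    exact hm.monotone (aff_mem hs0 r).2
  have hIoo : ∀ r ∈ Set.Ioo (0 : I) 1, aff a 1 (aff 0 s r) ∈ Set.Ioo a b := by
    intro r hr
    have hr0 := aff_strictMono hs0 hr.1
    have hr1 := aff_strictMono hs0 hr.2
    rw [aff_zero] at hr0
    rw [aff_one] at hr1
    refine ⟨by simpa using hm hr0, ?_⟩
    rw [← hs]
    exact hm hr1
  have hst : R.toDiagram.path (Fin.last n).castSucc 0 = ω (-1) := by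
    rw [hmid, aff_zero, aff_zero, h0]
  have hfi : R.toDiagram.path (Fin.last n).castSucc 1 = ω 1 := by
    rw [hmid, aff_one, hs, h1]
  refine ⟨R.toDiagram, (Fin.last n).castSucc, ⟨hω, ⟨hω.comp isOpenEmbedding_stretch, ?_, ?_, ?_, ?_⟩,
    hst, hfi⟩, (R.represents κ).trans ((D.cut e a ha ha1 hua).represents κ),
    fun r => ⟨_, hIcc r, hmid r⟩, fun r hr => ⟨_, hIoo r hr, hmid r⟩⟩
  · refine ⟨fun r hr => ?_, ⟨-1, by simp, ?_⟩, ⟨1, by simp, ?_⟩⟩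
    · rw [image_stretch, hmid]
      exact (hin _).2 (hIoo r hr)
    · rw [hst]; simp [stretch, chart]
    · rw [hfi]; simp [stretch, chart]
  · intro i hi r
    rw [image_stretch]
    rcases exists_cutTwice e i with ⟨i, hi', rfl⟩ | rfl | rfl | rfl
    · rw [hne i hi']; exact halone i hi' r
    · rw [hself, hin]
      exact fun h => h.1.not_ge (aff_mem ha r).2
    · exact absurd rfl hi
    · rw [hlast, hin]
      refine fun h => h.2.not_ge ?_
      conv_lhs => rw [← hs]
      exact hm.monotone (aff_mem hs1 r).1
  · intro r y
    have := hun _ (hIcc r) (D.cutTwiceProj e a s ha ha1 hs0 hs1 hua hub y)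
    rw [← cutTwiceProj_middle D e a s ha ha1 hs0 hs1 hua hub] at this
    exact this
  · rw [hst, hfi]
    intro h
    have := hω.injective h
    norm_num [Complex.ext_iff] at this

end PieceDiagram

theorem isOpenEmbedding_affine (p : ℂ) {c : ℂ} (hc : c ≠ 0) :
    IsOpenEmbedding fun w : ℂ => p + c * w :=
  ((Homeomorph.mulLeft₀ c hc).trans (Homeomorph.addLeft p)).isOpenEmbedding

theorem norm_lt_two_of_mem_ellipse {w : ℂ} (hw : w ∈ ellipse) : ‖w‖ < 2 := by
  simp only [ellipse, Set.mem_ofPred_eq] at hw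
  rw [← sq_lt_sq₀ (norm_nonneg _) zero_le_two, Complex.sq_norm, Complex.normSq_apply]
  nlinarith [sq_nonneg w.re]

theorem ofReal_mem_ellipse {r : ℝ} : (r : ℂ) ∈ ellipse ↔ |r| < 1 := by
  simp [ellipse]

namespace PieceDiagram

theorem finite_crossed (D : PieceDiagram S n) (e : Fin n) : {t | ¬ D.Uncrossed (e, t)}.Finite := by
  refine ((D.above_finite.image fun p => p.1.2).union
    (D.above_finite.image fun p => p.2.2)).subset fun t ht => ?_
  simp only [Uncrossed, Set.mem_ofPred_eq, not_forall, not_and_or, not_not] at ht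
  obtain ⟨y, h | h⟩ := ht
  · exact Or.inl ⟨((e, t), y), h, rfl⟩
  · exact Or.inr ⟨(y, (e, t)), h, rfl⟩

theorem eq_of_uncrossed (D : PieceDiagram S n) {e i : Fin n} {s t : I} (hs : D.Uncrossed (e, s))
    (hs' : s ∈ Set.Ioo 0 1) (h : D.path i t = D.path e s) : i = e ∧ t = s := by
  rcases D.meet (i, t) (e, s) h with h | h | h | h | h
  · exact Prod.mk.inj h
  · exact absurd h (hs _).2
  · exact absurd h (hs _).1
  · exact absurd h.2.1 hs'.1.ne'
  · exact absurd h.1 hs'.2.ne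

/-- Near some parameter a piece is straight and has no crossings. -/
theorem exists_straight (D : PieceDiagram S n) (e : Fin n) : ∃ (ψ : ℂ → F) (ρ : I → ℝ) (a t b : I),
    IsOpenEmbedding ψ ∧ 0 < a ∧ a < t ∧ t < b ∧ b < 1 ∧ ρ t = 0 ∧
    (∀ s ∈ Set.Icc a b, D.Uncrossed (e, s) ∧ D.path e s = ψ (ρ s)) ∧
    ContinuousOn ρ (Set.Icc a b) ∧ StrictMonoOn ρ (Set.Icc a b) := by
  obtain ⟨t, ht, htB⟩ := (Set.Ioo_infinite (zero_lt_one (α := I))).exists_notMem_finite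
    ((D.flat e).union (D.finite_crossed e))
  simp only [Set.mem_union, Set.mem_ofPred_eq, not_or, not_not] at htB
  obtain ⟨⟨ψ, hψ, hψ0, hright, hleft⟩, hunt⟩ := htB
  have hev : ∀ᶠ s in 𝓝 t, D.Uncrossed (e, s) := by
    have := (D.finite_crossed e).isClosed.isOpen_compl.mem_nhds (x := t) (by simpa using hunt)
    filter_upwards [this] with s hs
    simpa using hs
  obtain ⟨b', hb', hb⟩ := (mem_nhdsGT_iff_exists_Ioo_subset' ht.2).1
    (hright.and (hev.filter_mono nhdsWithin_le_nhds))
  obtain ⟨a', ha', ha⟩ := (mem_nhdsLT_iff_exists_Ioo_subset' ht.1).1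
    (hleft.and (hev.filter_mono nhdsWithin_le_nhds))
  obtain ⟨b, htb, hbb⟩ := exists_between (Set.mem_Ioi.1 hb')
  obtain ⟨a, haa, hat⟩ := exists_between (Set.mem_Iio.1 ha')
  have ha0 : 0 < a := unitInterval.nonneg'.trans_lt haa
  have hb1 : b < 1 := hbb.trans_le unitInterval.le_one'
  have hr : ∀ s, t < s → s ≤ b → D.Uncrossed (e, s) ∧ ∃ r : ℝ, 0 < r ∧ D.path e s = ψ r := by
    intro s h1 h2
    obtain ⟨⟨_, ⟨r, hr, rfl⟩, h⟩, h'⟩ := hb ⟨h1, h2.trans_lt hbb⟩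
    exact ⟨h', r, hr, by rw [← h, mul_one]⟩
  have hl : ∀ s, s < t → a ≤ s → D.Uncrossed (e, s) ∧ ∃ r : ℝ, r < 0 ∧ D.path e s = ψ r := by
    intro s h1 h2
    obtain ⟨⟨_, ⟨r, hr, rfl⟩, h⟩, h'⟩ := ha ⟨haa.trans_le h2, h1⟩
    exact ⟨h', r, hr, by rw [← h, mul_one]⟩
  have hall : ∀ s ∈ Set.Icc a b, D.Uncrossed (e, s) ∧ ∃ r : ℝ, D.path e s = ψ r := by
    intro s hs
    rcases lt_trichotomy s t with h | rfl | h
    · obtain ⟨h1, r, -, h2⟩ := hl s h hs.1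
      exact ⟨h1, r, h2⟩
    · exact ⟨hunt, 0, by rw [← hψ0, Complex.ofReal_zero]⟩
    · obtain ⟨h1, r, -, h2⟩ := hr s h hs.2
      exact ⟨h1, r, h2⟩
  -- The real coordinate in the chart `ψ`. It is continuous and injective between `a` and `b`, hence
  -- monotone, and it increases because it is negative at `a` and positive at `b`.
  let ρ : I → ℝ := fun s => (Function.invFun ψ (D.path e s)).re
  have hρ : ∀ s (r : ℝ), D.path e s = ψ r → ρ s = r := by
    intro s r h
    simp only [ρ, h, Function.leftInverse_invFun hψ.injective (r : ℂ), Complex.ofReal_re]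
  have hρ' : ∀ s ∈ Set.Icc a b, D.path e s = ψ (ρ s) := by
    intro s hs
    obtain ⟨-, r, hr⟩ := hall s hs
    rw [hρ s r hr, hr]
  have hcont : ContinuousOn ρ (Set.Icc a b) := by
    have h1 : ContinuousOn (fun s => ((ρ s : ℝ) : ℂ)) (Set.Icc a b) := by
      refine hψ.isInducing.continuousOn_iff.2 ?_
      exact (D.path e).continuous.continuousOn.congr fun s hs => (hρ' s hs).symm
    have h2 := Complex.continuous_re.comp_continuousOn h1
    exact h2.congr fun s _ => (Complex.ofReal_re _).symm
  have hinj : Set.InjOn ρ (Set.Icc a b) := by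
    intro r hr s hs hrs
    refine (D.eq_of_uncrossed (i := e) (hall s hs).1 ⟨ha0.trans_le hs.1, hs.2.trans_lt hb1⟩ ?_).2
    rw [hρ' s hs, hρ' r hr, hrs]
  have hab : a ≤ b := (hat.trans htb).le
  have hta : ρ a < 0 := by
    obtain ⟨-, r, hr0, hr⟩ := hl a hat le_rfl
    rwa [hρ a r hr]
  have htb' : 0 < ρ b := by
    obtain ⟨-, r, hr0, hr⟩ := hr b htb le_rfl
    rwa [hρ b r hr]
  refine ⟨ψ, ρ, a, t, b, hψ, ha0, hat, htb, hb1, hρ t 0 (by rw [← hψ0, Complex.ofReal_zero]),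
    fun s hs => ⟨(hall s hs).1, hρ' s hs⟩, hcont, ?_⟩
  rcases hcont.strictMonoOn_of_injOn_Icc' hab hinj with h | h
  · exact h
  · exact absurd (h ⟨le_rfl, hab⟩ ⟨hab, le_rfl⟩ (hat.trans htb)) (hta.trans htb').not_gt

/-- Up to cutting, any diagram has a piece in position, in a chart away from a given curve. -/
theorem exists_inPosition_of_disjoint [T2Space F] (D : PieceDiagram S n) {κ : C(I, F)}
    (hd : ∀ e t s, D.path e t ≠ κ s) : ∃ (D' : PieceDiagram S (n + 2)) (d : Fin (n + 2)) (ω : ℂ → F),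
      D'.InPosition ω d ∧ D'.Represents D κ ∧ ∀ t, κ t ∉ ω '' ellipse := by
  let e : Fin n := ⟨0, D.pieces_pos⟩
  obtain ⟨ψ, ρ, a, t, b, hψ, ha0, hat, htb, hb1, hρ0, hρ, hcont, hmono⟩ := D.exists_straight e
  have hab := hat.trans htb
  -- All that the ellipse has to avoid: the rest of the piece, the other pieces and the curve.
  let K : Set F := D.path e '' (Set.Ioo a b)ᶜ ∪ (⋃ i ∈ {i | i ≠ e}, Set.range (D.path i)) ∪
    Set.range κ
  have hK : IsClosed K := by
    refine IsClosed.union (IsClosed.union ?_ ?_) ?_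
    · exact ((isOpen_Ioo.isClosed_compl.isCompact).image (D.path e).continuous).isClosed
    · exact (Set.toFinite _).isClosed_biUnion fun i _ =>
        (isCompact_range (D.path i).continuous).isClosed
    · exact (isCompact_range κ.continuous).isClosed
  have hmem : ∀ s, s ∉ Set.Ioo a b → D.path e s ∈ K := fun s hs =>
    Or.inl (Or.inl ⟨s, hs, rfl⟩)
  have hmem' : ∀ i, i ≠ e → ∀ s, D.path i s ∈ K := fun i hi s =>
    Or.inl (Or.inr (Set.mem_biUnion (x := i) hi ⟨s, rfl⟩))
  have hp0 : D.path e t = ψ 0 := by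
    rw [(hρ t ⟨hat.le, htb.le⟩).2, hρ0, Complex.ofReal_zero]
  have hpK : ψ 0 ∉ K := by
    have hu := (hρ t ⟨hat.le, htb.le⟩).1
    have ht : t ∈ Set.Ioo (0 : I) 1 := ⟨ha0.trans hat, htb.trans hb1⟩
    rw [← hp0]
    rintro ((⟨s, hs, h⟩ | h) | ⟨s, h⟩)
    · exact hs ((D.eq_of_uncrossed hu ht h).2 ▸ ⟨hat, htb⟩)
    · obtain ⟨i, hi, s, h⟩ := Set.mem_iUnion₂.1 h
      exact hi (D.eq_of_uncrossed hu ht h).1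
    · exact hd _ _ _ h.symm
  obtain ⟨ε, hε, hεK⟩ := Metric.isOpen_iff.1 (hK.isOpen_compl.preimage hψ.continuous) 0 hpK
  have hball : ∀ w : ℂ, ‖w‖ < ε → ψ w ∉ K := fun w hw => hεK (by simpa using hw)
  -- The ellipse lies in the disc of radius 2, so scaled by ε / 2 it stays within radius ε.
  have hη : 0 < ε / 2 := _root_.half_pos hε
  generalize hηdef : ε / 2 = η at hη
  have hηε : ε = 2 * η := by linarith
  have hη0 : ((η : ℝ) : ℂ) ≠ 0 := Complex.ofReal_ne_zero.2 hη.ne'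
  let ω : ℂ → F := fun w => ψ (0 + η * w)
  have hω : IsOpenEmbedding ω := hψ.comp (isOpenEmbedding_affine 0 hη0)
  have hωK : ∀ x ∈ ω '' ellipse, x ∉ K := by
    rintro _ ⟨w, hw, rfl⟩
    refine hball _ ?_
    rw [zero_add, norm_mul, Complex.norm_real, Real.norm_eq_abs, abs_of_pos hη, hηε]
    have := norm_lt_two_of_mem_ellipse hw
    nlinarith
  have hout : ∀ s ∈ Set.Icc a b, s ∉ Set.Ioo a b → ε ≤ |ρ s| := by
    intro s hs hs'
    by_contra! hlt
    refine hball (ρ s) (by simpa using hlt) ?_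
    rw [← (hρ s hs).2]
    exact hmem s hs'
  have hIa : a ∈ Set.Icc a b := ⟨le_rfl, hab.le⟩
  have hIb : b ∈ Set.Icc a b := ⟨hab.le, le_rfl⟩
  have hIt : t ∈ Set.Icc a b := ⟨hat.le, htb.le⟩
  have hρa : ρ a < -η := by
    have h1 := hmono hIa hIt hat
    have h2 := hout a hIa (fun h => h.1.false)
    rw [hρ0] at h1
    rw [abs_of_neg h1] at h2
    linarith
  have hρb : η < ρ b := by
    have h1 := hmono hIt hIb htb
    have h2 := hout b hIb (fun h => h.2.false)
    rw [hρ0] at h1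
    rw [abs_of_pos h1] at h2
    linarith
  obtain ⟨a', ha', hρa'⟩ := intermediate_value_Icc hab.le hcont
    (show -η ∈ Set.Icc (ρ a) (ρ b) from ⟨hρa.le, by linarith⟩)
  obtain ⟨b', hb', hρb'⟩ := intermediate_value_Icc hab.le hcont
    (show η ∈ Set.Icc (ρ a) (ρ b) from ⟨by linarith, hρb.le⟩)
  have hab' : a' < b' := (hmono.lt_iff_lt ha' hb').1 (by rw [hρa', hρb']; linarith)
  have h0 : D.path e a' = ω (-1) := by
    rw [(hρ a' ha').2, hρa']; simp [ω]
  have h1 : D.path e b' = ω 1 := by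
    rw [(hρ b' hb').2, hρb']; simp [ω]
  have hin : ∀ s, D.path e s ∈ ω '' ellipse ↔ s ∈ Set.Ioo a' b' := by
    refine fun s => ⟨fun hs => ?_, fun hs => ?_⟩
    · have hs' : s ∈ Set.Ioo a b := by
        by_contra h
        exact hωK _ hs (hmem s h)
      have hs'' : s ∈ Set.Icc a b := Set.Ioo_subset_Icc_self hs'
      obtain ⟨w, hw, hws⟩ := hs
      rw [(hρ s hs'').2] at hws
      have hw' : η * w = ρ s := by simpa using hψ.injective hws
      have hwr : w = ((ρ s / η : ℝ) : ℂ) := by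
        rw [Complex.ofReal_div, ← hw', mul_div_cancel_left₀ _ hη0]
      rw [hwr, ofReal_mem_ellipse, abs_div, abs_of_pos hη, div_lt_one hη, abs_lt] at hw
      exact ⟨(hmono.lt_iff_lt ha' hs'').1 (hρa'.trans_lt hw.1),
        (hmono.lt_iff_lt hs'' hb').1 (hw.2.trans_eq hρb'.symm)⟩
    · have hs'' : s ∈ Set.Icc a b := ⟨ha'.1.trans hs.1.le, hs.2.le.trans hb'.2⟩
      have h1 := hmono ha' hs'' hs.1
      have h2 := hmono hs'' hb' hs.2
      rw [hρa'] at h1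
      rw [hρb'] at h2
      refine ⟨((ρ s / η : ℝ) : ℂ), ?_, ?_⟩
      · rw [ofReal_mem_ellipse, abs_div, abs_of_pos hη, div_lt_one hη, abs_lt]
        exact ⟨h1, h2⟩
      · rw [(hρ s hs'').2]
        simp only [ω, zero_add, Complex.ofReal_div]
        rw [mul_div_cancel₀ _ hη0]
  obtain ⟨D', d, h1, h2, -, -⟩ := D.exists_inPosition
    (ha0.trans_le ha'.1) hab' (hb'.2.trans_lt hb1) hω h0 h1 hin
    (fun i hi s hs => hωK _ hs (hmem' i hi s))
    (fun s hs => (hρ s ⟨ha'.1.trans hs.1, hs.2.trans hb'.2⟩).1) κ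
  exact ⟨D', d, ω, h1, h2, fun s hs => hωK _ hs (Or.inr ⟨s, rfl⟩)⟩

end PieceDiagram

theorem seg_ofReal (a b : ℝ) (t : I) : seg a b t = ((a + t * (b - a) : ℝ) : ℂ) := by
  rw [seg_apply]; push_cast; ring

theorem norm_midpoint_lt {x y : ℂ} (hx : ‖x‖ ≤ 1) (hy : ‖y‖ ≤ 1) (h : x ≠ y) :
    ‖(x + y) / 2‖ < 1 := by
  have h1 := parallelogram_law_with_norm ℝ x y
  have h2 : 0 < ‖x - y‖ := norm_pos_iff.2 (sub_ne_zero.2 h)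
  rw [norm_div, Complex.norm_ofNat, div_lt_one two_pos]
  nlinarith [norm_nonneg x, norm_nonneg y, norm_nonneg (x + y)]

/-- The part of the real axis of the chart `ω` inside the small disc `f`. -/
theorem exists_ends [T2Space F] {ω f : ℂ → F} (hω : IsOpenEmbedding ω) (hf : IsOpenEmbedding f)
    (h0 : f 0 = ω 0) (hsmall : f '' Metric.closedBall 0 1 ⊆ ω '' Metric.ball 0 (1 / 2)) :
    ∃ (a b : ℝ) (x y : ℂ), -1 < a ∧ a < b ∧ b < 1 ∧ ‖x‖ ≤ 1 ∧ ‖y‖ ≤ 1 ∧ f x = ω a ∧ f y = ω b ∧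
      ∀ r : ℝ, ω r ∈ f '' Metric.closedBall 0 1 → a ≤ r ∧ r ≤ b := by
  let N : Set ℝ := Set.Icc (-1) 1 ∩ (fun r : ℝ => ω r) ⁻¹' (f '' Metric.closedBall 0 1)
  have hc : Continuous fun r : ℝ => ω r := hω.continuous.comp Complex.continuous_ofReal
  have hN : IsCompact N := isCompact_Icc.inter_right
    (((isCompact_closedBall 0 1).image hf.continuous).isClosed.preimage hc)
  have hlt : ∀ r : ℝ, ω r ∈ f '' Metric.closedBall 0 1 → |r| < 1 / 2 := by
    intro r hr
    obtain ⟨w, hw, hwr⟩ := hsmall hr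
    rw [hω.injective hwr] at hw
    simpa using hw
  have hmemN : ∀ r : ℝ, ω r ∈ f '' Metric.closedBall 0 1 → r ∈ N := by
    intro r hr
    have := abs_lt.1 (hlt r hr)
    exact ⟨⟨by linarith, by linarith⟩, hr⟩
  have hne : N.Nonempty := ⟨0, hmemN 0 ⟨0, by simp, by simpa using h0⟩⟩
  have hev : ∀ᶠ r : ℝ in 𝓝 0, ω r ∈ f '' Metric.closedBall 0 1 := by
    have hopen : IsOpen ((fun r : ℝ => ω r) ⁻¹' (f '' Metric.ball 0 1)) :=
      (hf.isOpenMap _ Metric.isOpen_ball).preimage hc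
    filter_upwards [hopen.mem_nhds (x := 0) ⟨0, by simp, by simpa using h0⟩] with r hr
    exact Set.image_mono Metric.ball_subset_closedBall hr
  obtain ⟨δ, hδ, hδN⟩ := Metric.eventually_nhds_iff.1 hev
  -- The axis may leave and re-enter the small disc in between; only the first and the last point
  -- matter.
  obtain ⟨a, haN, ha⟩ := hN.exists_isLeast hne
  obtain ⟨b, hbN, hb⟩ := hN.exists_isGreatest hne
  have ha0 : a ≤ -(δ / 2) := ha (hmemN _ (hδN (by
    rw [dist_zero_right, Real.norm_eq_abs, abs_neg, abs_of_pos] <;> linarith)))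
  have hb0 : δ / 2 ≤ b := hb (hmemN _ (hδN (by
    rw [dist_zero_right, Real.norm_eq_abs, abs_of_pos] <;> linarith)))
  obtain ⟨x, hx, hxa⟩ := haN.2
  obtain ⟨y, hy, hyb⟩ := hbN.2
  have h1 := abs_lt.1 (hlt a haN.2)
  have h2 := abs_lt.1 (hlt b hbN.2)
  exact ⟨a, b, x, y, by linarith, by linarith, by linarith, by simpa using hx, by simpa using hy,
    hxa, hyb, fun r hr => ⟨ha (hmemN r hr), hb (hmemN r hr)⟩⟩

namespace PieceDiagram

/-- A piece in position may be replaced by one that runs straight through a given small disc. -/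
theorem InPosition.exists_inPosition [T2Space F] {D : PieceDiagram S n} {ω f : ℂ → F} {d : Fin n}
    (h : D.InPosition ω d) (hf : IsOpenEmbedding f) (h0 : f 0 = ω 0)
    (hsmall : f '' Metric.closedBall 0 1 ⊆ ω '' Metric.ball 0 (1 / 2)) {κ : C(I, F)}
    (hκ : ∀ t, κ t ∉ ω '' ellipse) :
    ∃ (D' : PieceDiagram S (n + 2)) (d' : Fin (n + 2)) (p c : ℂ), c ≠ 0 ∧
      D'.InPosition (fun w => f (p + c * w)) d' ∧ D'.Represents D κ ∧
      (∀ s ∈ Set.Ioo 0 1, D'.path d' s ∈ (fun w => f (p + c * w)) '' Metric.ball 0 1) ∧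
      ∀ s, ∃ r : ℝ, D'.path d' s = f (p + c * r) := by
  have hω := h.emb
  -- What is straight in `ω` need not be straight in `f`. So the piece is rerouted: along the axis
  -- of `ω` up to the small disc, through it on a chord that is straight in `f`, and on along the
  -- axis.
  obtain ⟨a, b, x, y, ha, hab, hb, hx, hy, hxa, hyb, hmin⟩ := exists_ends hω hf h0 hsmall
  have hxy : x ≠ y := by
    rintro rfl
    exact hab.ne (Complex.ofReal_injective (hω.injective (hxa.symm.trans hyb)))
  -- the three parts of the new piece
  let P : C(I, F) := draw ω hω (seg (-1) a)
  let C : C(I, F) := draw f hf (seg x y)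
  let Q : C(I, F) := draw ω hω (seg b 1)
  have hP : ∀ t, P t = ω ((-1 + t * (a - -1) : ℝ)) := fun t => by
    rw [← seg_ofReal]; simp [P]
  have hQ : ∀ t, Q t = ω ((b + t * (1 - b) : ℝ)) := fun t => by
    rw [← seg_ofReal]; simp [Q]
  have hCQ : C 1 = Q 0 := by simp [C, Q, hyb]
  have hPC : P 1 = cat C Q hCQ 0 := by simp [P, C, hxa]
  have hCmem : ∀ t, C t ∈ f '' Metric.closedBall 0 1 := by
    intro t
    refine ⟨seg x y t, ?_, rfl⟩
    refine (convex_closedBall (0 : ℂ) 1).segment_subset (by simpa using hx) (by simpa using hy) ?_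
    rw [segment_eq_image']
    exact ⟨t, t.2, by simp [seg_apply]⟩
  have hCinj : Function.Injective C := hf.injective.comp (seg_injective hxy)
  have hPinj : Function.Injective P := hω.injective.comp (seg_injective fun h1 => by
    have := congrArg Complex.re h1
    simp at this; linarith)
  have hQinj : Function.Injective Q := hω.injective.comp (seg_injective fun h1 => by
    have := congrArg Complex.re h1
    simp at this; linarith)
  have hPmem : ∀ t, P t ∈ f '' Metric.closedBall 0 1 → t = 1 := by
    intro t ht
    rw [hP] at ht
    have := (hmin _ ht).1
    refine le_antisymm unitInterval.le_one' ?_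
    rw [← Subtype.coe_le_coe, Set.Icc.coe_one]
    nlinarith
  have hQmem : ∀ t, Q t ∈ f '' Metric.closedBall 0 1 → t = 0 := by
    intro t ht
    rw [hQ] at ht
    have := (hmin _ ht).2
    refine le_antisymm ?_ unitInterval.nonneg'
    rw [← Subtype.coe_le_coe, Set.Icc.coe_zero]
    nlinarith
  have hCQinj : Function.Injective (cat C Q hCQ) := by
    refine cat_injective hCinj hQinj fun s t hst => ?_
    obtain rfl := hQmem t (hst ▸ hCmem s)
    exact ⟨hCinj (hst.trans hCQ.symm), rfl⟩
  have hPQ : ∀ s t, P s ≠ Q t := by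
    intro s t hst
    rw [hP, hQ] at hst
    have := Complex.ofReal_injective (hω.injective hst)
    have hs := s.2.2
    have ht := t.2.1
    nlinarith
  -- The new arc is simple, since the two parts on the axis meet the small disc only in the ends of
  -- the chord.
  let β : C(I, F) := cat P (cat C Q hCQ) hPC
  have hβinj : Function.Injective β := by
    refine cat_injective hPinj hCQinj fun s t hst => ?_
    obtain ⟨t, rfl | rfl⟩ := exists_half t
    · rw [cat_left] at hst
      obtain rfl := hPmem s (hst ▸ hCmem t)
      rw [hPC, cat_zero] at hst
      rw [← hCinj hst]
      simp
    · rw [cat_right] at hst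
      exact absurd hst (hPQ s t)
  have hreal : ∀ r : ℝ, |r| < 1 → ω r ∈ ω '' ellipse := fun r hr => ⟨r, ofReal_mem_ellipse.2 hr, rfl⟩
  have hfe : f '' Metric.closedBall 0 1 ⊆ ω '' ellipse := fun w hw => by
    obtain ⟨q, hq, rfl⟩ := hsmall hw
    exact ⟨q, ball_subset_ellipse (Metric.ball_subset_ball (by norm_num) hq), rfl⟩
  have hβ : IsArc (ω ∘ stretch) (D.path d 0) (D.path d 1) (fun _ _ => False) β := by
    refine IsArc.of_injective ?_ ?_ (fun t ht => ?_) hβinj ?_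
    · simp [β, P, h.start]
    · simp [β, Q, h.finish]
    · rw [image_stretch]
      obtain ⟨t, rfl | rfl⟩ := exists_half t
      · simp only [β, cat_left, hP]
        have h1 : (0 : ℝ) < t := unitInterval.pos_iff_ne_zero.2 (by
          rintro rfl; simp at ht)
        have h2 := t.2.2
        refine hreal _ (abs_lt.2 ⟨by nlinarith, by nlinarith⟩)
      obtain ⟨t, rfl | rfl⟩ := exists_half t
      · simp only [β, cat_right, cat_left]
        exact hfe (hCmem t)
      · simp only [β, cat_right, hQ]
        have h1 : (t : ℝ) < 1 := unitInterval.lt_one_iff_ne_one.2 (by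
          rintro rfl; simp at ht)
        have h2 := t.2.1
        refine hreal _ (abs_lt.2 ⟨by nlinarith, by nlinarith⟩)
    · refine IsFlat.cat (isFlat_seg hω fun h1 => ?_) (IsFlat.cat (isFlat_seg hf hxy)
        (isFlat_seg hω fun h1 => ?_))
      · have := congrArg Complex.re h1
        simp at this; linarith
      · have := congrArg Complex.re h1
        simp at this; linarith
  -- the middle of the chord
  let p : ℂ := (x + y) / 2
  have hp : ‖p‖ < 1 := norm_midpoint_lt hx hy hxy
  -- The chord has length at most 2, so `‖c‖` is at most (1 - ‖p‖) / 4, and the ellipse about `p`,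
  -- of radius less than `2 * ‖c‖`, stays in the unit disc of `f`.
  let q : ℝ := (1 - ‖p‖) / 8
  have hq0 : 0 < q := by simp only [q]; linarith
  have hq1 : q ≤ 1 / 8 := by simp only [q]; linarith [norm_nonneg p]
  have hqc : ((q : ℝ) : ℂ) ≠ 0 := Complex.ofReal_ne_zero.2 hq0.ne'
  let c : ℂ := q * (y - x)
  have hc : c ≠ 0 := mul_ne_zero hqc (sub_ne_zero.2 hxy.symm)
  have hcn : ‖c‖ ≤ (1 - ‖p‖) / 4 := by
    simp only [c, norm_mul, Complex.norm_real, Real.norm_eq_abs, abs_of_pos hq0]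
    have : ‖y - x‖ ≤ 2 := (norm_sub_le _ _).trans (by linarith)
    simp only [q] at hq0 ⊢
    nlinarith
  let ω' : ℂ → F := fun w => f (p + c * w)
  have hω' : IsOpenEmbedding ω' := hf.comp (isOpenEmbedding_affine p hc)
  have hω'f : ω' '' ellipse ⊆ f '' Metric.closedBall 0 1 := by
    rintro _ ⟨w, hw, rfl⟩
    refine ⟨_, ?_, rfl⟩
    have h1 := norm_lt_two_of_mem_ellipse hw
    rw [mem_closedBall_zero_iff]
    refine (norm_add_le _ _).trans ?_
    rw [norm_mul]
    nlinarith [norm_nonneg c, norm_nonneg w]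
  have hC : ∀ t : I, C t = ω' (((t - 1 / 2) / q : ℝ)) := by
    intro t
    simp only [C, ω', draw_apply]
    congr 1
    rw [seg_apply]
    simp only [p, c]
    push_cast
    field_simp
    ring
  -- On the chord, the coordinate of the parameter `t` in the chart `ω'` is (t - 1/2) / q, which is
  -- -1 at `a₁` and 1 at `b₁`.
  let a₁ : I := ⟨1 / 2 - q, by linarith, by linarith⟩
  let b₁ : I := ⟨1 / 2 + q, by linarith, by linarith⟩
  have ha₁ : 0 < a₁ := by rw [← Subtype.coe_lt_coe]; simp only [a₁, Set.Icc.coe_zero]; linarith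
  have hb₁ : b₁ < 1 := by rw [← Subtype.coe_lt_coe]; simp only [b₁, Set.Icc.coe_one]; linarith
  have hab₁ : a₁ < b₁ := by rw [← Subtype.coe_lt_coe]; simp only [a₁, b₁]; linarith
  let τ : I → I := fun t => aff half 1 (aff 0 half t)
  have hτ : StrictMono τ := (aff_strictMono half_lt_one).comp (aff_strictMono half_pos)
  have hβτ : ∀ t, β (τ t) = C t := fun t => by simp [β, τ]
  have hβmem : ∀ t, β t ∈ f '' Metric.closedBall 0 1 → ∃ s, t = τ s := by
    intro t ht
    obtain ⟨t, rfl | rfl⟩ := exists_half t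
    · simp only [β, cat_left] at ht
      obtain rfl := hPmem t ht
      exact ⟨0, by simp [τ]⟩
    obtain ⟨t, rfl | rfl⟩ := exists_half t
    · exact ⟨t, rfl⟩
    · simp only [β, cat_right] at ht
      obtain rfl := hQmem t ht
      exact ⟨1, by simp [τ]⟩
  have hCe : ∀ s, C s ∈ ω' '' ellipse ↔ s ∈ Set.Ioo a₁ b₁ := by
    intro s
    rw [hC, hω'.injective.mem_set_image, ofReal_mem_ellipse, abs_div, abs_of_pos hq0,
      div_lt_one hq0, abs_lt, Set.mem_Ioo, ← Subtype.coe_lt_coe, ← Subtype.coe_lt_coe]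
    constructor
    · rintro ⟨h1, h2⟩
      exact ⟨by simp only [a₁]; linarith, by simp only [b₁]; linarith⟩
    · rintro ⟨h1, h2⟩
      simp only [a₁, b₁] at h1 h2
      exact ⟨by linarith, by linarith⟩
  have hIcc : ∀ t, t ∈ Set.Icc (τ a₁) (τ b₁) → ∃ s ∈ Set.Icc a₁ b₁, t = τ s := by
    intro t ht
    have hc : Continuous τ := (aff half 1).continuous.comp (aff 0 half).continuous
    obtain ⟨s, hs⟩ := mem_range_of_exists_le_of_exists_ge hc ⟨a₁, ht.1⟩ ⟨b₁, ht.2⟩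
    rw [← hs] at ht
    exact ⟨s, ⟨hτ.le_iff_le.1 ht.1, hτ.le_iff_le.1 ht.2⟩, hs.symm⟩
  let D₂ := D.replaceArc h.channel β hβ
  have hD₂ : ∀ t, D₂.path d t = β t := fun t => by
    rw [show D₂.path d = β from replaceArc_path_self]
  have hin : ∀ t, D₂.path d t ∈ ω' '' ellipse ↔ t ∈ Set.Ioo (τ a₁) (τ b₁) := by
    intro t
    rw [hD₂]
    constructor
    · intro ht
      obtain ⟨s, rfl⟩ := hβmem t (hω'f ht)
      rw [hβτ, hCe] at ht
      exact ⟨hτ ht.1, hτ ht.2⟩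
    · intro ht
      obtain ⟨s, -, rfl⟩ := hIcc t ⟨ht.1.le, ht.2.le⟩
      rw [hβτ, hCe]
      exact ⟨hτ.lt_iff_lt.1 ht.1, hτ.lt_iff_lt.1 ht.2⟩
  have hstart : D₂.path d (τ a₁) = ω' (-1) := by
    rw [hD₂, hβτ, hC]
    congr 1
    rw [show ((a₁ : ℝ) - 1 / 2) / q = -1 by simp only [a₁]; field_simp; ring]
    simp
  have hfinish : D₂.path d (τ b₁) = ω' 1 := by
    rw [hD₂, hβτ, hC]
    congr 1
    rw [show ((b₁ : ℝ) - 1 / 2) / q = 1 by simp only [b₁]; field_simp; ring]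
    simp
  obtain ⟨D₃, d₃, h1, h2, h3, h4⟩ := D₂.exists_inPosition (κ := κ)
    (unitInterval.nonneg'.trans_lt (hτ ha₁)) (hτ hab₁)
    ((hτ hb₁).trans_le unitInterval.le_one') hω' hstart hfinish hin
    (fun i hi t ht => by
      rw [show D₂.path i = D.path i from replaceArc_path_of_ne hi] at ht
      refine h.channel.alone i hi t ?_
      rw [image_stretch]
      exact hfe (hω'f ht))
    fun t _ => uncrossed_replaceArc h.channel hβ (by simp)
  refine ⟨D₃, d₃, p, c, hc, h1, h2.trans (h.represents_replaceArc hκ hβ), fun s hs => ?_,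
    fun s => ?_⟩
  · obtain ⟨t, ht, hst⟩ := h4 s hs
    obtain ⟨r, -, rfl⟩ := hIcc t ⟨ht.1.le, ht.2.le⟩
    have hr := (hCe r).2 ⟨hτ.lt_iff_lt.1 ht.1, hτ.lt_iff_lt.1 ht.2⟩
    rw [hC, hω'.injective.mem_set_image, ofReal_mem_ellipse] at hr
    rw [hst, hD₂, hβτ, hC]
    exact ⟨_, by rwa [mem_ball_zero_iff, Complex.norm_real, Real.norm_eq_abs], rfl⟩
  · obtain ⟨t, ht, hst⟩ := h3 s
    obtain ⟨r, -, rfl⟩ := hIcc t ht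
    rw [hst, hD₂, hβτ, hC]
    exact ⟨_, rfl⟩

/-- The value of a closed curve without crossings that bounds a disc. -/
theorem IsCircleRemoval.toSkein_eq {D : PieceDiagram S (n + 1)}
    {D' : PieceDiagram S n} (h : D.IsCircleRemoval D') :
    z • toSkein ⟨n + 1, D⟩ = (vInv - v) • toSkein ⟨n, D'⟩ := by
  have := S.t2
  obtain ⟨φ, κ, hκ, hd, hφ, hrange, hD⟩ := h.exists_addCircle
  obtain ⟨D₁, d₁, ω, hpos, hrep, hκω⟩ := D'.exists_inPosition_of_disjoint hd
  -- the curve in the chart `φ`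
  have hu' : ∀ t, ∃ w, ‖w‖ = 1 ∧ φ w = κ t := by
    intro t
    have : κ t ∈ φ '' Metric.sphere 0 1 := hrange ▸ Set.mem_range_self t
    obtain ⟨w, hw, hwt⟩ := this
    exact ⟨w, by simpa using hw, hwt⟩
  choose u hu huκ using hu'
  have huc : Continuous u := by
    rw [hφ.isInducing.continuous_iff, show φ ∘ u = κ from funext huκ]
    exact κ.continuous
  have hsurj : ∀ w, ‖w‖ = 1 → ∃ t, u t = w := by
    intro w hw
    have : φ w ∈ Set.range κ := hrange ▸ ⟨w, by simpa using hw, rfl⟩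
    obtain ⟨t, ht⟩ := this
    exact ⟨t, hφ.injective ((huκ t).trans ht)⟩
  -- moving a small copy of the curve to the chart `ω`
  obtain ⟨g, hg, hgp⟩ := reaches S (x := φ 0) (y := ω 0) ⟨φ, hφ, 0, rfl⟩ ⟨ω, hpos.emb, 0, rfl⟩
  have hopen : IsOpen ((g ∘ φ) ⁻¹' (ω '' Metric.ball 0 (1 / 2))) :=
    (hpos.emb.isOpenMap _ Metric.isOpen_ball).preimage (g.continuous.comp hφ.continuous)
  obtain ⟨ε, hε, hεω⟩ := Metric.isOpen_iff.1 hopen 0 ⟨0, by simp, hgp.symm⟩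
  have hε0 : ((ε / 2 : ℝ) : ℂ) ≠ 0 := Complex.ofReal_ne_zero.2 (by positivity)
  obtain ⟨g', hg', hg'φ⟩ := realises hφ hε0 0 1
  -- In the chart `f` the shrunk and moved curve is again the unit circle.
  let f : ℂ → F := fun w => g (φ (0 + (ε / 2 : ℝ) * w))
  have hf : IsOpenEmbedding f :=
    (g.isOpenEmbedding.comp hφ).comp (isOpenEmbedding_affine 0 hε0)
  have hsmall : f '' Metric.closedBall 0 1 ⊆ ω '' Metric.ball 0 (1 / 2) := by
    rintro _ ⟨w, hw, rfl⟩
    refine hεω ?_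
    rw [mem_closedBall_zero_iff] at hw
    rw [zero_add, mem_ball_zero_iff, norm_mul, Complex.norm_real, Real.norm_eq_abs,
      abs_of_pos (by positivity)]
    nlinarith
  obtain ⟨D₂, d₂, p, c, hc, hpos₂, hrep₂, hball, hreal⟩ :=
    hpos.exists_inPosition hf (by simpa [f] using hgp) hsmall hκω
  have hrep' := hrep₂.trans hrep
  rw [hD, ← hrep'.toSkein_eq, ← hrep'.toSkein_addCircle_eq hκ hd (hrep'.disjoint hd)]
  refine toSkein_addCircle_of_disc hf hc hpos₂ hball hreal hκ _ (hg'.trans hg) (u := ⟨u, huc⟩)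
    hu hsurj fun t => ?_
  rw [Homeomorph.trans_apply, ← huκ, hg'φ _ (hu t).le]
  simp [f]

end PieceDiagram

/-! ### Induction over the resolution tree -/

/-- Each vertex expresses its weighted diagram through the weighted diagrams of its children with
coefficients in `integral`; denominators never arise, because the weights compensate for the change
of `k`. -/
theorem weighted_mem_span {D : Diagram S} (T : ResolutionTree D) :
    weighted D ∈ Submodule.span integral (Set.range fun i => weighted (T.leaves.get i)) := by
  have hv : v ∈ integral := Subring.subset_closure (by simp)
  have hv' : vInv ∈ integral := Subring.subset_closure (by simp)
  have hz : z ∈ integral := Subring.subset_closure (by simp)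
  have smul_mem : ∀ {M : Submodule integral (Skein S)} {a : Coeff} {x : Skein S}, a ∈ integral →
      x ∈ M → a • x ∈ M := fun {M a x} ha hx => M.smul_mem ⟨a, ha⟩ hx
  -- Membership in place of positions, so that concatenating lists of leaves visibly enlarges the
  -- span.
  have hrange : ∀ L : List (Diagram S), (Set.range fun i => weighted (L.get i)) =
      {w | ∃ E ∈ L, weighted E = w} := by
    intro L
    ext w
    simp only [Set.mem_range, Set.mem_ofPred_eq, List.mem_iff_get]
    constructor
    · rintro ⟨i, h⟩; exact ⟨_, ⟨i, rfl⟩, h⟩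
    · rintro ⟨_, ⟨i, rfl⟩, h⟩; exact ⟨i, h⟩
  have span_mono : ∀ {L L' : List (Diagram S)}, L ⊆ L' →
      Submodule.span integral {w | ∃ E ∈ L, weighted E = w} ≤
        Submodule.span integral {w | ∃ E ∈ L', weighted E = w} := by
    intro L L' h
    refine Submodule.span_mono ?_
    rintro w ⟨E, hE, hw⟩
    exact ⟨E, h hE, hw⟩
  rw [hrange]
  induction T with
  | leaf D =>
    exact Submodule.subset_span ⟨D, by simp [ResolutionTree.leaves], rfl⟩
  | @crossing n D D' D₀ x y h' h₀ T' T₀ ih' ih₀ =>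
    have hk : k ⟨n, D'⟩ = k ⟨n, D⟩ := by
      simp only [k, PieceDiagram.numNull_eq, h'.nullSets_eq]
    -- The factor z of the skein relation makes `k D + 1` factors available, enough for the weight
    -- of the smoothing; `j` of them are left over.
    obtain ⟨j, hj⟩ : ∃ j, k ⟨n, D⟩ + 1 = j + k ⟨n, D₀⟩ :=
      ⟨_, (Nat.sub_add_cancel h₀.numNull_le).symm⟩
    have hw : z ^ k ⟨n, D⟩ • z • toSkein ⟨n, D₀⟩ = z ^ j • weighted ⟨n, D₀⟩ := by
      rw [weighted, smul_smul, smul_smul, ← pow_succ, hj, pow_add]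
    have hD' : weighted ⟨n, D'⟩ ∈ Submodule.span integral
        {w | ∃ E ∈ (ResolutionTree.crossing h' h₀ T' T₀).leaves, weighted E = w} :=
      span_mono (List.subset_append_left _ _) ih'
    have hD₀ : z ^ j • weighted ⟨n, D₀⟩ ∈ Submodule.span integral
        {w | ∃ E ∈ (ResolutionTree.crossing h' h₀ T' T₀).leaves, weighted E = w} :=
      smul_mem (pow_mem hz j)
        (span_mono (List.subset_append_right _ _) ih₀)
    rw [← hw] at hD₀
    rw [weighted, hk] at hD'
    rw [weighted]
    rcases D.isPositive_or_isNegative h'.1 with hs | hs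
    · rw [← hs.toSkein_switch h' h₀, smul_sub] at hD₀
      simpa using add_mem hD₀ hD'
    · rw [← hs.toSkein_switch h' h₀, smul_sub] at hD₀
      simpa using sub_mem hD' hD₀
  | @curlRemoval n D D' x y h T' ih =>
    obtain ⟨a, ha, -, -, -, hs⟩ := h.exists_unit
    have hk : k ⟨n, D'⟩ = k ⟨n, D⟩ := by
      simp only [k, PieceDiagram.numNull_eq, h.nullSets_eq]
    rw [weighted, hs, ← hk, smul_comm]
    exact smul_mem ha ih
  | @curlInsertion n D D' x y h T' ih =>
    obtain ⟨a, -, b, hb, hab, hs⟩ := h.exists_unit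
    have hk : k ⟨n, D⟩ = k ⟨n, D'⟩ := by
      simp only [k, PieceDiagram.numNull_eq, h.nullSets_eq]
    have : weighted ⟨n, D⟩ = b • weighted ⟨n, D'⟩ := by
      rw [weighted, weighted, hs, hk, smul_comm b, smul_smul b, mul_comm b, hab, one_smul]
    rw [this]
    exact smul_mem hb ih
  | @circleRemoval n D D' h T' ih =>
    have hk : k ⟨n + 1, D⟩ = k ⟨n, D'⟩ + 1 := h.numNull_eq
    -- One factor z of the weight is spent on the circle, which becomes `vInv - v`.
    rw [weighted, hk, pow_succ, mul_smul, h.toSkein_eq, smul_comm]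
    exact smul_mem (sub_mem hv' hv) ih
  | isotopy h T' ih =>
    rw [weighted, h.toSkein_eq, ← h.k_eq]
    exact ih

end HomflySkein

theorem mainTheorem2 {F : Type*} [TopologicalSpace F] (S : HomflySkein.MarkedSurface F)
    (D : HomflySkein.Diagram S) (T : HomflySkein.ResolutionTree D) :
    ∃ c : Fin T.leaves.length → HomflySkein.Coeff,
      (∀ i, c i ∈ HomflySkein.integral) ∧
      HomflySkein.z ^ HomflySkein.k D • HomflySkein.toSkein D =
        ∑ i, (c i * HomflySkein.z ^ HomflySkein.k (T.leaves.get i)) •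
          HomflySkein.toSkein (T.leaves.get i) := by
  obtain ⟨c, hc⟩ := (Submodule.mem_span_range_iff_exists_fun _).1
    (HomflySkein.weighted_mem_span T)
  refine ⟨fun i => c i, fun i => (c i).2, ?_⟩
  rw [← HomflySkein.weighted, ← hc]
  refine Finset.sum_congr rfl fun i _ => ?_
  rw [mul_smul]
  rfl
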